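/- For a finite simple graph $G=(V,E)$, a set $M\subseteq E$ is an edge dominating set if every edge of $E\setminus M$ shares an endpoint with an edge of $M$; it is minimal if no proper subset of $M$ is an edge dominating set. A tree decomposition of $G$ is a tree $T$ with bags $X_t\subseteq V$ ($t\in V(T)$) such that $\bigcup_t X_t=V$, every edge of $G$ has both endpoints in some bag, and $X_{t_1}\cap X_{t_2}\subseteq X_t$ whenever $t$ lies on the path of $T$ from $t_1$ to $t_2$; its width is $\max_t |X_t|-1$. A nice tree decomposition (with introduce edge nodes) is a tree decomposition with $T$ rooted at a node $r$ with $X_r=\emptyset$, in which every node $t$ is of one of the following types: a leaf (no children, $X_t=\emptyset$); an introduce node (one child $t'$, $X_t=X_{t'}\cup\{v\}$ with $v\notin X_{t'}$); a forget node (one child $t'$, $X_t=X_{t'}\setminus\{v\}$ with $v\in X_{t'}$); an introduce edge node (one child $t'$, $X_t=X_{t'}$, labelled with an edge $uv\in E$ with $u,v\in X_t$); a join node (exactly two children $t_1,t_2$, $X_t=X_{t_1}=X_{t_2}$); and every edge of $G$ is the label of exactly one introduce edge node. Theorem. There is an algorithm (a random access machine program, with time measured by logarithmic cost) that, given an $n$-vertex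 graph $G$ and a nice tree decomposition $T$ of $G$ of width at most $\omega$ whose number of nodes is polynomially bounded in $\omega$ and $n$ (for instance $O(\omega n)$), computes the maximum size of a minimal edge dominating set of $G$ in time $45^{\omega}\cdot n^{O(1)}$. Precisely: there is one program such that for every $K\in\mathbb{N}$ there are constants $C,c\in\mathbb{N}$ such that for all $n,\omega\in\mathbb{N}$, all graphs $G$ on $n$ vertices and all nice tree decompositions $T$ of $G$ of width at most $\omega$ with at most $K\cdot((\omega+1)(n+1))^{K}$ nodes, the program on input $(G,T)$ halts with the maximum size of a minimal edge dominating set of $G$ as output after time at most $C\cdot 45^{\omega}\cdot (n+1)^{c}$. -/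

import Mathlib

namespace UpperEDS

/-! ### Edge dominating sets -/

section Graph

variable {V : Type*}

/-- `M` is an edge dominating set of `G`: a set of edges such that every edge outside `M` shares
an endpoint with an edge of `M`. -/
def IsEdgeDominating (G : SimpleGraph V) (M : Finset (Sym2 V)) : Prop :=
  (M : Set (Sym2 V)) ⊆ G.edgeSet ∧
    ∀ e ∈ G.edgeSet, e ∉ M → ∃ f ∈ M, ∃ v, v ∈ e ∧ v ∈ f

/-- A minimal edge dominating set: no proper subset is an edge dominating set. -/
def IsMinimalEdgeDominating (G : SimpleGraph V) (M : Finset (Sym2 V)) : Prop :=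
  IsEdgeDominating G M ∧ ∀ M', M' ⊂ M → ¬ IsEdgeDominating G M'

/-- `k` is the maximum size of a minimal edge dominating set of `G`. -/
def IsUpperEDSNumber (G : SimpleGraph V) (k : ℕ) : Prop :=
  IsGreatest {m | ∃ M : Finset (Sym2 V), IsMinimalEdgeDominating G M ∧ M.card = m} k

end Graph

/-! ### Nice tree decompositions -/

/-- A tree decomposition of `G` whose tree has node set `ι`. -/
structure TreeDecomposition {V : Type*} [DecidableEq V] (G : SimpleGraph V) (ι : Type*) where
  tree : SimpleGraph ι
  isTree : tree.IsTree
  bag : ι → Finset V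
  cover : ∀ v, ∃ t, v ∈ bag t
  cover_edge : ∀ u v, G.Adj u v → ∃ t, u ∈ bag t ∧ v ∈ bag t
  interpolation : ∀ (t₁ t₂ : ι) (p : tree.Walk t₁ t₂), p.IsPath →
    ∀ t ∈ p.support, bag t₁ ∩ bag t₂ ⊆ bag t

/-- The width: the maximum of `|X_t| - 1` over the nodes `t`. -/
def TreeDecomposition.width {V : Type*} [DecidableEq V] {G : SimpleGraph V} {ι : Type*}
    [Fintype ι] (T : TreeDecomposition G ι) : ℤ :=
  ((Finset.univ.sup fun t => (T.bag t).card : ℕ) : ℤ) - 1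

/-- The children of `t` when `T` is rooted at `root`: the neighbours of `t` that are one step
farther away from the root. -/
def children {ι : Type*} (T : SimpleGraph ι) (root t : ι) : Set ι :=
  {s | T.Adj t s ∧ T.dist root s = T.dist root t + 1}

/-- The type of a node, with its children and the vertex or edge it is labelled with. -/
inductive NodeKind (V ι : Type*) where
  | leaf
  | introduceVertex (child : ι) (v : V)
  | introduceEdge (child : ι) (u v : V)
  | forget (child : ι) (v : V)
  | join (child₁ child₂ : ι)

/-- The condition that each type imposes on a node with bag `X t` and set of children `ch`. -/
def NodeKind.Valid {V : Type*} [DecidableEq V] {ι : Type*} (G : SimpleGraph V)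
    (X : ι → Finset V) (t : ι) (ch : Set ι) : NodeKind V ι → Prop
  | .leaf => ch = ∅ ∧ X t = ∅
  | .introduceVertex c v => ch = {c} ∧ v ∉ X c ∧ X t = insert v (X c)
  | .introduceEdge c u v => ch = {c} ∧ X t = X c ∧ G.Adj u v ∧ u ∈ X t ∧ v ∈ X t
  | .forget c v => ch = {c} ∧ v ∈ X c ∧ X t = (X c).erase v
  | .join c₁ c₂ => c₁ ≠ c₂ ∧ ch = {c₁, c₂} ∧ X t = X c₁ ∧ X t = X c₂

/-- A nice tree decomposition with introduce edge nodes. -/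
structure NiceTreeDecomposition {V : Type*} [DecidableEq V] (G : SimpleGraph V) (ι : Type*)
    extends TreeDecomposition G ι where
  root : ι
  root_bag : bag root = ∅
  kind : ι → NodeKind V ι
  kind_valid : ∀ t, (kind t).Valid G bag t (children tree root t)
  introduced_once : ∀ e ∈ G.edgeSet, ∃! t, ∃ c u v, kind t = .introduceEdge c u v ∧ s(u, v) = e

/-! ### Random access machines with logarithmic cost -/

/-- A machine state: registers and random access memory, both holding natural numbers. A program
mentions only finitely many registers; the memory is addressed indirectly. -/
structure State where
  reg : ℕ → ℕ
  mem : ℕ → ℕ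

def State.setReg (s : State) (r x : ℕ) : State := { s with reg := Function.update s.reg r x }

def State.setMem (s : State) (a x : ℕ) : State := { s with mem := Function.update s.mem a x }

/-- Arithmetic: addition, truncated subtraction, multiplication, integer division. -/
inductive Op where
  | add | sub | mul | div

def Op.eval : Op → ℕ → ℕ → ℕ
  | .add, x, y => x + y
  | .sub, x, y => x - y
  | .mul, x, y => x * y
  | .div, x, y => x / y

/-- Programs: single machine instructions, and control flow by tests of a register for zero. -/
inductive Prog where
  | skip
  | const (dst k : ℕ)
  | copy (dst src : ℕ)
  | arith (op : Op) (dst src₁ src₂ : ℕ)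
  | load (dst addr : ℕ)
  | store (addr src : ℕ)
  | seq (p q : Prog)
  | ifNonzero (r : ℕ) (p q : Prog)
  | whileNonzero (r : ℕ) (p : Prog)

/-- The logarithmic cost of handling the number `x`: its length in binary. -/
def len (x : ℕ) : ℕ := Nat.log 2 x + 1

/-- `Exec p s t s'`: started in state `s`, the program `p` halts in state `s'` after time `t`.
Each instruction costs the total binary length of the numbers it handles (addresses included). -/
inductive Exec : Prog → State → ℕ → State → Prop
  | skip (s : State) : Exec .skip s 1 s
  | const (s : State) (d k : ℕ) : Exec (.const d k) s (len k) (s.setReg d k)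
  | copy (s : State) (d r : ℕ) : Exec (.copy d r) s (len (s.reg r)) (s.setReg d (s.reg r))
  | arith (s : State) (op : Op) (d r₁ r₂ : ℕ) :
      Exec (.arith op d r₁ r₂) s (len (s.reg r₁) + len (s.reg r₂))
        (s.setReg d (op.eval (s.reg r₁) (s.reg r₂)))
  | load (s : State) (d a : ℕ) :
      Exec (.load d a) s (len (s.reg a) + len (s.mem (s.reg a)))
        (s.setReg d (s.mem (s.reg a)))
  | store (s : State) (a r : ℕ) :
      Exec (.store a r) s (len (s.reg a) + len (s.reg r)) (s.setMem (s.reg a) (s.reg r))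
  | seq {p q : Prog} {s s₁ s₂ : State} {t₁ t₂ : ℕ} :
      Exec p s t₁ s₁ → Exec q s₁ t₂ s₂ → Exec (.seq p q) s (t₁ + t₂) s₂
  | if_true {p q : Prog} {r : ℕ} {s s' : State} {t : ℕ} :
      s.reg r ≠ 0 → Exec p s t s' → Exec (.ifNonzero r p q) s (len (s.reg r) + t) s'
  | if_false {p q : Prog} {r : ℕ} {s s' : State} {t : ℕ} :
      s.reg r = 0 → Exec q s t s' → Exec (.ifNonzero r p q) s (len (s.reg r) + t) s'
  | while_true {p : Prog} {r : ℕ} {s s₁ s₂ : State} {t₁ t₂ : ℕ} :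
      s.reg r ≠ 0 → Exec p s t₁ s₁ → Exec (.whileNonzero r p) s₁ t₂ s₂ →
      Exec (.whileNonzero r p) s (len (s.reg r) + t₁ + t₂) s₂
  | while_false {p : Prog} {r : ℕ} {s : State} :
      s.reg r = 0 → Exec (.whileNonzero r p) s (len (s.reg r)) s

/-- The initial state on an input word: registers zero, the input in the first memory cells. -/
def initState (input : List ℕ) : State where
  reg := fun _ => 0
  mem := fun i => input.getD i 0

/-- On the given input, `p` halts after time `t` with `out` in register `0`. -/
def ComputesInTime (p : Prog) (input : List ℕ) (out t : ℕ) : Prop :=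
  ∃ s', Exec p (initState input) t s' ∧ s'.reg 0 = out

/-! ### The input: a graph on `Fin n` with a nice tree decomposition with node set `Fin N` -/

/-- The record of a node: type, children and label. -/
def encodeKind {n N : ℕ} : NodeKind (Fin n) (Fin N) → List ℕ
  | .leaf => [0, 0, 0, 0]
  | .introduceVertex c v => [1, c, v, 0]
  | .introduceEdge c u v => [2, c, u, v]
  | .forget c v => [3, c, v, 0]
  | .join c₁ c₂ => [4, c₁, c₂, 0]

open Classical in
/-- The input word: `n`, `N`, the root, the adjacency matrix of the graph, the adjacency matrix
of the tree, the `N × n` membership matrix of the bags, and the records of the nodes. -/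
noncomputable def encode {n N : ℕ} (G : SimpleGraph (Fin n))
    (T : NiceTreeDecomposition G (Fin N)) : List ℕ :=
  [n, N, (T.root : ℕ)] ++
  ((List.finRange n).flatMap fun i => (List.finRange n).map fun j =>
    if G.Adj i j then 1 else 0) ++
  ((List.finRange N).flatMap fun i => (List.finRange N).map fun j =>
    if T.tree.Adj i j then 1 else 0) ++
  ((List.finRange N).flatMap fun t => (List.finRange n).map fun v =>
    if v ∈ T.bag t then 1 else 0) ++
  ((List.finRange N).flatMap fun t => encodeKind (T.kind t))

end UpperEDS

/-! The proof replaces minimal edge dominating sets by local labellings and finds the best labelling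
by dynamic programming.

In a minimal edge dominating set `M` no edge has both ends covered by other edges of `M`
(`not_both_covered`), so `M` is a disjoint union of stars. A leaf of a star with at least two edges
has a neighbour that `M` leaves uncovered (`exists_uncovered`), and no two uncovered vertices are
adjacent. Conversely, a union of stars of this kind is minimal: an isolated edge, or the edge from a
leaf to its uncovered neighbour, loses its domination once the star edge is removed. Each vertex
thus gets one of four types, and must own exactly one chosen covering edge (unless uncovered) and,
if it is a leaf, exactly one chosen edge to an uncovered vertex. These choices are flags 2 and 3 on
edges. Since 2 and 5 are written as sums of 2s and 3s in only one way, "exactly one of each" becomes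
a condition on the sum of the flags. `IsSolution.exists_minimal` and `exists_isSolution` translate
in both directions.

Sums are additive over subtrees, so the state of a bag vertex is its type with the flag sum so far:
1 + 2 + 4 + 2 = 9 possibilities. Splitting a sum over two children gives 1 + 3 + 9 + 3 = 16
combinations (`exists_code`), and enumerating them over a bag costs a factor 16 per vertex. As 16 *
2 ≤ 45, a factor `2 ^ ω` is left to absorb powers of `ω + 1` (`exists_time_le`).

Correctness has two halves. Every nonzero table entry always comes from a genuine partial labelling
(`justified_candOf`). Relative to one fixed solution, a node whose children hold good entries has a
choice of codes that gives it a good entry (`IsSolution.exists_candOf`). Updates take maxima, so the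
order of the nodes is irrelevant and as many sweeps as there are nodes suffice (`does_roundsP`). The
tables lie sparsely in a memory that starts at zero, with 0 for "not realized"; words have length
linear in the numbers of vertices and nodes, so logarithmic cost adds only a polynomial factor. -/

namespace UpperEDS

/-! ### Structured programs -/

/-- Expressions over registers and memory. -/
inductive Ex where
  | num (k : ℕ)
  | reg (r : ℕ)
  | mem (a : Ex)
  | bin (op : Op) (a b : Ex)

namespace Ex

instance : Add Ex := ⟨bin .add⟩
instance : Sub Ex := ⟨bin .sub⟩
instance : Mul Ex := ⟨bin .mul⟩
instance : Div Ex := ⟨bin .div⟩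
instance (k : ℕ) : OfNat Ex k := ⟨num k⟩

/-- The value of an expression. -/
def eval : Ex → State → ℕ
  | num k, _ => k
  | reg r, s => s.reg r
  | mem a, s => s.mem (a.eval s)
  | bin op a b, s => op.eval (a.eval s) (b.eval s)

@[simp] theorem eval_num (k : ℕ) (s : State) : (num k).eval s = k := rfl
@[simp] theorem eval_ofNat (k : ℕ) [k.AtLeastTwo] (s : State) :
    (no_index (OfNat.ofNat k : Ex)).eval s = OfNat.ofNat k := rfl
@[simp] theorem eval_zero (s : State) : (0 : Ex).eval s = 0 := rfl
@[simp] theorem eval_one (s : State) : (1 : Ex).eval s = 1 := rfl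
@[simp] theorem eval_reg (r : ℕ) (s : State) : (reg r).eval s = s.reg r := rfl
@[simp] theorem eval_mem (a : Ex) (s : State) : (mem a).eval s = s.mem (a.eval s) := rfl
@[simp] theorem eval_add (a b : Ex) (s : State) : (a + b).eval s = a.eval s + b.eval s := rfl
@[simp] theorem eval_sub (a b : Ex) (s : State) : (a - b).eval s = a.eval s - b.eval s := rfl
@[simp] theorem eval_mul (a b : Ex) (s : State) : (a * b).eval s = a.eval s * b.eval s := rfl
@[simp] theorem eval_div (a b : Ex) (s : State) : (a / b).eval s = a.eval s / b.eval s := rfl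

/-- The remainder of a division. -/
def mod (a b : Ex) : Ex := a - b * (a / b)

@[simp] theorem eval_mod (a b : Ex) (s : State) : (a.mod b).eval s = a.eval s % b.eval s := by
  simp only [mod, eval_sub, eval_mul, eval_div]
  have := Nat.div_add_mod (a.eval s) (b.eval s)
  omega

/-- The test for equality, with value `1` or `0`. -/
def eq (a b : Ex) : Ex := 1 - ((a - b) + (b - a))

/-- The indicator of equality. -/
def eqInd (x y : ℕ) : ℕ := if x = y then 1 else 0

@[simp] theorem eval_eq (a b : Ex) (s : State) :
    (a.eq b).eval s = eqInd (a.eval s) (b.eval s) := by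
  simp only [eq, eval_sub, eval_add, eval_one, eqInd]
  split_ifs <;> omega

/-- The maximum. -/
def max (a b : Ex) : Ex := a + (b - a)

@[simp] theorem eval_max (a b : Ex) (s : State) :
    (a.max b).eval s = Max.max (a.eval s) (b.eval s) := by
  simp only [max, eval_sub, eval_add]
  omega

/-- The value of a function with finite support, given by its list of arguments and values. -/
def table (e : Ex) : List (ℕ × ℕ) → Ex
  | [] => 0
  | p :: l => (e.eq (num p.1)) * num p.2 + table e l

/-- The function with finite support given by a list of arguments and values. -/
def tableVal : List (ℕ × ℕ) → ℕ → ℕ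
  | [], _ => 0
  | p :: l, x => eqInd x p.1 * p.2 + tableVal l x

@[simp] theorem eval_table (e : Ex) (l : List (ℕ × ℕ)) (s : State) :
    (e.table l).eval s = tableVal l (e.eval s) := by
  induction l with
  | nil => rfl
  | cons p l ih => simp [table, tableVal, ih]

/-- A program that leaves the value of the expression in register `2 * d + 1` and otherwise
changes only registers with larger odd numbers. Register `r` of the expression is kept in
register `2 * r`. -/
def comp : Ex → ℕ → Prog
  | num k, d => .const (2 * d + 1) k
  | reg r, d => .copy (2 * d + 1) (2 * r)
  | mem a, d => .seq (a.comp d) (.load (2 * d + 1) (2 * d + 1))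
  | bin op a b, d =>
      .seq (a.comp d) (.seq (b.comp (d + 1)) (.arith op (2 * d + 1) (2 * d + 1) (2 * (d + 1) + 1)))

/-- A factor bounding the length of the value. -/
def wt : Ex → ℕ
  | num k => k + 1
  | reg _ => 1
  | mem a => a.wt + 1
  | bin _ a b => a.wt + b.wt + 1

/-- A factor bounding the time of the evaluation. -/
def cost : Ex → ℕ
  | num k => k + 1
  | reg _ => 1
  | mem a => a.cost + a.wt + 1
  | bin _ a b => a.cost + b.cost + a.wt + b.wt

end Ex

@[simp] theorem State.reg_setReg (s : State) (r x i : ℕ) :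
    (s.setReg r x).reg i = if i = r then x else s.reg i := by
  simp [State.setReg, Function.update_apply]

@[simp] theorem State.mem_setReg (s : State) (r x : ℕ) : (s.setReg r x).mem = s.mem := rfl

@[simp] theorem State.reg_setMem (s : State) (a x : ℕ) : (s.setMem a x).reg = s.reg := rfl

@[simp] theorem State.mem_setMem (s : State) (a x i : ℕ) :
    (s.setMem a x).mem i = if i = a then x else s.mem i := by
  simp [State.setMem, Function.update_apply]

/-- All numbers in the state have at most `l` binary digits. -/
def Bnd (l : ℕ) (s : State) : Prop := (∀ r, s.reg r < 2 ^ l) ∧ ∀ a, s.mem a < 2 ^ l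

/-- The machine state `m` represents `s`. -/
def Rel (m s : State) : Prop := (∀ r, m.reg (2 * r) = s.reg r) ∧ m.mem = s.mem

theorem len_le {x l : ℕ} (hl : 0 < l) (hx : x < 2 ^ l) : len x ≤ l := by
  unfold len
  rcases Nat.eq_zero_or_pos x with rfl | h
  · simpa using Nat.succ_le_of_lt hl
  · exact Nat.log_lt_of_lt_pow h.ne' hx

/-! ### Evaluation of expressions on the machine -/

namespace Ex

theorem wt_pos (e : Ex) : 0 < e.wt := by cases e <;> simp [wt]

/-- An operation at most adds the lengths of its operands and one more digit. Intermediate values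
may therefore exceed `2 ^ l`, but their length stays within a multiple of `l` fixed by the
expression. -/
theorem eval_lt (e : Ex) {l : ℕ} {s : State} (hl : 0 < l) (hs : Bnd l s) :
    e.eval s < 2 ^ (e.wt * l) := by
  induction e with
  | num k =>
    calc k < k + 1 := by omega
      _ < 2 ^ (k + 1) := Nat.lt_two_pow_self
      _ ≤ 2 ^ ((k + 1) * l) := Nat.pow_le_pow_right (by norm_num) (Nat.le_mul_of_pos_right _ hl)
  | reg r => simpa [wt] using hs.1 r
  | mem a =>
    exact lt_of_lt_of_le (hs.2 _) (Nat.pow_le_pow_right (by norm_num)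
      (Nat.le_mul_of_pos_left _ (by simp [wt])))
  | bin op a b iha ihb =>
    have key : ∀ x y i j : ℕ, x < 2 ^ i → y < 2 ^ j → op.eval x y < 2 ^ (i + j + 1) := by
      intro x y i j hx hy
      have h1 : 1 ≤ 2 ^ i := Nat.one_le_two_pow
      have h2 : 1 ≤ 2 ^ j := Nat.one_le_two_pow
      have h4 : x * y ≤ 2 ^ i * 2 ^ j := Nat.mul_le_mul hx.le hy.le
      have h5 : 2 ^ i * 1 ≤ 2 ^ i * 2 ^ j := Nat.mul_le_mul_left _ h2
      have h6 : 1 * 2 ^ j ≤ 2 ^ i * 2 ^ j := Nat.mul_le_mul_right _ h1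
      have h7 : x / y ≤ x := Nat.div_le_self _ _
      rw [pow_succ, pow_add]
      cases op <;> simp only [Op.eval] <;> omega
    refine lt_of_lt_of_le (key _ _ _ _ iha ihb) (Nat.pow_le_pow_right (by norm_num) ?_)
    simp only [wt]
    nlinarith

/-- The odd registers form an evaluation stack, and the even ones, which carry the represented
state, are never written. The clause on the stack cells below `d` keeps the first operand intact
while the second is evaluated one level higher. -/
theorem exec_comp (e : Ex) {l : ℕ} {s : State} (hl : 0 < l) (hs : Bnd l s) (d : ℕ) (m : State)
    (hm : Rel m s) :
    ∃ t m', Exec (e.comp d) m t m' ∧ Rel m' s ∧ m'.reg (2 * d + 1) = e.eval s ∧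
      (∀ i < d, m'.reg (2 * i + 1) = m.reg (2 * i + 1)) ∧ t ≤ e.cost * l := by
  induction e generalizing d m with
  | num k =>
    refine ⟨_, _, Exec.const _ _ _, ⟨fun r => ?_, hm.2⟩, by simp, fun i hi => ?_, ?_⟩
    · rw [State.reg_setReg, if_neg (by omega), hm.1]
    · rw [State.reg_setReg, if_neg (by omega)]
    · have := len_le (Nat.succ_pos k) ((Nat.lt_two_pow_self (n := k)).trans (Nat.pow_lt_pow_right
        (by norm_num) (Nat.lt_succ_self k)))
      exact this.trans (Nat.le_mul_of_pos_right _ hl)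
  | reg r =>
    refine ⟨_, _, Exec.copy _ _ _, ⟨fun r => ?_, hm.2⟩, by simp [hm.1], fun i hi => ?_, ?_⟩
    · rw [State.reg_setReg, if_neg (by omega), hm.1]
    · rw [State.reg_setReg, if_neg (by omega)]
    · rw [hm.1]
      simpa [cost] using len_le hl (hs.1 r)
  | mem a iha =>
    obtain ⟨t, m', h, hr, hv, hf, ht⟩ := iha d m hm
    refine ⟨_, _, Exec.seq h (Exec.load _ _ _), ⟨fun r => ?_, hr.2⟩, ?_, fun i hi => ?_, ?_⟩
    · rw [State.reg_setReg, if_neg (by omega), hr.1]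
    · simp [hv, hr.2]
    · rw [State.reg_setReg, if_neg (by omega), hf i hi]
    · rw [hv, hr.2]
      have h1 := len_le (Nat.mul_pos a.wt_pos hl) (a.eval_lt hl hs)
      have h2 := len_le hl (hs.2 (a.eval s))
      simp only [cost, add_mul, one_mul]
      omega
  | bin op a b iha ihb =>
    obtain ⟨t, m', h, hr, hv, hf, ht⟩ := iha d m hm
    obtain ⟨t', m'', h', hr', hv', hf', ht'⟩ := ihb (d + 1) m' hr
    refine ⟨_, _, Exec.seq h (Exec.seq h' (Exec.arith _ _ _ _ _)), ⟨fun r => ?_, hr'.2⟩, ?_,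
      fun i hi => ?_, ?_⟩
    · rw [State.reg_setReg, if_neg (by omega), hr'.1]
    · simp [hv', hf' d (by omega), hv, eval]
    · rw [State.reg_setReg, if_neg (by omega), hf' i (by omega), hf i hi]
    · rw [hv', hf' d (by omega), hv]
      have h1 := len_le (Nat.mul_pos a.wt_pos hl) (a.eval_lt hl hs)
      have h2 := len_le (Nat.mul_pos b.wt_pos hl) (b.eval_lt hl hs)
      simp only [cost, add_mul]
      omega

end Ex

/-- Assignment to a register. -/
def setP (r : ℕ) (e : Ex) : Prog := .seq (e.comp 0) (.copy (2 * r) 1)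

/-- Assignment to a memory cell. -/
def putP (a e : Ex) : Prog := .seq (a.comp 0) (.seq (e.comp 1) (.store 1 3))

/-- Branching. -/
def iteP (e : Ex) (p q : Prog) : Prog := .seq (e.comp 0) (.ifNonzero 1 p q)

/-- The loop in which register `r` runs downwards through the numbers below `e`. -/
def loopP (r : ℕ) (e : Ex) (p : Prog) : Prog :=
  .seq (setP r e) (.whileNonzero (2 * r) (.seq (setP r (.reg r - 1)) p))

infixr:60 ";;" => Prog.seq

/-- Started in a state that represents `s`, the program `p` halts within time `k * l` in a state
that represents one with property `Q`; all numbers stay below `2 ^ l`. -/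
def Does (l : ℕ) (p : Prog) (s : State) (k : ℕ) (Q : State → Prop) : Prop :=
  Bnd l s → ∀ m, Rel m s → ∃ t m' s', Exec p m t m' ∧ Rel m' s' ∧ Bnd l s' ∧ Q s' ∧ t ≤ k * l

/-! ### Rules for time-bounded execution -/

namespace Does

variable {l k k₁ k₂ : ℕ} {p q : Prog} {s : State} {Q R : State → Prop}

theorem mono (h : Does l p s k₁ Q) (hk : k₁ ≤ k₂) (hQ : ∀ s, Q s → R s) : Does l p s k₂ R := by
  intro hs m hm
  obtain ⟨t, m', s', h1, h2, h3, h4, h5⟩ := h hs m hm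
  exact ⟨t, m', s', h1, h2, h3, hQ _ h4, h5.trans (Nat.mul_le_mul_right _ hk)⟩

theorem of_bnd (h : Bnd l s → Does l p s k Q) : Does l p s k Q := fun hs => h hs hs

theorem seq (h : Does l p s k₁ Q) (h' : ∀ s', Q s' → Does l q s' k₂ R) :
    Does l (p ;; q) s (k₁ + k₂) R := by
  intro hs m hm
  obtain ⟨t, m', s', h1, h2, h3, h4, h5⟩ := h hs m hm
  obtain ⟨t', m'', s'', g1, g2, g3, g4, g5⟩ := h' s' h4 h3 m' h2
  exact ⟨_, m'', s'', h1.seq g1, g2, g3, g4, by rw [add_mul]; omega⟩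

theorem set (hl : 0 < l) {r : ℕ} {e : Ex} (he : e.eval s < 2 ^ l) :
    Does l (setP r e) s (e.cost + 1) fun s' => s' = s.setReg r (e.eval s) := by
  intro hs m hm
  obtain ⟨t, m', h, hr, hv, -, ht⟩ := e.exec_comp hl hs 0 m hm
  refine ⟨_, _, s.setReg r (e.eval s), h.seq (Exec.copy _ _ _), ⟨fun i => ?_, hr.2⟩,
    ⟨fun i => ?_, hs.2⟩, rfl, ?_⟩
  · simp only [mul_zero, zero_add] at hv
    simp only [State.reg_setReg, hv, hr.1]
    split_ifs <;> first | rfl | omega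
  · rw [State.reg_setReg]
    split_ifs
    exacts [he, hs.1 i]
  · simp only [mul_zero, zero_add] at hv
    rw [hv, add_mul, one_mul]
    exact add_le_add ht (len_le hl he)

theorem set_seq (hl : 0 < l) {r : ℕ} {e : Ex} (he : Bnd l s → e.eval s < 2 ^ l)
    (h : Does l q (s.setReg r (e.eval s)) k R) :
    Does l (setP r e ;; q) s (e.cost + 1 + k) R :=
  of_bnd fun hs => (set hl (he hs)).seq fun _ hs' => hs' ▸ h

theorem put (hl : 0 < l) {a e : Ex} (he : e.eval s < 2 ^ l) :
    Does l (putP a e) s (a.cost + e.cost + a.wt + 1)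
      fun s' => s' = s.setMem (a.eval s) (e.eval s) := by
  intro hs m hm
  obtain ⟨t, m', h, hr, hv, -, ht⟩ := a.exec_comp hl hs 0 m hm
  obtain ⟨t', m'', h', hr', hv', hf', ht'⟩ := e.exec_comp hl hs 1 m' hr
  have ha := hf' 0 (by norm_num)
  simp only [mul_zero, zero_add] at hv ha
  simp only [mul_one, Nat.reduceAdd] at hv'
  refine ⟨_, _, s.setMem (a.eval s) (e.eval s), h.seq (h'.seq (Exec.store _ _ _)),
    ⟨fun i => ?_, ?_⟩, ⟨hs.1, fun i => ?_⟩,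
    rfl, ?_⟩
  · simp [hr'.1]
  · simp [State.setMem, hr'.2, ha, hv, hv']
  · rw [State.mem_setMem]
    split_ifs
    exacts [he, hs.2 i]
  · have h1 := len_le (Nat.mul_pos a.wt_pos hl) (a.eval_lt hl hs)
    have h2 := len_le hl he
    rw [ha, hv, hv']
    simp only [add_mul, one_mul]
    omega

theorem ite (hl : 0 < l) {e : Ex} (h₁ : e.eval s ≠ 0 → Does l p s k Q)
    (h₂ : e.eval s = 0 → Does l q s k Q) :
    Does l (iteP e p q) s (e.cost + e.wt + k) Q := by
  intro hs m hm
  obtain ⟨t, m', h, hr, hv, -, ht⟩ := e.exec_comp hl hs 0 m hm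
  simp only [mul_zero, zero_add] at hv
  have h1 := len_le (Nat.mul_pos e.wt_pos hl) (e.eval_lt hl hs)
  by_cases hz : e.eval s = 0
  · obtain ⟨t', m'', s', g1, g2, g3, g4, g5⟩ := h₂ hz hs m' hr
    refine ⟨_, m'', s', h.seq (Exec.if_false (hv.trans hz) g1), g2, g3, g4, ?_⟩
    rw [hv]
    simp only [add_mul]
    omega
  · obtain ⟨t', m'', s', g1, g2, g3, g4, g5⟩ := h₁ hz hs m' hr
    refine ⟨_, m'', s', h.seq (Exec.if_true (hv ▸ hz) g1), g2, g3, g4, ?_⟩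
    rw [hv]
    simp only [add_mul]
    omega

theorem ite_of_ne (hl : 0 < l) {e : Ex} (he : e.eval s ≠ 0) (h : Does l p s k Q) :
    Does l (iteP e p q) s (e.cost + e.wt + k) Q :=
  ite hl (fun _ => h) fun h' => absurd h' he

theorem ite_of_eq (hl : 0 < l) {e : Ex} (he : e.eval s = 0) (h : Does l q s k Q) :
    Does l (iteP e p q) s (e.cost + e.wt + k) Q :=
  ite hl (fun h' => absurd he h') fun _ => h

theorem skip (hl : 0 < l) : Does l .skip s 1 fun s' => s' = s := fun hs m hm =>
  ⟨_, _, _, Exec.skip m, hm, hs, rfl, by omega⟩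

/-- The counter is the index of the invariant and is already lowered when the body starts, so one
pass leads from `Inv (j + 1)` to `Inv j`. The 8 in the bound pays for the test (1) and the decrement
(7). -/
theorem loop (hl : 0 < l) {r : ℕ} {e : Ex} (Inv : ℕ → State → Prop) (he : e.eval s < 2 ^ l)
    (h0 : Inv (e.eval s) (s.setReg r (e.eval s)))
    (hr : ∀ j s', Inv j s' → s'.reg r = j)
    (hstep : ∀ j s', j < e.eval s → Inv (j + 1) s' → Does l p (s'.setReg r j) k (Inv j)) :
    Does l (loopP r e p) s (e.cost + 2 + e.eval s * (k + 8)) (Inv 0) := by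
  have hw : ∀ j ≤ e.eval s, ∀ s', Inv j s' →
      Does l (.whileNonzero (2 * r) (setP r (.reg r - 1) ;; p)) s' (1 + j * (k + 8)) (Inv 0) := by
    intro j
    induction j with
    | zero =>
      intro _ s' hi hs m hm
      have hz : m.reg (2 * r) = 0 := by rw [hm.1, hr _ _ hi]
      refine ⟨_, m, s', Exec.while_false hz, hm, hs, hi, ?_⟩
      rw [hz]
      simp [len]
      omega
    | succ j ih =>
      intro hj s' hi hs m hm
      have hz : m.reg (2 * r) = j + 1 := by rw [hm.1, hr _ _ hi]
      have hb : j + 1 < 2 ^ l := by rw [← hr _ _ hi]; exact hs.1 r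
      have hd : Does l (setP r (.reg r - 1) ;; p) s' (7 + k) (Inv j) := by
        refine (set_seq (k := k) hl (fun hs => ?_) ?_).mono ?_ fun _ h => h
        · simp only [Ex.eval_sub, Ex.eval_reg, Ex.eval_one, hr _ _ hi]
          omega
        · simpa [hr _ _ hi] using hstep j s' (by omega) hi
        · change 1 + (1 + 1) + 1 + (1 + 1) + 1 + k ≤ _ + k
          omega
      obtain ⟨t₁, m₁, s₁, a1, a2, a3, a4, a5⟩ := hd hs m hm
      obtain ⟨t₂, m₂, s₂, b1, b2, b3, b4, b5⟩ := ih (by omega) s₁ a4 a3 m₁ a2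
      refine ⟨_, m₂, s₂, Exec.while_true (by omega) a1 b1, b2, b3, b4, ?_⟩
      have := len_le hl hb
      rw [hz]
      nlinarith
  refine ((set hl he).seq (R := Inv 0) (k₂ := 1 + e.eval s * (k + 8)) ?_).mono (by omega)
    fun _ h => h
  rintro _ rfl
  exact hw _ le_rfl _ h0

end Does

/-- A sequence of assignments to registers. -/
def assigns : List (ℕ × Ex) → Prog
  | [] => .skip
  | p :: L => setP p.1 p.2 ;; assigns L

/-- The state after a sequence of assignments. -/
def runAssigns : List (ℕ × Ex) → State → State
  | [], s => s
  | p :: L, s => runAssigns L (s.setReg p.1 (p.2.eval s))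

/-- All the assigned values are below `2 ^ l`. -/
def AssignsLt (l : ℕ) : List (ℕ × Ex) → State → Prop
  | [], _ => True
  | p :: L, s => p.2.eval s < 2 ^ l ∧ AssignsLt l L (s.setReg p.1 (p.2.eval s))

/-- A factor bounding the time of a sequence of assignments. -/
def assignsCost : List (ℕ × Ex) → ℕ
  | [] => 1
  | p :: L => p.2.cost + 1 + assignsCost L

theorem Does.assigns {l : ℕ} (hl : 0 < l) {L : List (ℕ × Ex)} {s : State} (h : AssignsLt l L s) :
    Does l (assigns L) s (assignsCost L) fun s' => s' = runAssigns L s := by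
  induction L generalizing s with
  | nil => exact Does.skip hl
  | cons p L ih => exact Does.set_seq hl (fun _ => h.1) (ih h.2)

/-! ### Descendants in a rooted tree -/

namespace NiceTreeDecomposition

variable {V : Type*} [DecidableEq V] {G : SimpleGraph V} {ι : Type*}
  (T : NiceTreeDecomposition G ι)

/-- The node `c` is a child of `t`. -/
def IsChild (t c : ι) : Prop := c ∈ children T.tree T.root t

variable {T} in
theorem IsChild.dist {t c : ι} (h : T.IsChild t c) :
    T.tree.dist T.root c = T.tree.dist T.root t + 1 := h.2

-- A shortest walk from the root to the parent, extended by the edge to `c`, is again shortest and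
-- hence a path; its penultimate node is the parent, and paths in a tree are unique.
variable {T} in
theorem IsChild.unique {a b c : ι} (ha : T.IsChild a c) (hb : T.IsChild b c) : a = b := by
  have key : ∀ {a}, T.IsChild a c →
      ∃ p : T.tree.Walk T.root c, p.IsPath ∧ p.penultimate = a := by
    intro a ha
    obtain ⟨p, hp⟩ := T.isTree.connected.exists_walk_length_eq_dist T.root a
    refine ⟨p.concat ha.1, SimpleGraph.Walk.isPath_of_length_eq_dist _ ?_, by simp⟩
    rw [SimpleGraph.Walk.length_concat, hp, ha.dist]
  obtain ⟨p, hp, rfl⟩ := key ha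
  obtain ⟨q, hq, rfl⟩ := key hb
  rw [(T.isTree.existsUnique_path T.root c).unique hp hq]

variable {T} in
theorem isChild_or_of_adj {a b : ι} (h : T.tree.Adj a b) : T.IsChild a b ∨ T.IsChild b a := by
  rcases T.isTree.dist_eq_dist_add_one_of_adj T.root h with h' | h'
  · exact .inr ⟨h.symm, h'⟩
  · exact .inl ⟨h, h'⟩

variable [Fintype ι]

open Classical in
/-- The nodes of the subtree rooted at `t`. -/
noncomputable def desc (t : ι) : Finset ι :=
  Finset.univ.filter (Relation.ReflTransGen T.IsChild t)

variable {T}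

theorem mem_desc {t s : ι} : s ∈ T.desc t ↔ Relation.ReflTransGen T.IsChild t s := by
  classical simp [desc]

theorem self_mem_desc (t : ι) : t ∈ T.desc t := mem_desc.2 .refl

theorem dist_le_of_mem_desc {t s : ι} (h : s ∈ T.desc t) :
    T.tree.dist T.root t ≤ T.tree.dist T.root s := by
  rw [mem_desc] at h
  induction h with
  | refl => rfl
  | tail _ h ih => rw [h.dist]; omega

/-- A path visits every node at most once. This is what limits the number of sweeps of the program.
-/
theorem dist_root_lt (t : ι) : T.tree.dist T.root t < Fintype.card ι := by
  obtain ⟨p, hp, hl⟩ := T.isTree.connected.exists_path_of_dist T.root t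
  exact hl ▸ hp.length_lt

/-- The next node on a shortest walk towards the root can only be the parent, so induction on the
distance applies. -/
theorem mem_desc_root (s : ι) : s ∈ T.desc T.root := by
  induction hd : T.tree.dist T.root s generalizing s with
  | zero =>
    rw [T.isTree.connected.dist_eq_zero_iff] at hd
    exact hd ▸ self_mem_desc _
  | succ d ih =>
    obtain ⟨p, hp⟩ := T.isTree.connected.exists_walk_length_eq_dist s T.root
    cases p with
    | nil => simp at hd
    | cons h q =>
      rename_i w
      rw [SimpleGraph.dist_comm, hd, SimpleGraph.Walk.length_cons] at hp
      have h1 : T.tree.dist T.root w ≤ d := by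
        rw [SimpleGraph.dist_comm]
        exact (SimpleGraph.dist_le q).trans (by omega)
      rcases isChild_or_of_adj h with h2 | h2
      · have := h2.dist
        omega
      · exact mem_desc.2 ((mem_desc.1 (ih w (by have := h2.dist; omega))).tail h2)

theorem mem_desc_iff {t s : ι} : s ∈ T.desc t ↔ s = t ∨ ∃ c, T.IsChild t c ∧ s ∈ T.desc c := by
  simp only [mem_desc]
  rw [Relation.ReflTransGen.cases_head_iff, eq_comm]

theorem IsChild.notMem_desc {t c : ι} (h : T.IsChild t c) : t ∉ T.desc c := fun h' => by
  have := dist_le_of_mem_desc h'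
  have := h.dist
  omega

/-- The parent of a node of a subtree other than its root belongs to the subtree. -/
theorem parent_mem_desc {c a b : ι} (ha : a ∈ T.desc c) (hac : a ≠ c) (h : T.IsChild b a) :
    b ∈ T.desc c := by
  rw [mem_desc, Relation.ReflTransGen.cases_tail_iff] at ha
  rcases ha with rfl | ⟨b', h1, h2⟩
  · exact absurd rfl hac
  · exact h.unique h2 ▸ mem_desc.2 h1

/-- Membership in the subtree of `c₂` passes to parents, so a common node would lift along its chain
to `c₁` and then to `t`, which is not a descendant of its own child. -/
theorem disjoint_desc {t c₁ c₂ : ι} (h₁ : T.IsChild t c₁) (h₂ : T.IsChild t c₂) (hne : c₁ ≠ c₂) :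
    Disjoint (T.desc c₁) (T.desc c₂) := by
  rw [Finset.disjoint_left]
  intro s hs1 hs2
  rw [mem_desc] at hs1
  induction hs1 with
  | refl => exact h₂.notMem_desc (parent_mem_desc hs2 hne h₁)
  | tail h h' ih =>
    rename_i a b
    refine ih (parent_mem_desc hs2 ?_ h')
    rintro rfl
    have := h₂.unique h'
    subst this
    exact h₁.notMem_desc (mem_desc.2 h)

/-- The edge from a node to its child `c` separates the subtree of `c` from the other nodes. -/
theorem IsChild.bag_inter {t c s s' : ι} (h : T.IsChild t c) (hs : s ∈ T.desc c)
    (hs' : s' ∉ T.desc c) {x : V} (hx : x ∈ T.bag s) (hx' : x ∈ T.bag s') :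
    x ∈ T.bag c ∧ x ∈ T.bag t := by
  obtain ⟨p, hp, -⟩ := T.isTree.existsUnique_path s s'
  -- A walk that leaves the subtree of `c` must use the edge between `c` and its parent `t`.
  have key : ∀ {s} (p : T.tree.Walk s s'), s ∈ T.desc c → c ∈ p.support ∧ t ∈ p.support := by
    intro s p
    induction p with
    | nil => exact fun h => absurd h hs'
    | cons hab q ih =>
      rename_i a b _
      intro ha
      by_cases hb : b ∈ T.desc c
      · have := ih hs' hx' p hp hb
        simp [this.1, this.2]
      · have hba : T.IsChild b a := (isChild_or_of_adj hab).resolve_left fun h' =>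
          hb (mem_desc.2 ((mem_desc.1 ha).tail h'))
        have hac : a = c := by
          by_contra hac
          exact hb (parent_mem_desc ha hac hba)
        subst hac
        have := h.unique hba
        subst this
        simp
  have hmem : x ∈ T.bag s ∩ T.bag s' := Finset.mem_inter.2 ⟨hx, hx'⟩
  exact ⟨T.interpolation s s' p hp c (key p hs).1 hmem,
    T.interpolation s s' p hp t (key p hs).2 hmem⟩

variable (T) in
/-- The vertex occurs in a bag of the subtree rooted at `t`. -/
def Below (t : ι) (x : V) : Prop := ∃ s ∈ T.desc t, x ∈ T.bag s

theorem below_root (x : V) : T.Below T.root x :=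
  let ⟨t, ht⟩ := T.cover x
  ⟨t, mem_desc_root t, ht⟩

theorem below_of_mem {t : ι} {x : V} (h : x ∈ T.bag t) : T.Below t x := ⟨t, self_mem_desc t, h⟩

theorem IsChild.mem_bag_of_below {t c : ι} (h : T.IsChild t c) {x : V} (hx : x ∈ T.bag t)
    (hb : T.Below c x) : x ∈ T.bag c :=
  let ⟨_, hs, hxs⟩ := hb
  (h.bag_inter hs h.notMem_desc hxs hx).1

/-- The equations for a node with one child. -/
theorem desc_of_children_eq_singleton [DecidableEq ι] {t c : ι}
    (h : children T.tree T.root t = {c}) :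
    T.IsChild t c ∧ T.desc t = insert t (T.desc c) := by
  have hc : ∀ c', T.IsChild t c' ↔ c' = c := fun c' => by
    rw [IsChild, h, Set.mem_singleton_iff]
  refine ⟨(hc c).2 rfl, ?_⟩
  ext s
  rw [mem_desc_iff, Finset.mem_insert]
  simp [hc]

theorem below_iff_of_children_eq_singleton {t c : ι} (h : children T.tree T.root t = {c}) (x : V) :
    T.Below t x ↔ x ∈ T.bag t ∨ T.Below c x := by
  classical
  simp [Below, (desc_of_children_eq_singleton h).2]

/-- The equations for a node with two children. -/
theorem desc_of_children_eq_pair [DecidableEq ι] {t c₁ c₂ : ι}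
    (h : children T.tree T.root t = {c₁, c₂}) :
    T.IsChild t c₁ ∧ T.IsChild t c₂ ∧ T.desc t = insert t (T.desc c₁ ∪ T.desc c₂) := by
  have hc : ∀ c', T.IsChild t c' ↔ c' = c₁ ∨ c' = c₂ := fun c' => by
    rw [IsChild, h]; simp
  refine ⟨(hc c₁).2 (.inl rfl), (hc c₂).2 (.inr rfl), ?_⟩
  ext s
  rw [mem_desc_iff, Finset.mem_insert]
  simp [hc, or_and_right, exists_or]

theorem below_iff_of_children_eq_pair {t c₁ c₂ : ι} (h : children T.tree T.root t = {c₁, c₂})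
    (x : V) : T.Below t x ↔ x ∈ T.bag t ∨ T.Below c₁ x ∨ T.Below c₂ x := by
  classical
  simp [Below, (desc_of_children_eq_pair h).2.2, or_and_right, exists_or]

/-- A path between two child subtrees runs through `t`. Labellings of the two sides of a join
therefore overlap only on the bag. -/
theorem mem_bag_of_below_of_below {t c₁ c₂ : ι} (h₁ : T.IsChild t c₁) (h₂ : T.IsChild t c₂)
    (hne : c₁ ≠ c₂) {x : V} (hx₁ : T.Below c₁ x) (hx₂ : T.Below c₂ x) : x ∈ T.bag t := by
  obtain ⟨s₁, hs₁, hx₁⟩ := hx₁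
  obtain ⟨s₂, hs₂, hx₂⟩ := hx₂
  exact (h₁.bag_inter hs₁ (Finset.disjoint_right.1 (disjoint_desc h₁ h₂ hne) hs₂) hx₁ hx₂).2

theorem desc_of_children_eq_empty {t : ι} (h : children T.tree T.root t = ∅) :
    T.desc t = {t} := by
  ext s
  rw [mem_desc_iff]
  simp [IsChild, h]

end NiceTreeDecomposition

open Ex (tableVal)

/-! ### Labellings

A vertex has type `0` if no edge of the solution covers it, `1` if it is the centre of a star of
the solution, `2` if it is a leaf of such a star, and `3` if it belongs to an isolated edge.
At each of its end points an edge carries a flag: `2` if it is the chosen edge of the solution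
covering the end point, `3` if it is the chosen edge from a leaf to an uncovered vertex. -/

/-- The admissible edges: the types and flags of the end points `a` and `b` are encoded as
`(6 * type + flag)`, the argument is `24 * a + b`; the value is `2` for an edge of the solution
and `1` for another edge. -/
def edgeTable : List (ℕ × ℕ) :=
  [(24 * 0 + 6, 1), (24 * 0 + 12, 1), (24 * 0 + 18, 1),
   (24 * 6 + 0, 1), (24 * 6 + 6, 1), (24 * 6 + 12, 1), (24 * 6 + 18, 1),
   (24 * 12 + 0, 1), (24 * 12 + 6, 1), (24 * 12 + 12, 1), (24 * 12 + 18, 1),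
   (24 * 18 + 0, 1), (24 * 18 + 6, 1), (24 * 18 + 12, 1), (24 * 18 + 18, 1),
   (24 * 15 + 0, 1), (24 * 0 + 15, 1),
   (24 * 6 + 14, 2), (24 * 8 + 14, 2), (24 * 14 + 6, 2), (24 * 14 + 8, 2),
   (24 * 20 + 20, 2)]

/-- The value of an edge with encoded end points `a` and `b`; `0` if it is not admissible. -/
def edgeVal (a b : ℕ) : ℕ := tableVal edgeTable (24 * a + b)

theorem edgeVal_def (a b : ℕ) : edgeVal a b = tableVal edgeTable (24 * a + b) := rfl

/-- The sum of the flags that a vertex of the given type needs. -/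
def full (τ : ℕ) : ℕ := (if τ = 0 then 0 else 2) + if τ = 2 then 3 else 0

theorem edgeVal_comm {a b : ℕ} (ha : a < 24) (hb : b < 24) : edgeVal a b = edgeVal b a := by
  have : ∀ a b : Fin 24, edgeVal a b = edgeVal b a := by decide +kernel
  exact this ⟨a, ha⟩ ⟨b, hb⟩

-- All that the correctness proof needs from `edgeTable`, settled by exhausting 4 · 4 · 6 · 6 cases.
-- In terms of the graph: flag 2 occurs only on solution edges, flag 3 only from a leaf to an
-- uncovered vertex, uncovered vertices are not adjacent, and a solution edge is flagged at each end
-- that is not a centre.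
set_option synthInstance.maxSize 1000 in
set_option synthInstance.maxHeartbeats 400000 in
theorem edgeVal_facts {a b f g : ℕ} (ha : a < 4) (hb : b < 4) (hf : f < 6) (hg : g < 6)
    (h : edgeVal (6 * a + f) (6 * b + g) ≠ 0) :
    (f = 0 ∨ f = 2 ∨ f = 3) ∧
    (edgeVal (6 * a + f) (6 * b + g) = 1 ∨ edgeVal (6 * a + f) (6 * b + g) = 2) ∧
    (f = 2 → edgeVal (6 * a + f) (6 * b + g) = 2) ∧ (f = 3 → a = 2 ∧ b = 0) ∧
    ¬ (a = 0 ∧ b = 0) ∧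
    (edgeVal (6 * a + f) (6 * b + g) = 2 → (a ≠ 1 → f = 2) ∧
      (a = 1 ∧ b = 2 ∨ a = 2 ∧ b = 1 ∨ a = 3 ∧ b = 3)) := by
  have key : ∀ (a b : Fin 4) (f g : Fin 6), edgeVal (6 * a + f) (6 * b + g) ≠ 0 →
    ((f : ℕ) = 0 ∨ (f : ℕ) = 2 ∨ (f : ℕ) = 3) ∧
    (edgeVal (6 * a + f) (6 * b + g) = 1 ∨ edgeVal (6 * a + f) (6 * b + g) = 2) ∧
    ((f : ℕ) = 2 → edgeVal (6 * a + f) (6 * b + g) = 2) ∧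
    ((f : ℕ) = 3 → (a : ℕ) = 2 ∧ (b : ℕ) = 0) ∧
    ¬ ((a : ℕ) = 0 ∧ (b : ℕ) = 0) ∧
    (edgeVal (6 * a + f) (6 * b + g) = 2 → ((a : ℕ) ≠ 1 → (f : ℕ) = 2) ∧
      ((a : ℕ) = 1 ∧ (b : ℕ) = 2 ∨ (a : ℕ) = 2 ∧ (b : ℕ) = 1 ∨ (a : ℕ) = 3 ∧ (b : ℕ) = 3)) := by
    decide +kernel
  exact key ⟨a, ha⟩ ⟨b, hb⟩ ⟨f, hf⟩ ⟨g, hg⟩ h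

/-- Applied to a set of nodes and to its complement, this excludes the partial sums 1 out of 2, and
1 and 4 out of 5. -/
theorem sum_ne_one_of_two_three {ι : Type*} {A : Finset ι} {f : ι → ℕ}
    (hf : ∀ s, f s = 0 ∨ f s = 2 ∨ f s = 3) :
    ∑ s ∈ A, f s ≠ 1 := by
  intro h
  obtain ⟨s, hs, hs0⟩ := Finset.exists_ne_zero_of_sum_ne_zero (h.trans_ne one_ne_zero)
  have := Finset.single_le_sum (f := f) (fun _ _ => Nat.zero_le _) hs
  have := hf s
  omega

/-- The reason for the values 2 and 3: each of 2a + 3b = 2 and 2a + 3b = 5 has a single solution in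
natural numbers, so the total reveals how often each flag occurs. -/
theorem sum_eq_of_two_three {ι : Type*} [Fintype ι] [DecidableEq ι] (f : ι → ℕ)
    (hf : ∀ s, f s = 0 ∨ f s = 2 ∨ f s = 3) :
    ∑ s, f s = 2 * (Finset.univ.filter (f · = 2)).card
      + 3 * (Finset.univ.filter (f · = 3)).card := by
  rw [Finset.card_filter, Finset.card_filter, Finset.mul_sum, Finset.mul_sum,
    ← Finset.sum_add_distrib]
  refine Finset.sum_congr rfl fun s _ => ?_
  rcases hf s with h | h | h <;> simp [h]

namespace NiceTreeDecomposition

variable {V : Type*} [DecidableEq V] {G : SimpleGraph V} {ι : Type*}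
  (T : NiceTreeDecomposition G ι)

/-- The flag that the edge introduced at the node `s`, if there is one, carries at `x`. -/
def flagAt (fl : ι → V → ℕ) (s : ι) (x : V) : ℕ :=
  match T.kind s with
  | .introduceEdge _ u v => if x = u ∨ x = v then fl s x else 0
  | _ => 0

/-- The value of the edge introduced at the node `s`, and `1` if there is none. -/
def valAt (τ : V → ℕ) (fl : ι → V → ℕ) (s : ι) : ℕ :=
  match T.kind s with
  | .introduceEdge _ u v => edgeVal (6 * τ u + fl s u) (6 * τ v + fl s v)
  | _ => 1

/-- The node at which an edge is introduced. -/
noncomputable def nodeOf (e : Sym2 V) : ι :=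
  open Classical in if h : e ∈ G.edgeSet then (T.introduced_once e h).choose else T.root

variable {T}

theorem kind_nodeOf {u v : V} (h : G.Adj u v) :
    (∃ c, T.kind (T.nodeOf s(u, v)) = .introduceEdge c u v) ∨
      ∃ c, T.kind (T.nodeOf s(u, v)) = .introduceEdge c v u := by
  have he : s(u, v) ∈ G.edgeSet := h
  rw [nodeOf, dif_pos he]
  obtain ⟨c, a, b, hk, hab⟩ := (T.introduced_once _ he).choose_spec.1
  rcases Sym2.eq_iff.1 hab with ⟨rfl, rfl⟩ | ⟨rfl, rfl⟩
  · exact .inl ⟨c, hk⟩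
  · exact .inr ⟨c, hk⟩

theorem adj_of_kind {s c : ι} {u v : V} (h : T.kind s = .introduceEdge c u v) : G.Adj u v := by
  have := T.kind_valid s
  rw [h] at this
  exact this.2.2.1

theorem nodeOf_of_kind {s c : ι} {u v : V} (h : T.kind s = .introduceEdge c u v) :
    T.nodeOf s(u, v) = s := by
  have he : s(u, v) ∈ G.edgeSet := adj_of_kind h
  rw [nodeOf, dif_pos he]
  exact (T.introduced_once _ he).unique (T.introduced_once _ he).choose_spec.1
    ⟨c, u, v, h, rfl⟩

theorem nodeOf_injOn : Set.InjOn T.nodeOf G.edgeSet := by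
  intro e he e' he' h
  induction e with | _ u v
  induction e' with | _ u' v'
  rcases kind_nodeOf (T := T) he with ⟨c, hk⟩ | ⟨c, hk⟩ <;>
  rcases kind_nodeOf (T := T) he' with ⟨c', hk'⟩ | ⟨c', hk'⟩ <;>
  · rw [h, hk'] at hk
    simp only [NodeKind.introduceEdge.injEq] at hk
    rcases hk with ⟨-, rfl, rfl⟩
    first | rfl | exact Sym2.eq_swap

/-- A labelling all of whose edges are admissible and all of whose vertices have the flags they
need. -/
structure IsSolution [Fintype ι] (T : NiceTreeDecomposition G ι) (τ : V → ℕ) (fl : ι → V → ℕ) :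
    Prop where
  type_lt : ∀ x, τ x < 4
  flag_lt : ∀ s x, fl s x < 6
  val_ne : ∀ s, T.valAt τ fl s ≠ 0
  sum_flag : ∀ x, ∑ s, T.flagAt fl s x = full (τ x)

section

variable {τ : V → ℕ} {fl : ι → V → ℕ}

theorem flagAt_nodeOf {u v : V} (h : G.Adj u v) :
    T.flagAt fl (T.nodeOf s(u, v)) u = fl (T.nodeOf s(u, v)) u := by
  rcases kind_nodeOf (T := T) h with ⟨c, hk⟩ | ⟨c, hk⟩ <;> simp [flagAt, hk]

theorem valAt_nodeOf (hτ : ∀ x, τ x < 4) (hf : ∀ s x, fl s x < 6) {u v : V} (h : G.Adj u v) :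
    T.valAt τ fl (T.nodeOf s(u, v)) =
      edgeVal (6 * τ u + fl (T.nodeOf s(u, v)) u) (6 * τ v + fl (T.nodeOf s(u, v)) v) := by
  rcases kind_nodeOf (T := T) h with ⟨c, hk⟩ | ⟨c, hk⟩
  · simp only [valAt, hk]
  · simp only [valAt, hk]
    have hu := hτ u
    have hv := hτ v
    have hu' := hf (T.nodeOf s(u, v)) u
    have hv' := hf (T.nodeOf s(u, v)) v
    exact edgeVal_comm (by omega) (by omega)

theorem exists_of_flagAt_ne_zero {s : ι} {x : V} (h : T.flagAt fl s x ≠ 0) :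
    ∃ y, G.Adj x y ∧ T.nodeOf s(x, y) = s := by
  unfold flagAt at h
  split at h
  case h_1 c u v hk =>
    have hx : x = u ∨ x = v := by
      by_contra hx
      simp [hx] at h
    rcases hx with rfl | rfl
    · exact ⟨v, adj_of_kind hk, nodeOf_of_kind hk⟩
    · exact ⟨u, (adj_of_kind hk).symm, by rw [Sym2.eq_swap]; exact nodeOf_of_kind hk⟩
  case h_2 => exact absurd rfl h

/-- Different edges are introduced at different nodes, so counting nodes counts edges. -/
theorem sum_valAt_sub_one [Fintype ι] {M : Finset (Sym2 V)}
    (hM : (M : Set (Sym2 V)) ⊆ G.edgeSet)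
    (h : ∀ s, T.valAt τ fl s - 1 = open Classical in if ∃ e ∈ M, T.nodeOf e = s then 1 else 0) :
    ∑ s, (T.valAt τ fl s - 1) = M.card := by
  classical
  rw [← Finset.card_image_of_injOn ((nodeOf_injOn (T := T)).mono hM), Finset.card_eq_sum_ones,
    Finset.sum_congr rfl fun s _ => h s, ← Finset.sum_filter]
  refine Finset.sum_congr ?_ fun _ _ => rfl
  ext s
  simp

/-! ### From labellings to minimal edge dominating sets -/

namespace IsSolution

variable [Fintype ι]

theorem facts (hS : T.IsSolution τ fl) {u v : V} (h : G.Adj u v) :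
    let s := T.nodeOf s(u, v)
    (fl s u = 0 ∨ fl s u = 2 ∨ fl s u = 3) ∧ (T.valAt τ fl s = 1 ∨ T.valAt τ fl s = 2) ∧
    (fl s u = 2 → T.valAt τ fl s = 2) ∧ (fl s u = 3 → τ u = 2 ∧ τ v = 0) ∧
    ¬ (τ u = 0 ∧ τ v = 0) ∧
    (T.valAt τ fl s = 2 → (τ u ≠ 1 → fl s u = 2) ∧
      (τ u = 1 ∧ τ v = 2 ∨ τ u = 2 ∧ τ v = 1 ∨ τ u = 3 ∧ τ v = 3)) := by
  have h1 := hS.val_ne (T.nodeOf s(u, v))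
  have h2 := valAt_nodeOf (T := T) hS.type_lt hS.flag_lt h
  simp only
  rw [h2] at h1 ⊢
  exact edgeVal_facts (hS.type_lt _) (hS.type_lt _) (hS.flag_lt _ _) (hS.flag_lt _ _) h1

theorem flagAt_eq (hS : T.IsSolution τ fl) (s : ι) (x : V) :
    T.flagAt fl s x = 0 ∨ T.flagAt fl s x = 2 ∨ T.flagAt fl s x = 3 := by
  by_cases h : T.flagAt fl s x = 0
  · exact .inl h
  · obtain ⟨y, hy, rfl⟩ := exists_of_flagAt_ne_zero h
    rw [flagAt_nodeOf hy]
    exact (hS.facts hy).1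

theorem exists_cover (hS : T.IsSolution τ fl) {x : V} (hx : τ x ≠ 0) :
    ∃ y, G.Adj x y ∧ T.valAt τ fl (T.nodeOf s(x, y)) = 2 := by
  classical
  have h1 := sum_eq_of_two_three (T.flagAt fl · x) (hS.flagAt_eq · x)
  rw [hS.sum_flag, full, if_neg hx] at h1
  have h2 : (Finset.univ.filter (T.flagAt fl · x = 2)).card ≠ 0 := by
    split_ifs at h1 <;> omega
  obtain ⟨s, hs⟩ := Finset.card_ne_zero.1 h2
  rw [Finset.mem_filter] at hs
  obtain ⟨y, hy, rfl⟩ := exists_of_flagAt_ne_zero (T := T) (fl := fl) (s := s) (x := x) (by omega)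
  rw [flagAt_nodeOf hy] at hs
  exact ⟨y, hy, (hS.facts hy).2.2.1 hs.2⟩

theorem exists_private (hS : T.IsSolution τ fl) {x : V} (hx : τ x = 2) :
    ∃ y, G.Adj x y ∧ τ y = 0 := by
  classical
  have h1 := sum_eq_of_two_three (T.flagAt fl · x) (hS.flagAt_eq · x)
  rw [hS.sum_flag, hx, full, if_neg (by norm_num), if_pos rfl] at h1
  have h2 : (Finset.univ.filter (T.flagAt fl · x = 3)).card ≠ 0 := by omega
  obtain ⟨s, hs⟩ := Finset.card_ne_zero.1 h2
  rw [Finset.mem_filter] at hs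
  obtain ⟨y, hy, rfl⟩ := exists_of_flagAt_ne_zero (T := T) (fl := fl) (s := s) (x := x) (by omega)
  rw [flagAt_nodeOf hy] at hs
  exact ⟨y, hy, ((hS.facts hy).2.2.2.1 hs.2).2⟩

/-- Each solution edge at a vertex that is not a centre is flagged 2 there, and the total has room
for one such flag. Centres are exempt, since their further edges carry flag 0. -/
theorem cover_unique (hS : T.IsSolution τ fl) {x y z : V} (hx : τ x ≠ 0)
    (hx' : τ x ≠ 1) (hy : G.Adj x y) (hz : G.Adj x z)
    (hvy : T.valAt τ fl (T.nodeOf s(x, y)) = 2) (hvz : T.valAt τ fl (T.nodeOf s(x, z)) = 2) :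
    y = z := by
  classical
  have h1 := sum_eq_of_two_three (T.flagAt fl · x) (hS.flagAt_eq · x)
  rw [hS.sum_flag, full, if_neg hx] at h1
  have h2 : (Finset.univ.filter (T.flagAt fl · x = 2)).card ≤ 1 := by
    split_ifs at h1 <;> omega
  have key : ∀ {y}, G.Adj x y → T.valAt τ fl (T.nodeOf s(x, y)) = 2 →
      T.nodeOf s(x, y) ∈ Finset.univ.filter (T.flagAt fl · x = 2) := by
    intro y hy hv
    rw [Finset.mem_filter, flagAt_nodeOf hy]
    exact ⟨Finset.mem_univ _, ((hS.facts hy).2.2.2.2.2 hv).1 hx'⟩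
  have h3 := nodeOf_injOn (T := T) hy hz (Finset.card_le_one.1 h2 _ (key hy hvy) _ (key hz hvz))
  rcases Sym2.eq_iff.1 h3 with h | h
  · exact h.2
  · exact h.2.trans h.1

/-- The edges of value `2` of a solution form a minimal edge dominating set. -/
theorem exists_minimal (hS : T.IsSolution τ fl) [Fintype V] :
    ∃ M, IsMinimalEdgeDominating G M ∧ M.card = ∑ s, (T.valAt τ fl s - 1) := by
  classical
  let M : Finset (Sym2 V) :=
    Finset.univ.filter fun e => e ∈ G.edgeSet ∧ T.valAt τ fl (T.nodeOf e) = 2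
  have hM : ∀ {u v}, s(u, v) ∈ M ↔ G.Adj u v ∧ T.valAt τ fl (T.nodeOf s(u, v)) = 2 := by
    intro u v
    simp [M]
  have hsub : (M : Set (Sym2 V)) ⊆ G.edgeSet := fun e he => (Finset.mem_filter.1 he).2.1
  have hne : ∀ {u v}, s(u, v) ∈ M → τ u ≠ 0 := by
    intro u v h
    have := ((hS.facts (hM.1 h).1).2.2.2.2.2 (hM.1 h).2).2
    omega
  refine ⟨M, ⟨⟨hsub, ?_⟩, ?_⟩, ?_⟩
  · intro e he _
    induction e with | _ u v
    have h0 := (hS.facts he).2.2.2.2.1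
    -- One of the two ends is covered, and its covering edge dominates.
    by_cases hu : τ u = 0
    · obtain ⟨y, hy⟩ := hS.exists_cover (x := v) fun hv => h0 ⟨hu, hv⟩
      exact ⟨s(v, y), hM.2 hy, v, by simp, by simp⟩
    · obtain ⟨y, hy⟩ := hS.exists_cover hu
      exact ⟨s(u, y), hM.2 hy, u, by simp, by simp⟩
  · intro M' hM' hdom
    obtain ⟨hss, e, he, he'⟩ := Finset.ssubset_iff_of_subset hM'.subset |>.1 hM' |>
      fun ⟨e, h1, h2⟩ => And.intro hM'.subset (Exists.intro e (And.intro h1 h2))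
    -- A vertex that is not a centre has one solution edge; if `M'` omits it, `M'` does not cover
    -- the vertex.
    have huniq : ∀ {x y z}, τ x ≠ 1 → s(x, y) ∈ M → s(x, y) ∉ M' → s(x, z) ∈ M' → False := by
      intro x y z hx h1 h2 h3
      have := hS.cover_unique (hne h1) hx (hM.1 h1).1 (hM.1 (hss h3)).1 (hM.1 h1).2
        (hM.1 (hss h3)).2
      exact h2 (this ▸ h3)
    -- Without the star edge at a leaf, the edge to its uncovered neighbour is dominated at neither
    -- end.
    have hleaf : ∀ {u v}, s(u, v) ∈ M → s(u, v) ∉ M' → τ u ≠ 2 := by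
      intro u v h1 h2 hu
      obtain ⟨w, hw, hw0⟩ := hS.exists_private hu
      obtain ⟨f, hf, z, hz, hzf⟩ := hdom.2 s(u, w) hw fun h =>
        hne (Sym2.eq_swap (a := u) ▸ hss h) hw0
      obtain ⟨y, rfl⟩ := hzf
      rcases Sym2.mem_iff.1 hz with rfl | rfl
      · exact huniq (by omega) h1 h2 hf
      · exact hne (hss hf) hw0
    induction e with | _ u v
    have hsw : s(v, u) = s(u, v) := Sym2.eq_swap
    rcases ((hS.facts (hM.1 he).1).2.2.2.2.2 (hM.1 he).2).2 with h | h | h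
    · exact hleaf (u := v) (v := u) (hsw ▸ he) (hsw ▸ he') h.2
    · exact hleaf he he' h.1
    -- An omitted isolated edge would itself be undominated.
    · obtain ⟨f, hf, z, hz, hzf⟩ := hdom.2 s(u, v) (hM.1 he).1 he'
      obtain ⟨y, rfl⟩ := hzf
      rcases Sym2.mem_iff.1 hz with rfl | rfl
      · exact huniq (by omega) he he' hf
      · exact huniq (y := u) (by omega) (hsw ▸ he) (hsw ▸ he') hf
  · refine (sum_valAt_sub_one hsub fun s => ?_).symm
    split_ifs with h
    · obtain ⟨e, he, rfl⟩ := h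
      rw [(Finset.mem_filter.1 he).2.2]
    · unfold valAt
      split
      case h_1 c u v hk =>
        have hs := nodeOf_of_kind hk
        have h1 := (hS.facts (adj_of_kind hk)).2.1
        have h2 : T.valAt τ fl (T.nodeOf s(u, v)) ≠ 2 := fun h2 =>
          h ⟨s(u, v), hM.2 ⟨adj_of_kind hk, h2⟩, hs⟩
        have h3 : T.valAt τ fl (T.nodeOf s(u, v)) = 1 := by omega
        rw [hs] at h3
        simp only [valAt, hk] at h3
        rw [h3]
      case h_2 => rfl

end IsSolution

end

/-- A minimal edge dominating set contains no edge both of whose end points are covered by other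
edges of the set. -/
theorem not_both_covered {M : Finset (Sym2 V)} (hM : IsMinimalEdgeDominating G M) {u v y z : V}
    (he : s(u, v) ∈ M) (hy : s(u, y) ∈ M) (hyv : y ≠ v) (hz : s(v, z) ∈ M) (hzu : z ≠ u) :
    False := by
  classical
  have hy' : s(u, y) ∈ M.erase s(u, v) :=
    Finset.mem_erase.2 ⟨fun h => hyv (Sym2.congr_right.1 h), hy⟩
  have hz' : s(v, z) ∈ M.erase s(u, v) := by
    refine Finset.mem_erase.2 ⟨fun h => ?_, hz⟩
    rcases Sym2.eq_iff.1 h with h | h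
    · exact hzu (h.2.trans h.1)
    · exact hzu h.2
  have hcov : ∀ x ∈ s(u, v), ∃ f ∈ M.erase s(u, v), x ∈ f := by
    intro x hx
    rcases Sym2.mem_iff.1 hx with rfl | rfl
    · exact ⟨_, hy', by simp⟩
    · exact ⟨_, hz', by simp⟩
  refine hM.2 (M.erase s(u, v)) (Finset.erase_ssubset he) ⟨fun e h => hM.1.1
    (Finset.mem_of_mem_erase h), fun e hE hn => ?_⟩
  by_cases heq : e = s(u, v)
  · obtain ⟨f, hf, hxf⟩ := hcov u (by simp)
    exact ⟨f, hf, u, by simp [heq], hxf⟩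
  · obtain ⟨f, hf, x, hxe, hxf⟩ := hM.1.2 e hE fun h => hn (Finset.mem_erase.2 ⟨heq, h⟩)
    by_cases hf' : f = s(u, v)
    · obtain ⟨f', hf', hxf'⟩ := hcov x (hf' ▸ hxf)
      exact ⟨f', hf', x, hxe, hxf'⟩
    · exact ⟨f, Finset.mem_erase.2 ⟨hf', hf⟩, x, hxe, hxf⟩

/-- In a minimal edge dominating set, a leaf of a star with at least two edges has an uncovered
neighbour. -/
theorem exists_uncovered {M : Finset (Sym2 V)} (hM : IsMinimalEdgeDominating G M) {u v y : V}
    (he : s(u, v) ∈ M) (hy : s(u, y) ∈ M) (hyv : y ≠ v) :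
    ∃ w, G.Adj v w ∧ ∀ z, s(w, z) ∉ M := by
  classical
  have hy' : s(u, y) ∈ M.erase s(u, v) :=
    Finset.mem_erase.2 ⟨fun h => hyv (Sym2.congr_right.1 h), hy⟩
  have h := hM.2 (M.erase s(u, v)) (Finset.erase_ssubset he)
  rw [IsEdgeDominating, not_and] at h
  have h := h fun e h => hM.1.1 (Finset.mem_of_mem_erase h)
  push Not at h
  obtain ⟨g, hg, hgM, hgd⟩ := h
  have hug : u ∉ g := fun hu => hgd _ hy' u hu (by simp)
  have hge : g ≠ s(u, v) := fun h => hug (by simp [h])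
  have hgM' : g ∉ M := fun h => hgM (Finset.mem_erase.2 ⟨hge, h⟩)
  obtain ⟨f, hf, x, hxg, hxf⟩ := hM.1.2 g hg hgM'
  have hfe : f = s(u, v) := by
    by_contra hfe
    exact hgd f (Finset.mem_erase.2 ⟨hfe, hf⟩) x hxg hxf
  rw [hfe] at hxf
  rcases Sym2.mem_iff.1 hxf with rfl | rfl
  · exact absurd hxg hug
  · obtain ⟨w, rfl⟩ := hxg
    refine ⟨w, hg, fun z hz => ?_⟩
    by_cases hze : s(w, z) = s(u, x)
    · have : w ∈ s(u, x) := hze ▸ Sym2.mem_mk_left w z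
      rcases Sym2.mem_iff.1 this with rfl | rfl
      · exact hug (by simp)
      · exact G.loopless.irrefl _ hg
    · exact hgd _ (Finset.mem_erase.2 ⟨hze, hz⟩) w (by simp) (by simp)

/-- Every minimal edge dominating set comes from a solution. -/
theorem exists_isSolution [Fintype ι] {M : Finset (Sym2 V)} (hM : IsMinimalEdgeDominating G M) :
    ∃ τ fl, T.IsSolution τ fl ∧ ∑ s, (T.valAt τ fl s - 1) = M.card := by
  classical
  let Cov (x : V) : Prop := ∃ y, s(x, y) ∈ M
  let Multi (x : V) : Prop := ∃ y z, s(x, y) ∈ M ∧ s(x, z) ∈ M ∧ y ≠ z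
  let τ (x : V) : ℕ := if ¬ Cov x then 0 else if Multi x then 1 else
    if ∃ y, s(x, y) ∈ M ∧ Multi y then 2 else 3
  have hadj : ∀ {u v}, s(u, v) ∈ M → G.Adj u v := fun h => hM.1.1 h
  -- The implication inside makes the choice total; at uncovered vertices the witness `x` is a
  -- dummy. The same device serves in `hpriv`.
  have hcov : ∀ x, ∃ y, τ x ≠ 0 → s(x, y) ∈ M := by
    intro x
    by_cases h : Cov x
    · exact h.imp fun y hy _ => hy
    · exact ⟨x, fun h' => absurd (by simp [τ, h]) h'⟩
  have hpriv : ∀ x, ∃ y, τ x = 2 → G.Adj x y ∧ ¬ Cov y := by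
    intro x
    by_cases h : τ x = 2
    · simp only [τ] at h
      split_ifs at h with h1 h2 h3 <;> try omega
      obtain ⟨u, hxu, y, z, huy, huz, hyz⟩ := h3
      rw [Sym2.eq_swap] at hxu
      -- Of two different solution edges at the centre `u`, one does not lead to `x`; it is the
      -- second edge that `exists_uncovered` asks for.
      by_cases hyx : y = x
      · obtain ⟨w, hw, hw'⟩ := exists_uncovered hM hxu huz (hyx ▸ hyz.symm)
        exact ⟨w, fun _ => ⟨hw, fun ⟨z, hz⟩ => hw' z hz⟩⟩
      · obtain ⟨w, hw, hw'⟩ := exists_uncovered hM hxu huy hyx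
        exact ⟨w, fun _ => ⟨hw, fun ⟨z, hz⟩ => hw' z hz⟩⟩
    · exact ⟨x, fun h' => absurd h' h⟩
  choose aw haw using hcov
  choose pw hpw using hpriv
  let fl (s : ι) (x : V) : ℕ := (if τ x ≠ 0 ∧ T.nodeOf s(x, aw x) = s then 2 else 0) +
    if τ x = 2 ∧ T.nodeOf s(x, pw x) = s then 3 else 0
  have hτ : ∀ x, τ x < 4 := by
    intro x
    simp only [τ]
    split_ifs <;> norm_num
  have hfl : ∀ s x, fl s x < 6 := by
    intro s x
    simp only [fl]
    split_ifs <;> norm_num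
  have hτ0 : ∀ {x}, ¬ Cov x → τ x = 0 := fun h => by simp [τ, h]
  have hawM : ∀ {x}, τ x ≠ 0 → T.nodeOf s(x, aw x) ∈ M.image T.nodeOf := fun h =>
    Finset.mem_image_of_mem _ (haw _ h)
  have hinj : ∀ {e e'}, e ∈ G.edgeSet → e' ∈ G.edgeSet → T.nodeOf e = T.nodeOf e' → e = e' :=
    fun h h' => nodeOf_injOn h h'
  -- On an edge of `M` flag 3 cannot occur, because the private neighbour is uncovered. A vertex
  -- with a single edge in `M` has chosen that edge.
  have hflM : ∀ {u v}, s(u, v) ∈ M → fl (T.nodeOf s(u, v)) u = if ¬ Multi u then 2 else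
      if v = aw u then 2 else 0 := by
    intro u v h
    have hcu : Cov u := ⟨v, h⟩
    have h0 : τ u ≠ 0 := by
      simp only [τ, hcu]
      split_ifs <;> simp_all
    have h2 : ¬ (τ u = 2 ∧ T.nodeOf s(u, pw u) = T.nodeOf s(u, v)) := by
      rintro ⟨h2, h3⟩
      obtain ⟨h4, h5⟩ := hpw u h2
      have h6 := hinj (e := s(u, pw u)) (e' := s(u, v)) h4 (hadj h) h3
      have h7 : pw u = v := Sym2.congr_right.1 h6
      exact h5 ⟨u, by rw [h7, Sym2.eq_swap]; exact h⟩
    have h1 : T.nodeOf s(u, aw u) = T.nodeOf s(u, v) ↔ v = aw u := by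
      refine ⟨fun h1 => ?_, fun h1 => by rw [h1]⟩
      have := hinj (e := s(u, aw u)) (e' := s(u, v)) (hadj (haw u h0)) (hadj h) h1
      rw [Sym2.congr_right] at this
      exact this.symm
    simp only [fl, if_neg h2, h1, ne_eq, h0, not_false_eq_true, true_and, add_zero]
    by_cases hm : Multi u
    · simp [hm]
    · have : v = aw u := by
        by_contra hne
        exact hm ⟨v, aw u, h, haw u h0, hne⟩
      simp [hm, this]
  have hvalM : ∀ {u v}, s(u, v) ∈ M →
      edgeVal (6 * τ u + fl (T.nodeOf s(u, v)) u) (6 * τ v + fl (T.nodeOf s(u, v)) v) = 2 := by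
    intro u v h
    have h' : s(v, u) ∈ M := Sym2.eq_swap (a := v) ▸ h
    have hu := hflM h
    have hv := hflM h'
    rw [Sym2.eq_swap] at hv
    have hcu : Cov u := ⟨v, h⟩
    have hcv : Cov v := ⟨u, h'⟩
    rw [hu, hv]
    by_cases hmu : Multi u
    -- If both ends had further edges in `M`, the edge would be redundant.
    · have hmv : ¬ Multi v := by
        rintro ⟨a, b, ha, hb, hab⟩
        obtain ⟨c, d, hc, hd, hcd⟩ := hmu
        obtain ⟨c, hc, hcv⟩ : ∃ c, s(u, c) ∈ M ∧ c ≠ v := by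
          by_cases h : c = v
          · exact ⟨d, hd, h ▸ hcd.symm⟩
          · exact ⟨c, hc, h⟩
        obtain ⟨a, ha, hau⟩ : ∃ c, s(v, c) ∈ M ∧ c ≠ u := by
          by_cases h : a = u
          · exact ⟨b, hb, h ▸ hab.symm⟩
          · exact ⟨a, ha, h⟩
        exact not_both_covered hM h hc hcv ha hau
      have h1 : τ u = 1 := by simp [τ, hcu, hmu]
      have h2 : τ v = 2 := by
        have : ∃ y, s(v, y) ∈ M ∧ Multi y := ⟨u, h', hmu⟩
        simp [τ, hcv, hmv, this]
      rw [h1, h2]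
      simp only [hmu, hmv]
      simp only [not_true_eq_false, if_false, not_false_eq_true, if_true]
      split_ifs <;> decide
    · by_cases hmv : Multi v
      · have h1 : τ v = 1 := by simp [τ, hcv, hmv]
        have h2 : τ u = 2 := by
          have : ∃ y, s(u, y) ∈ M ∧ Multi y := ⟨v, h, hmv⟩
          simp [τ, hcu, hmu, this]
        rw [h1, h2]
        simp only [hmu, hmv]
        simp only [not_true_eq_false, if_false, not_false_eq_true, if_true]
        split_ifs <;> decide
      · have key : ∀ {a b}, s(a, b) ∈ M → ¬ Multi a → ¬ Multi b → τ a = 3 := by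
          intro a b hab ha hb
          have h1 : Cov a := ⟨b, hab⟩
          have h2 : ¬ ∃ y, s(a, y) ∈ M ∧ Multi y := by
            rintro ⟨y, hy, hy'⟩
            by_cases hyb : y = b
            · exact hb (hyb ▸ hy')
            · exact ha ⟨y, b, hy, hab, hyb⟩
          simp [τ, h1, ha, h2]
        rw [key h hmu hmv, key h' hmv hmu]
        simp only [hmu, hmv]
        simp only [not_false_eq_true, if_true]
        decide
  have hflN : ∀ {u v}, G.Adj u v → s(u, v) ∉ M → fl (T.nodeOf s(u, v)) u =
      if τ u = 2 ∧ pw u = v then 3 else 0 := by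
    intro u v h hn
    have h1 : ¬ (τ u ≠ 0 ∧ T.nodeOf s(u, aw u) = T.nodeOf s(u, v)) := by
      rintro ⟨h1, h2⟩
      exact hn (hinj (e := s(u, aw u)) (e' := s(u, v)) (hadj (haw u h1)) h h2 ▸ haw u h1)
    have h2 : (τ u = 2 ∧ T.nodeOf s(u, pw u) = T.nodeOf s(u, v)) ↔ (τ u = 2 ∧ pw u = v) := by
      refine and_congr_right fun h2 => ⟨fun h3 => ?_, fun h3 => by rw [h3]⟩
      have := hinj (e := s(u, pw u)) (e' := s(u, v)) (hpw u h2).1 h h3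
      exact Sym2.congr_right.1 this
    simp only [fl, if_neg h1, h2, zero_add]
  have hvalN : ∀ {u v}, G.Adj u v → s(u, v) ∉ M →
      edgeVal (6 * τ u + fl (T.nodeOf s(u, v)) u) (6 * τ v + fl (T.nodeOf s(u, v)) v) = 1 := by
    intro u v h hn
    have hu := hflN h hn
    have hv := hflN h.symm (Sym2.eq_swap (a := u) ▸ hn)
    rw [Sym2.eq_swap] at hv
    rw [hu, hv]
    by_cases h1 : τ u = 2 ∧ pw u = v
    · have h2 : τ v = 0 := hτ0 (h1.2 ▸ (hpw u h1.1).2)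
      rw [if_pos h1, if_neg (by omega), h1.1, h2]
      decide
    · by_cases h2 : τ v = 2 ∧ pw v = u
      · have h3 : τ u = 0 := hτ0 (h2.2 ▸ (hpw v h2.1).2)
        rw [if_neg h1, if_pos h2, h2.1, h3]
        decide
      · rw [if_neg h1, if_neg h2]
        -- An edge with two uncovered ends would not be dominated.
        have h3 : ¬ (τ u = 0 ∧ τ v = 0) := by
          rintro ⟨h3, h4⟩
          have hnc : ∀ {x}, τ x = 0 → ¬ Cov x := by
            intro x hx hc
            simp only [τ, hc] at hx
            split_ifs at hx
            simp_all
          obtain ⟨f, hf, x, hx, hxf⟩ := hM.1.2 s(u, v) h hn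
          obtain ⟨y, rfl⟩ := hxf
          rcases Sym2.mem_iff.1 hx with rfl | rfl
          · exact hnc h3 ⟨y, hf⟩
          · exact hnc h4 ⟨y, hf⟩
        have key : ∀ a b : Fin 4, ¬ ((a : ℕ) = 0 ∧ (b : ℕ) = 0) →
            edgeVal (6 * a + 0) (6 * b + 0) = 1 := by decide +kernel
        exact key ⟨_, hτ u⟩ ⟨_, hτ v⟩ h3
  have hval : ∀ s, T.valAt τ fl s = if ∃ e ∈ M, T.nodeOf e = s then 2 else 1 := by
    intro s
    unfold valAt
    split
    case h_1 c u v hk =>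
      have hs := nodeOf_of_kind hk
      by_cases h : s(u, v) ∈ M
      · rw [if_pos ⟨_, h, hs⟩, ← hs, hvalM h]
      · rw [if_neg, ← hs, hvalN (adj_of_kind hk) h]
        rintro ⟨e, he, hes⟩
        exact h (hinj (hM.1.1 he) (adj_of_kind hk) (hes.trans hs.symm) ▸ he)
    case h_2 h =>
      rw [if_neg]
      rintro ⟨e, he, rfl⟩
      induction e with | _ u v
      rcases kind_nodeOf (T := T) (hadj he) with ⟨c, hc⟩ | ⟨c, hc⟩
      · exact h _ _ _ hc
      · exact h _ _ _ hc
  have hflag : ∀ s x, T.flagAt fl s x = fl s x := by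
    intro s x
    by_cases h : fl s x = 0
    · unfold flagAt
      split <;> simp [h]
    · by_cases h1 : τ x ≠ 0 ∧ T.nodeOf s(x, aw x) = s
      · rw [← h1.2]
        exact flagAt_nodeOf (hadj (haw x h1.1))
      · by_cases h2 : τ x = 2 ∧ T.nodeOf s(x, pw x) = s
        · rw [← h2.2]
          exact flagAt_nodeOf (hpw x h2.1).1
        · exact absurd (by simp only [fl, if_neg h1, if_neg h2]) h
  refine ⟨τ, fl, ⟨hτ, hfl, fun s => ?_, fun x => ?_⟩, sum_valAt_sub_one hM.1.1 fun s => ?_⟩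
  · rw [hval]
    split_ifs <;> norm_num
  · simp only [hflag, fl, full, Finset.sum_add_distrib]
    congr 1
    · by_cases h : τ x = 0 <;> simp [h]
    · by_cases h : τ x = 2 <;> simp [h]
  · rw [hval]
    split_ifs <;> rfl

end NiceTreeDecomposition

attribute [irreducible] edgeVal

/-! ### Locality of labellings -/

namespace NiceTreeDecomposition

section

variable {V : Type*} [DecidableEq V] {G : SimpleGraph V} {ι : Type*}
  {T : NiceTreeDecomposition G ι} {τ τ' : V → ℕ} {fl fl' : ι → V → ℕ}

theorem mem_bag_of_kind {s c : ι} {u v : V} (h : T.kind s = .introduceEdge c u v) :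
    u ∈ T.bag s ∧ v ∈ T.bag s := by
  have := T.kind_valid s
  rw [h] at this
  exact this.2.2.2

theorem flagAt_eq_zero {s : ι} {x : V} (hx : x ∉ T.bag s) : T.flagAt fl s x = 0 := by
  unfold flagAt
  split
  case h_1 c u v hk =>
    have := mem_bag_of_kind hk
    rw [if_neg]
    rintro (rfl | rfl)
    exacts [hx this.1, hx this.2]
  case h_2 => rfl

theorem flagAt_congr {s : ι} {x : V} (h : fl s = fl' s) : T.flagAt fl s x = T.flagAt fl' s x := by
  simp only [flagAt, h]

theorem valAt_congr {s : ι} (hτ : ∀ x ∈ T.bag s, τ x = τ' x) (h : fl s = fl' s) :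
    T.valAt τ fl s = T.valAt τ' fl' s := by
  unfold valAt
  split
  case h_1 c u v hk =>
    have := mem_bag_of_kind hk
    rw [hτ u this.1, hτ v this.2, h]
  case h_2 => rfl

end

variable {V : Type*} [DecidableEq V] {G : SimpleGraph V} {ι : Type*} [Fintype ι]
  (T : NiceTreeDecomposition G ι)

/-! ### Partial solutions -/

/-- The sum of the flags at `x` of the edges introduced in the subtree of `t`. -/
noncomputable def flags (fl : ι → V → ℕ) (t : ι) (x : V) : ℕ := ∑ s ∈ T.desc t, T.flagAt fl s x

/-- The number of edges of the solution introduced in the subtree of `t`. -/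
noncomputable def value (τ : V → ℕ) (fl : ι → V → ℕ) (t : ι) : ℕ :=
  ∑ s ∈ T.desc t, (T.valAt τ fl s - 1)

/-- The types and flags of the vertices in the bag of `t`. -/
noncomputable def state (τ : V → ℕ) (fl : ι → V → ℕ) (t : ι) (x : V) : ℕ :=
  if x ∈ T.bag t then 6 * τ x + T.flags fl t x else 0

/-- A labelling of the part of the graph introduced in the subtree of `t`. -/
structure IsPartial (τ : V → ℕ) (fl : ι → V → ℕ) (t : ι) : Prop where
  type_lt : ∀ x, τ x < 4
  flag_lt : ∀ s x, fl s x < 6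
  val_ne : ∀ s ∈ T.desc t, T.valAt τ fl s ≠ 0
  flags_lt : ∀ x ∈ T.bag t, T.flags fl t x < 6
  flags_eq : ∀ x, T.Below t x → x ∉ T.bag t → T.flags fl t x = full (τ x)

/-- There is a partial solution at `t` with state `σ` and `v - 1` edges. -/
def Realizes (t : ι) (σ : V → ℕ) (v : ℕ) : Prop :=
  ∃ τ fl, T.IsPartial τ fl t ∧ σ = T.state τ fl t ∧ v = T.value τ fl t + 1

variable {T} {τ τ' : V → ℕ} {fl fl' : ι → V → ℕ}

theorem flags_eq_zero {t : ι} {x : V} (h : ¬ T.Below t x) : T.flags fl t x = 0 :=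
  Finset.sum_eq_zero fun s hs => flagAt_eq_zero fun hx => h ⟨s, hs, hx⟩

theorem flags_congr {t : ι} {x : V} (h : ∀ s ∈ T.desc t, fl s = fl' s) :
    T.flags fl t x = T.flags fl' t x :=
  Finset.sum_congr rfl fun s hs => flagAt_congr (h s hs)

theorem valAt_congr_of_below {t : ι} (hτ : ∀ x, T.Below t x → τ x = τ' x)
    (h : ∀ s ∈ T.desc t, fl s = fl' s) {s : ι} (hs : s ∈ T.desc t) :
    T.valAt τ fl s = T.valAt τ' fl' s :=
  valAt_congr (fun x hx => hτ x ⟨s, hs, hx⟩) (h s hs)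

theorem value_congr {t : ι} (hτ : ∀ x, T.Below t x → τ x = τ' x)
    (h : ∀ s ∈ T.desc t, fl s = fl' s) : T.value τ fl t = T.value τ' fl' t :=
  Finset.sum_congr rfl fun _ hs => by rw [valAt_congr_of_below hτ h hs]

section OneChild

variable {t c : ι}

theorem flags_of_child (h : children T.tree T.root t = {c}) (x : V) :
    T.flags fl t x = T.flags fl c x + T.flagAt fl t x := by
  classical
  obtain ⟨h1, h2⟩ := desc_of_children_eq_singleton h
  rw [flags, h2, Finset.sum_insert h1.notMem_desc, add_comm, flags]

theorem value_of_child (h : children T.tree T.root t = {c}) :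
    T.value τ fl t = T.value τ fl c + (T.valAt τ fl t - 1) := by
  classical
  obtain ⟨h1, h2⟩ := desc_of_children_eq_singleton h
  rw [value, h2, Finset.sum_insert h1.notMem_desc, add_comm, value]

theorem mem_desc_of_child (h : children T.tree T.root t = {c}) {s : ι} :
    s ∈ T.desc t ↔ s = t ∨ s ∈ T.desc c := by
  classical
  rw [(desc_of_children_eq_singleton h).2, Finset.mem_insert]

theorem isChild_of_eq (h : children T.tree T.root t = {c}) : T.IsChild t c := by
  classical exact (desc_of_children_eq_singleton h).1

end OneChild

section TwoChildren

variable {t c₁ c₂ : ι}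

theorem isChild_of_eq_pair (h : children T.tree T.root t = {c₁, c₂}) :
    T.IsChild t c₁ ∧ T.IsChild t c₂ := by
  classical exact ⟨(desc_of_children_eq_pair h).1, (desc_of_children_eq_pair h).2.1⟩

theorem mem_desc_of_children (h : children T.tree T.root t = {c₁, c₂}) {s : ι} :
    s ∈ T.desc t ↔ s = t ∨ s ∈ T.desc c₁ ∨ s ∈ T.desc c₂ := by
  classical
  rw [(desc_of_children_eq_pair h).2.2, Finset.mem_insert, Finset.mem_union]

theorem sum_desc_of_children (h : children T.tree T.root t = {c₁, c₂}) (hne : c₁ ≠ c₂) (f : ι → ℕ) :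
    ∑ s ∈ T.desc t, f s = ∑ s ∈ T.desc c₁, f s + ∑ s ∈ T.desc c₂, f s + f t := by
  classical
  obtain ⟨h1, h2, h3⟩ := desc_of_children_eq_pair h
  rw [h3, Finset.sum_insert, Finset.sum_union (disjoint_desc h1 h2 hne), add_comm]
  rw [Finset.mem_union, not_or]
  exact ⟨h1.notMem_desc, h2.notMem_desc⟩

end TwoChildren

theorem Realizes.lt {t : ι} {σ : V → ℕ} {v : ℕ} (h : T.Realizes t σ v) (x : V) : σ x < 24 := by
  obtain ⟨τ, fl, hp, rfl, -⟩ := h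
  unfold state
  split_ifs with hx
  · have := hp.type_lt x
    have := hp.flags_lt x hx
    omega
  · norm_num

/-- Each node introduces at most one edge. The bound keeps the table entries within the word length.
-/
theorem Realizes.le_card {t : ι} {σ : V → ℕ} {v : ℕ} (h : T.Realizes t σ v) :
    v ≤ Fintype.card ι + 1 := by
  obtain ⟨τ, fl, hp, rfl, rfl⟩ := h
  have : T.value τ fl t ≤ ∑ s ∈ T.desc t, 1 := by
    refine Finset.sum_le_sum fun s hs => ?_
    have h1 := hp.val_ne s hs
    unfold valAt at h1 ⊢
    split
    case h_1 c u v hk =>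
      simp only [hk] at h1
      have := (edgeVal_facts (hp.type_lt u) (hp.type_lt v) (hp.flag_lt _ _) (hp.flag_lt _ _) h1).2.1
      omega
    case h_2 => simp
  rw [Finset.sum_const, smul_eq_mul, mul_one] at this
  have := this.trans (Finset.card_le_univ _)
  omega

/-! ### Soundness of the transitions -/

theorem realizes_leaf {t : ι} (hk : T.kind t = .leaf) : T.Realizes t (fun _ => 0) 1 := by
  have hv := T.kind_valid t
  rw [hk] at hv
  have hd := desc_of_children_eq_empty hv.1
  refine ⟨fun _ => 0, fun _ _ => 0, ⟨by simp, by simp, ?_, ?_, ?_⟩, ?_, ?_⟩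
  · simp [hd, valAt, hk]
  · simp [hv.2]
  · rintro x ⟨s, hs, hx⟩ hx'
    rw [hd, Finset.mem_singleton] at hs
    exact absurd (hs ▸ hx) hx'
  · funext x
    simp [state, hv.2]
  · simp [value, hd, valAt, hk]

/-- The new vertex occurs nowhere below `c`, since otherwise it would belong to the bag of `c`. Its
type is therefore free and its flag sum is 0. -/
theorem Realizes.introduceVertex {t c : ι} {x : V} (hk : T.kind t = .introduceVertex c x)
    {σ : V → ℕ} {v a : ℕ} (h : T.Realizes c σ v) (ha : a < 4) :
    T.Realizes t (Function.update σ x (6 * a)) v := by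
  have hv := T.kind_valid t
  rw [hk] at hv
  obtain ⟨hc, hx, hb⟩ := hv
  obtain ⟨τ, fl, hp, rfl, rfl⟩ := h
  have hch := isChild_of_eq hc
  have hxb : ¬ T.Below c x := fun h => hx (hch.mem_bag_of_below (by simp [hb]) h)
  have hne : ∀ y, T.Below c y → y ≠ x := fun y hy h => hxb (h ▸ hy)
  have hτ : ∀ y, T.Below c y → Function.update τ x a y = τ y := fun y hy =>
    Function.update_of_ne (hne y hy) _ _
  have hfl : ∀ y, T.flags fl t y = T.flags fl c y := fun y => by
    simp [flags_of_child hc, flagAt, hk]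
  have hval : T.valAt (Function.update τ x a) fl t = 1 := by simp [valAt, hk]
  refine ⟨Function.update τ x a, fl, ⟨fun y => ?_, hp.flag_lt, fun s hs => ?_, fun y hy => ?_,
    fun y hy hy' => ?_⟩, ?_, ?_⟩
  · by_cases h : y = x
    · simpa [h] using ha
    · simpa [h] using hp.type_lt y
  · rcases (mem_desc_of_child hc).1 hs with rfl | hs
    · simp [hval]
    · rw [valAt_congr_of_below hτ (fun _ _ => rfl) hs]
      exact hp.val_ne s hs
  · rw [hfl]
    rw [hb, Finset.mem_insert] at hy
    rcases hy with rfl | hy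
    · simp [flags_eq_zero hxb]
    · exact hp.flags_lt y hy
  · rw [hb, Finset.mem_insert, not_or] at hy'
    rw [hfl, Function.update_of_ne hy'.1]
    rw [below_iff_of_children_eq_singleton hc, hb, Finset.mem_insert] at hy
    exact hp.flags_eq y (by tauto) hy'.2
  · funext y
    by_cases h : y = x
    · subst h
      simp [state, hb, hfl, flags_eq_zero hxb]
    · simp [state, hb, hfl, h]
  · rw [value_of_child hc, hval, value_congr hτ fun _ _ => rfl]

/-- As `full a < 6`, the hypothesis on `σ x` forces type `a` and a completed flag sum, which is what
a vertex below but outside the bag must have. -/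
theorem Realizes.forget {t c : ι} {x : V} (hk : T.kind t = .forget c x)
    {σ : V → ℕ} {v a : ℕ} (h : T.Realizes c σ v) (hx : σ x = 6 * a + full a) :
    T.Realizes t (Function.update σ x 0) v := by
  have hv := T.kind_valid t
  rw [hk] at hv
  obtain ⟨hc, hxc, hb⟩ := hv
  obtain ⟨τ, fl, hp, rfl, rfl⟩ := h
  have hfl : ∀ y, T.flags fl t y = T.flags fl c y := fun y => by
    simp [flags_of_child hc, flagAt, hk]
  have hval : T.valAt τ fl t = 1 := by simp [valAt, hk]
  refine ⟨τ, fl, ⟨hp.type_lt, hp.flag_lt, fun s hs => ?_, fun y hy => ?_, fun y hy hy' => ?_⟩,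
    ?_, ?_⟩
  · rcases (mem_desc_of_child hc).1 hs with rfl | hs
    · simp [hval]
    · exact hp.val_ne s hs
  · rw [hfl]
    rw [hb] at hy
    exact hp.flags_lt y (Finset.mem_of_mem_erase hy)
  · rw [hfl]
    rw [below_iff_of_children_eq_singleton hc] at hy
    replace hy := hy.resolve_left hy'
    by_cases hyx : y = x
    · subst hyx
      have h1 := hp.flags_lt y hxc
      rw [state, if_pos hxc] at hx
      have h3 : full a < 6 := by unfold full; split_ifs <;> omega
      have h2 : τ y = a := by omega
      rw [h2]
      omega
    · exact hp.flags_eq y hy fun h => hy' (by rw [hb]; exact Finset.mem_erase.2 ⟨hyx, h⟩)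
  · funext y
    by_cases h : y = x
    · subst h
      simp [state, hb]
    · simp [state, hb, hfl, h]
  · rw [value_of_child hc, hval]

/-- Only the flags at the node `t` itself are redefined. Bounding the new sums by 6 keeps type and
sum readable from one digit; 1 is subtracted because both `v` and the edge value are one more than a
number of edges. -/
theorem Realizes.introduceEdge {t c : ι} {u w : V} (hk : T.kind t = .introduceEdge c u w)
    {σ : V → ℕ} {v f g : ℕ} (h : T.Realizes c σ v) (hf : σ u % 6 + f < 6) (hg : σ w % 6 + g < 6)
    (he : edgeVal (6 * (σ u / 6) + f) (6 * (σ w / 6) + g) ≠ 0) :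
    T.Realizes t (fun y => σ y + if y = u then f else if y = w then g else 0)
      (v + edgeVal (6 * (σ u / 6) + f) (6 * (σ w / 6) + g) - 1) := by
  classical
  have hv := T.kind_valid t
  rw [hk] at hv
  obtain ⟨hc, hb, hadj, hu, hw⟩ := hv
  obtain ⟨τ, fl, hp, rfl, rfl⟩ := h
  have huw : w ≠ u := hadj.ne'
  have hch := isChild_of_eq hc
  let fl' : ι → V → ℕ := Function.update fl t fun y => if y = u then f else if y = w then g else 0
  have hne : ∀ s ∈ T.desc c, s ≠ t := fun s hs h => hch.notMem_desc (h ▸ hs)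
  have hfl' : ∀ s ∈ T.desc c, fl' s = fl s := fun s hs => Function.update_of_ne (hne s hs) _ _
  have hflt : ∀ y, T.flagAt fl' t y = if y = u then f else if y = w then g else 0 := by
    intro y
    simp only [flagAt, hk, fl', Function.update_self]
    split_ifs <;> simp_all
  have hfl : ∀ y, T.flags fl' t y = T.flags fl c y + if y = u then f else if y = w then g else 0 :=
    fun y => by rw [flags_of_child hc, hflt, flags_congr hfl']
  have hdiv : ∀ {y}, y ∈ T.bag t → T.state τ fl c y / 6 = τ y ∧
      T.state τ fl c y % 6 = T.flags fl c y := by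
    intro y hy
    rw [hb] at hy
    have := hp.flags_lt y hy
    rw [state, if_pos hy]
    omega
  rw [(hdiv hu).1, (hdiv hw).1] at he ⊢
  rw [(hdiv hu).2] at hf
  rw [(hdiv hw).2] at hg
  have hval : T.valAt τ fl' t = edgeVal (6 * τ u + f) (6 * τ w + g) := by
    simp [valAt, hk, fl', huw]
  refine ⟨τ, fl', ⟨hp.type_lt, fun s y => ?_, fun s hs => ?_, fun y hy => ?_, fun y hy hy' => ?_⟩,
    ?_, ?_⟩
  · by_cases h : s = t
    · simp only [fl', h, Function.update_self]
      split_ifs <;> omega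
    · simpa [fl', h] using hp.flag_lt s y
  · rcases (mem_desc_of_child hc).1 hs with rfl | hs
    · rw [hval]
      exact he
    · rw [valAt_congr_of_below (fun _ _ => rfl) hfl' hs]
      exact hp.val_ne s hs
  · rw [hfl]
    rw [hb] at hy
    have := hp.flags_lt y hy
    split_ifs with h1 h2
    · rwa [h1]
    · rwa [h2]
    · simpa
  · have h1 : y ≠ u := fun h => hy' (h ▸ hu)
    have h2 : y ≠ w := fun h => hy' (h ▸ hw)
    rw [hfl, if_neg h1, if_neg h2, add_zero]
    rw [below_iff_of_children_eq_singleton hc] at hy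
    exact hp.flags_eq y (hy.resolve_left hy') (hb ▸ hy')
  · funext y
    simp only [state, hfl, ← hb]
    split_ifs with h1 h2 h3 h2 h3
    · omega
    · omega
    · omega
    · exact absurd (h2 ▸ hu) h1
    · exact absurd (h3 ▸ hw) h1
    · rfl
  · rw [value_of_child hc, hval, value_congr (fun _ _ => rfl) hfl']
    omega

/-- The two labellings are glued, the first taking precedence. They agree where both matter: a
vertex below both children lies in the bag of `t`, and there the types coincide by `hσ`. -/
theorem Realizes.join {t c₁ c₂ : ι} (hk : T.kind t = .join c₁ c₂)
    {σ₁ σ₂ : V → ℕ} {v₁ v₂ : ℕ} (h₁ : T.Realizes c₁ σ₁ v₁) (h₂ : T.Realizes c₂ σ₂ v₂)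
    (hσ : ∀ x ∈ T.bag t, σ₁ x / 6 = σ₂ x / 6 ∧ σ₁ x % 6 + σ₂ x % 6 < 6) :
    T.Realizes t (fun x => σ₁ x + σ₂ x % 6) (v₁ + v₂ - 1) := by
  classical
  have hv := T.kind_valid t
  rw [hk] at hv
  obtain ⟨hne, hc, hb₁, hb₂⟩ := hv
  obtain ⟨τ₁, fl₁, hp₁, rfl, rfl⟩ := h₁
  obtain ⟨τ₂, fl₂, hp₂, rfl, rfl⟩ := h₂
  obtain ⟨hch₁, hch₂⟩ := isChild_of_eq_pair hc
  let τ : V → ℕ := fun x => if T.Below c₁ x then τ₁ x else τ₂ x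
  let fl : ι → V → ℕ := fun s => if s ∈ T.desc c₁ then fl₁ s else fl₂ s
  have hbag : ∀ {y}, y ∈ T.bag t → τ₁ y = τ₂ y ∧ T.flags fl₁ c₁ y + T.flags fl₂ c₂ y < 6 ∧
      T.state τ₂ fl₂ c₂ y % 6 = T.flags fl₂ c₂ y := by
    intro y hy
    have h1 := hσ y hy
    have hy₁ := hy
    rw [hb₁] at hy₁
    rw [hb₂] at hy
    rw [state, state, if_pos hy₁, if_pos hy] at h1
    rw [state, if_pos hy]
    have := hp₁.flags_lt y hy₁
    have := hp₂.flags_lt y hy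
    omega
  have hτ₁ : ∀ x, T.Below c₁ x → τ x = τ₁ x := fun x hx => if_pos hx
  have hτ₂ : ∀ x, T.Below c₂ x → τ x = τ₂ x := by
    intro x hx
    simp only [τ]
    split_ifs with h
    · exact (hbag (mem_bag_of_below_of_below hch₁ hch₂ hne h hx)).1
    · rfl
  have hfl₁ : ∀ s ∈ T.desc c₁, fl s = fl₁ s := fun s hs => if_pos hs
  have hfl₂ : ∀ s ∈ T.desc c₂, fl s = fl₂ s := fun s hs =>
    if_neg fun h => Finset.disjoint_left.1 (disjoint_desc hch₁ hch₂ hne) h hs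
  have hfl : ∀ y, T.flags fl t y = T.flags fl₁ c₁ y + T.flags fl₂ c₂ y := by
    intro y
    have h0 : T.flagAt fl t y = 0 := by simp [flagAt, hk]
    rw [← flags_congr hfl₁, ← flags_congr hfl₂, flags, sum_desc_of_children hc hne, h0, add_zero]
    rfl
  have hval : T.valAt τ fl t = 1 := by simp [valAt, hk]
  refine ⟨τ, fl, ⟨fun x => ?_, fun s x => ?_, fun s hs => ?_, fun y hy => ?_, fun y hy hy' => ?_⟩,
    ?_, ?_⟩
  · simp only [τ]
    split_ifs
    exacts [hp₁.type_lt x, hp₂.type_lt x]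
  · simp only [fl]
    split_ifs
    exacts [hp₁.flag_lt s x, hp₂.flag_lt s x]
  · rcases (mem_desc_of_children hc).1 hs with rfl | hs | hs
    · simp [hval]
    · rw [valAt_congr_of_below hτ₁ hfl₁ hs]
      exact hp₁.val_ne s hs
    · rw [valAt_congr_of_below hτ₂ hfl₂ hs]
      exact hp₂.val_ne s hs
  · rw [hfl]
    exact (hbag hy).2.1
  · rw [hfl]
    rw [below_iff_of_children_eq_pair hc] at hy
    rcases hy.resolve_left hy' with h | h
    · have h' : ¬ T.Below c₂ y := fun h' => hy' (mem_bag_of_below_of_below hch₁ hch₂ hne h h')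
      rw [flags_eq_zero h', hτ₁ y h, add_zero]
      exact hp₁.flags_eq y h (hb₁ ▸ hy')
    · have h' : ¬ T.Below c₁ y := fun h' => hy' (mem_bag_of_below_of_below hch₁ hch₂ hne h' h)
      rw [flags_eq_zero h', hτ₂ y h, zero_add]
      exact hp₂.flags_eq y h (hb₂ ▸ hy')
  · funext y
    by_cases hy : y ∈ T.bag t
    · rw [(hbag hy).2.2, state, state, if_pos hy, if_pos (hb₁ ▸ hy), hfl,
        hτ₁ y (below_of_mem (hb₁ ▸ hy)), add_assoc]
    · simp [state, hy, hb₁ ▸ hy, hb₂ ▸ hy]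
  · have h1 : T.value τ fl t = T.value τ fl c₁ + T.value τ fl c₂ := by
      rw [value, sum_desc_of_children hc hne, hval]
      rfl
    rw [h1, value_congr hτ₁ hfl₁, value_congr hτ₂ hfl₂]
    omega

/-- The partial solutions at the root are the solutions. -/
theorem Realizes.root {σ : V → ℕ} {v : ℕ} (h : T.Realizes T.root σ v) :
    ∃ τ fl, T.IsSolution τ fl ∧ v = ∑ s, (T.valAt τ fl s - 1) + 1 := by
  have hd : T.desc T.root = Finset.univ := by
    ext s
    simp [mem_desc_root]
  obtain ⟨τ, fl, hp, rfl, rfl⟩ := h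
  refine ⟨τ, fl, ⟨hp.type_lt, hp.flag_lt, fun s => hp.val_ne s (mem_desc_root s), fun x => ?_⟩,
    by rw [value, hd]⟩
  rw [← hp.flags_eq x (below_root x) (by simp [T.root_bag]), flags, hd]

/-! ### The states of a solution -/

theorem state_leaf {t : ι} (hk : T.kind t = .leaf) :
    T.state τ fl t = (fun _ => 0) ∧ T.value τ fl t = 0 := by
  have hv := T.kind_valid t
  rw [hk] at hv
  refine ⟨funext fun x => by simp [state, hv.2], ?_⟩
  simp [value, desc_of_children_eq_empty hv.1, valAt, hk]

theorem state_introduceVertex {t c : ι} {x : V} (hk : T.kind t = .introduceVertex c x) :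
    T.state τ fl c = Function.update (T.state τ fl t) x 0 ∧ T.state τ fl t x = 6 * τ x ∧
      T.value τ fl t = T.value τ fl c := by
  have hv := T.kind_valid t
  rw [hk] at hv
  obtain ⟨hc, hx, hb⟩ := hv
  have hxb : ¬ T.Below c x := fun h => hx ((isChild_of_eq hc).mem_bag_of_below (by simp [hb]) h)
  have hfl : ∀ y, T.flags fl t y = T.flags fl c y := fun y => by
    simp [flags_of_child hc, flagAt, hk]
  refine ⟨funext fun y => ?_, ?_, ?_⟩
  · by_cases h : y = x
    · subst h
      simp [state, hx]
    · simp [state, h, hb, hfl]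
  · simp [state, hb, hfl, flags_eq_zero hxb]
  · simp [value_of_child hc, valAt, hk]

theorem state_join {t c₁ c₂ : ι} (hk : T.kind t = .join c₁ c₂) :
    (∀ y ∈ T.bag t, T.state τ fl t y = 6 * τ y + T.flags fl c₁ y + T.flags fl c₂ y) ∧
      T.value τ fl t = T.value τ fl c₁ + T.value τ fl c₂ := by
  have hv := T.kind_valid t
  rw [hk] at hv
  obtain ⟨hne, hc, -⟩ := hv
  have h0 : ∀ y, T.flagAt fl t y = 0 := fun y => by simp [flagAt, hk]
  have h1 : T.valAt τ fl t = 1 := by simp [valAt, hk]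
  refine ⟨fun y hy => ?_, ?_⟩
  · rw [state, if_pos hy, flags, sum_desc_of_children hc hne, h0, add_zero, ← add_assoc]
    rfl
  · rw [value, sum_desc_of_children hc hne, h1]
    rfl

namespace IsSolution

/-- The sums over `A` and over its complement add up to 0, 2 or 5, and neither is 1. This leaves the
nine pairs of a type and a flag sum. -/
theorem sum_flagAt (hS : T.IsSolution τ fl) (A : Finset ι) (x : V) :
    ∑ s ∈ A, T.flagAt fl s x = 0 ∨ τ x ≠ 0 ∧ ∑ s ∈ A, T.flagAt fl s x = 2 ∨
      τ x = 2 ∧ (∑ s ∈ A, T.flagAt fl s x = 3 ∨ ∑ s ∈ A, T.flagAt fl s x = 5) := by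
  classical
  have h1 := Finset.sum_add_sum_compl A fun s => T.flagAt fl s x
  rw [hS.sum_flag, full] at h1
  have h2 := sum_ne_one_of_two_three (A := A) (hS.flagAt_eq · x)
  have h3 := sum_ne_one_of_two_three (A := Aᶜ) (hS.flagAt_eq · x)
  split_ifs at h1 <;> omega

/-- All edges at `x` are introduced below `c`: another node with `x` in its bag would force `x` into
the bag of `t`. So the flag sum is complete when `x` is forgotten. -/
theorem state_forget (hS : T.IsSolution τ fl) {t c : ι} {x : V} (hk : T.kind t = .forget c x) :
    T.state τ fl t = Function.update (T.state τ fl c) x 0 ∧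
      T.state τ fl c x = 6 * τ x + full (τ x) ∧ T.value τ fl t = T.value τ fl c := by
  have hv := T.kind_valid t
  rw [hk] at hv
  obtain ⟨hc, hx, hb⟩ := hv
  have hfl : ∀ y, T.flags fl t y = T.flags fl c y := fun y => by
    simp [flags_of_child hc, flagAt, hk]
  refine ⟨funext fun y => ?_, ?_, ?_⟩
  · by_cases h : y = x
    · subst h
      simp [state, hb]
    · simp [state, h, hb, hfl]
  · rw [state, if_pos hx, ← hS.sum_flag x, flags]
    congr 1
    refine Finset.sum_subset (Finset.subset_univ _) fun s _ hs => flagAt_eq_zero fun hxs => ?_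
    have := ((isChild_of_eq hc).bag_inter (self_mem_desc c) hs hx hxs).2
    simp [hb] at this
  · simp [value_of_child hc, valAt, hk]

theorem state_introduceEdge (hS : T.IsSolution τ fl) {t c : ι} {u w : V}
    (hk : T.kind t = .introduceEdge c u w) :
    (T.state τ fl t = fun y => T.state τ fl c y + T.flagAt fl t y) ∧
      T.valAt τ fl t = edgeVal (6 * τ u + T.flagAt fl t u) (6 * τ w + T.flagAt fl t w) ∧
      T.value τ fl t + 1 = T.value τ fl c + T.valAt τ fl t := by
  have hv := T.kind_valid t
  rw [hk] at hv
  obtain ⟨hc, hb, -⟩ := hv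
  refine ⟨funext fun y => ?_, ?_, ?_⟩
  · by_cases h : y ∈ T.bag c
    · simp [state, hb, h, flags_of_child hc, add_assoc]
    · simp [state, hb, h, flagAt_eq_zero]
  · simp [flagAt, valAt, hk]
  · have := hS.val_ne t
    rw [value_of_child hc]
    omega

end IsSolution

end NiceTreeDecomposition

/-! ### Encoding of states by numbers -/

/-- The number with the given digits to base `24`. -/
def idx {n : ℕ} (σ : Fin n → ℕ) : ℕ := ∑ v, σ v * 24 ^ (v : ℕ)

theorem idx_succ {n : ℕ} (σ : Fin (n + 1) → ℕ) : idx σ = σ 0 + 24 * idx (σ ∘ Fin.succ) := by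
  rw [idx, Fin.sum_univ_succ, idx, Finset.mul_sum]
  simp only [Fin.val_zero, pow_zero, mul_one, Fin.val_succ, Function.comp]
  congr 1
  refine Finset.sum_congr rfl fun v _ => ?_
  ring

theorem idx_div_mod {n : ℕ} {σ : Fin n → ℕ} (hσ : ∀ v, σ v < 24) (u : Fin n) :
    idx σ / 24 ^ (u : ℕ) % 24 = σ u := by
  induction n with
  | zero => exact u.elim0
  | succ n ih =>
    have h0 := hσ 0
    rw [idx_succ]
    refine Fin.cases ?_ (fun u => ?_) u
    · simp only [Fin.val_zero, pow_zero, Nat.div_one]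
      omega
    · have h1 : (σ 0 + 24 * idx (σ ∘ Fin.succ)) / 24 = idx (σ ∘ Fin.succ) := by omega
      rw [Fin.val_succ, pow_succ', ← Nat.div_div_eq_div_mul, h1]
      exact ih (fun v => hσ _) u

theorem idx_injective {n : ℕ} {σ σ' : Fin n → ℕ} (hσ : ∀ v, σ v < 24) (hσ' : ∀ v, σ' v < 24)
    (h : idx σ = idx σ') : σ = σ' :=
  funext fun v => by rw [← idx_div_mod hσ, ← idx_div_mod hσ', h]

theorem idx_lt {n : ℕ} {σ : Fin n → ℕ} (hσ : ∀ v, σ v < 24) : idx σ < 24 ^ n := by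
  induction n with
  | zero => simp [idx]
  | succ n ih =>
    have h0 := hσ 0
    have := ih (σ := σ ∘ Fin.succ) fun v => hσ _
    rw [idx_succ, pow_succ']
    omega

theorem idx_add {n : ℕ} (σ φ : Fin n → ℕ) : idx (fun v => σ v + φ v) = idx σ + idx φ := by
  simp [idx, add_mul, Finset.sum_add_distrib]

theorem idx_update_zero {n : ℕ} (σ : Fin n → ℕ) (x : Fin n) :
    idx (Function.update σ x 0) = idx σ - σ x * 24 ^ (x : ℕ) := by
  have h1 := Finset.add_sum_erase Finset.univ (fun v => σ v * 24 ^ (v : ℕ)) (Finset.mem_univ x)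
  have h2 := Finset.add_sum_erase Finset.univ (fun v => Function.update σ x 0 v * 24 ^ (v : ℕ))
    (Finset.mem_univ x)
  have h3 : ∑ v ∈ Finset.univ.erase x, Function.update σ x 0 v * 24 ^ (v : ℕ) =
      ∑ v ∈ Finset.univ.erase x, σ v * 24 ^ (v : ℕ) :=
    Finset.sum_congr rfl fun v hv => by
      rw [Function.update_of_ne (Finset.ne_of_mem_erase hv)]
  simp only [Function.update_self, zero_mul, zero_add] at h2
  simp only [idx]
  omega

theorem idx_pair {n : ℕ} {u w : Fin n} (h : u ≠ w) (f g : ℕ) :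
    idx (fun v => if v = u then f else if v = w then g else 0) =
      f * 24 ^ (u : ℕ) + g * 24 ^ (w : ℕ) := by
  have : ∀ v : Fin n, (if v = u then f else if v = w then g else 0) * 24 ^ (v : ℕ) =
      (if v = u then f * 24 ^ (u : ℕ) else 0) + if v = w then g * 24 ^ (w : ℕ) else 0 := by
    intro v
    split_ifs <;> simp_all
  simp [idx, this, Finset.sum_add_distrib]

/-- The possible combinations of a type and the sums of the flags at the two children of a
node. -/
def codeList : List (ℕ × ℕ × ℕ) :=
  [(0, 0, 0), (1, 0, 0), (1, 2, 0), (1, 0, 2), (3, 0, 0), (3, 2, 0), (3, 0, 2),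
   (2, 0, 0), (2, 2, 0), (2, 0, 2), (2, 3, 0), (2, 0, 3), (2, 5, 0), (2, 0, 5), (2, 2, 3),
   (2, 3, 2)]

/-- The table of a function on the list of combinations. -/
def codeTable (g : ℕ × ℕ × ℕ → ℕ) : List (ℕ × ℕ) :=
  (List.range 16).map fun d => (d, g (codeList.getD d (0, 0, 0)))

/-- The type and flags at the first child. -/
def codeTable₁ : List (ℕ × ℕ) := codeTable fun p => 6 * p.1 + p.2.1

/-- The type and flags at the second child. -/
def codeTable₂ : List (ℕ × ℕ) := codeTable fun p => 6 * p.1 + p.2.2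

/-- The flags at the second child. -/
def codeTable₃ : List (ℕ × ℕ) := codeTable fun p => p.2.2

/-- The types without flags. -/
def bareTable : List (ℕ × ℕ) := [(0, 1), (6, 1), (12, 1), (18, 1)]

/-- The types with all the flags they need. -/
def fullTable : List (ℕ × ℕ) := [(0, 1), (8, 1), (17, 1), (20, 1)]

theorem code_facts {d : ℕ} (hd : d < 16) :
    tableVal codeTable₁ d < 24 ∧ tableVal codeTable₁ d % 6 + tableVal codeTable₃ d < 6 ∧
      tableVal codeTable₂ d = 6 * (tableVal codeTable₁ d / 6) + tableVal codeTable₃ d := by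
  have : ∀ d : Fin 16,
      tableVal codeTable₁ d < 24 ∧ tableVal codeTable₁ d % 6 + tableVal codeTable₃ d < 6 ∧
      tableVal codeTable₂ d = 6 * (tableVal codeTable₁ d / 6) + tableVal codeTable₃ d := by
    decide +kernel
  exact this ⟨d, hd⟩

/-- The possible sums of some of the flags at a vertex of type `τ`. -/
def FlagSum (τ f : ℕ) : Prop := f = 0 ∨ τ ≠ 0 ∧ f = 2 ∨ τ = 2 ∧ (f = 3 ∨ f = 5)

instance (τ f : ℕ) : Decidable (FlagSum τ f) := by unfold FlagSum; infer_instance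

theorem FlagSum.lt {τ f : ℕ} (h : FlagSum τ f) : f < 6 := by unfold FlagSum at h; omega

theorem exists_code {τ f g : ℕ} (hτ : τ < 4) (hf : FlagSum τ f) (hg : FlagSum τ g)
    (hfg : FlagSum τ (f + g)) :
    ∃ d < 16, tableVal codeTable₁ d = 6 * τ + f ∧ tableVal codeTable₂ d = 6 * τ + g ∧
      tableVal codeTable₃ d = g := by
  have : ∀ (τ : Fin 4) (f g : Fin 6), FlagSum τ f → FlagSum τ g → FlagSum τ (f + g) →
      ∃ d : Fin 16, tableVal codeTable₁ d = 6 * τ + f ∧ tableVal codeTable₂ d = 6 * τ + g ∧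
        tableVal codeTable₃ d = g := by decide +kernel
  obtain ⟨d, h⟩ := this ⟨τ, hτ⟩ ⟨f, hf.lt⟩ ⟨g, hg.lt⟩ hf hg hfg
  exact ⟨d, d.2, h⟩

theorem bareTable_facts {d : ℕ} (hd : d < 24) :
    (tableVal bareTable d = 0 ∨ tableVal bareTable d = 1) ∧
      (tableVal bareTable d ≠ 0 ↔ ∃ a < 4, d = 6 * a) := by
  have : ∀ d : Fin 24, (tableVal bareTable d = 0 ∨ tableVal bareTable d = 1) ∧
      (tableVal bareTable d ≠ 0 ↔ ∃ a < 4, (d : ℕ) = 6 * a) := by decide +kernel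
  exact this ⟨d, hd⟩

theorem fullTable_facts {d : ℕ} (hd : d < 24) :
    (tableVal fullTable d = 0 ∨ tableVal fullTable d = 1) ∧
      (tableVal fullTable d ≠ 0 ↔ ∃ a < 4, d = 6 * a + full a) := by
  have : ∀ d : Fin 24, (tableVal fullTable d = 0 ∨ tableVal fullTable d = 1) ∧
      (tableVal fullTable d ≠ 0 ↔ ∃ a < 4, (d : ℕ) = 6 * a + full a) := by decide +kernel
  exact this ⟨d, hd⟩

/-- The sum of two entries, each of which is `0` or one more than a number of edges. -/
def combine (a b : ℕ) : ℕ := (1 - (1 - a)) * ((1 - (1 - b)) * (a + b - 1))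

theorem combine_eq (a b : ℕ) : combine a b = if a = 0 ∨ b = 0 then 0 else a + b - 1 := by
  unfold combine
  rcases Nat.eq_zero_or_pos a with rfl | ha
  · simp
  · rcases Nat.eq_zero_or_pos b with rfl | hb
    · simp
    · rw [if_neg (by omega), show 1 - (1 - a) = 1 by omega, show 1 - (1 - b) = 1 by omega,
        one_mul, one_mul]

/-- The states that result from a choice of codes for the vertices of `b`. -/
def spread {n : ℕ} (b : Finset (Fin n)) (l : List (ℕ × ℕ)) (δ : Fin n → ℕ) (v : Fin n) : ℕ :=
  if v ∈ b then tableVal l (δ v) else 0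

theorem spread_facts {n : ℕ} (b : Finset (Fin n)) {δ : Fin n → ℕ} (hδ : ∀ v, δ v < 16)
    (v : Fin n) :
    spread b codeTable₁ δ v < 24 ∧ spread b codeTable₁ δ v % 6 + spread b codeTable₃ δ v < 6 ∧
      spread b codeTable₂ δ v = 6 * (spread b codeTable₁ δ v / 6) + spread b codeTable₃ δ v := by
  unfold spread
  split_ifs
  · exact code_facts (hδ v)
  · norm_num

theorem spread_lt {n : ℕ} (b : Finset (Fin n)) {δ : Fin n → ℕ} (hδ : ∀ v, δ v < 16)
    (v : Fin n) : spread b codeTable₂ δ v < 24 ∧ spread b codeTable₃ δ v < 24 := by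
  have := spread_facts b hδ v
  omega

theorem exists_spread {n : ℕ} (b : Finset (Fin n)) {τ F F' : Fin n → ℕ} (hτ : ∀ v, τ v < 4)
    (hF : ∀ v, FlagSum (τ v) (F v)) (hF' : ∀ v, FlagSum (τ v) (F' v))
    (hFF' : ∀ v, FlagSum (τ v) (F v + F' v)) :
    ∃ δ : Fin n → ℕ, (∀ v, δ v < 16) ∧
      (spread b codeTable₁ δ = fun v => if v ∈ b then 6 * τ v + F v else 0) ∧
      (spread b codeTable₂ δ = fun v => if v ∈ b then 6 * τ v + F' v else 0) ∧
      (spread b codeTable₃ δ = fun v => if v ∈ b then F' v else 0) := by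
  choose δ hδ h using fun v => exists_code (hτ v) (hF v) (hF' v) (hFF' v)
  refine ⟨δ, hδ, funext fun v => ?_, funext fun v => ?_, funext fun v => ?_⟩
  · rw [spread, (h v).1]
  · rw [spread, (h v).2.1]
  · rw [spread, (h v).2.2]

attribute [irreducible] codeTable₁ codeTable₂ codeTable₃ bareTable fullTable

/-! ### Transitions of the tables -/

namespace NiceTreeDecomposition

variable {n N : ℕ} {G : SimpleGraph (Fin n)} (T : NiceTreeDecomposition G (Fin N))

/-- The node whose bag contains the bags of `t` and its children. -/
def bigNode (t : Fin N) : Fin N :=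
  match T.kind t with
  | .forget c _ => c
  | _ => t

/-- The entry of the table of node `t` that a choice of codes leads to: its place and its value. -/
def cand (tab : Fin N → ℕ → ℕ) (t : Fin N) (X₁ X₂ F : ℕ) : ℕ × ℕ :=
  match T.kind t with
  | .leaf => (X₁, 1)
  | .introduceVertex c x =>
      (X₁, tableVal bareTable (X₁ / 24 ^ (x : ℕ) % 24) *
        tab c (X₁ - X₁ / 24 ^ (x : ℕ) % 24 * 24 ^ (x : ℕ)))
  | .introduceEdge c u w =>
      (X₁ + (F / 24 ^ (u : ℕ) % 24 * 24 ^ (u : ℕ) + F / 24 ^ (w : ℕ) % 24 * 24 ^ (w : ℕ)),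
        combine (tab c X₁) (edgeVal (X₂ / 24 ^ (u : ℕ) % 24) (X₂ / 24 ^ (w : ℕ) % 24)))
  | .forget c x =>
      (X₁ - X₁ / 24 ^ (x : ℕ) % 24 * 24 ^ (x : ℕ),
        tableVal fullTable (X₁ / 24 ^ (x : ℕ) % 24) * tab c X₁)
  | .join c₁ c₂ => (X₁ + F, combine (tab c₁ X₁) (tab c₂ X₂))

/-- The entry that the choice `δ` of codes leads to. -/
def candOf (tab : Fin N → ℕ → ℕ) (t : Fin N) (δ : Fin n → ℕ) : ℕ × ℕ :=
  T.cand tab t (idx (spread (T.bag (T.bigNode t)) codeTable₁ δ))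
    (idx (spread (T.bag (T.bigNode t)) codeTable₂ δ))
    (idx (spread (T.bag (T.bigNode t)) codeTable₃ δ))

/-- The entry `(X, v)` of the table of node `t` is justified. -/
def Justified (t : Fin N) (X v : ℕ) : Prop := v ≠ 0 → ∃ σ, X = idx σ ∧ T.Realizes t σ v

variable {T} {tab : Fin N → ℕ → ℕ}

theorem realizes_of_justified (h : ∀ t X, T.Justified t X (tab t X)) {t : Fin N}
    {σ : Fin n → ℕ} (hσ : ∀ v, σ v < 24) (hne : tab t (idx σ) ≠ 0) :
    T.Realizes t σ (tab t (idx σ)) := by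
  obtain ⟨σ', hσ', hr⟩ := h t (idx σ) hne
  obtain rfl := idx_injective hσ hr.lt hσ'
  exact hr

/-- Soundness of a transition for an arbitrary justified table, whatever has been computed so far.
Inadmissible choices yield the value 0 and claim nothing; the others match one of the `Realizes`
transitions. -/
theorem justified_candOf (h : ∀ t X, T.Justified t X (tab t X)) (t : Fin N) {δ : Fin n → ℕ}
    (hδ : ∀ v, δ v < 16) : T.Justified t (T.candOf tab t δ).1 (T.candOf tab t δ).2 := by
  unfold candOf
  generalize hb : T.bag (T.bigNode t) = b
  have hs := spread_facts b hδ
  have h1 := fun v => (hs v).1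
  have h2 := fun v => (spread_lt b hδ v).1
  have h3 := fun v => (spread_lt b hδ v).2
  have hoff : ∀ v ∉ b, spread b codeTable₁ δ v = 0 ∧ spread b codeTable₃ δ v = 0 := fun v hv => by
    simp [spread, hv]
  generalize spread b codeTable₁ δ = σ₁ at *
  generalize spread b codeTable₂ δ = σ₂ at *
  generalize spread b codeTable₃ δ = φ at *
  have hv := T.kind_valid t
  intro hne
  unfold cand at hne ⊢
  cases hk : T.kind t with
  | leaf =>
    rw [hk] at hv
    refine ⟨fun _ => 0, ?_, realizes_leaf hk⟩
    rw [bigNode, hk] at hb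
    rw [show σ₁ = fun _ => 0 from funext fun v => (hoff v (by simp [← hb, hv.2])).1]
  | introduceVertex c x =>
    simp only [hk] at hne ⊢
    rw [idx_div_mod h1, ← idx_update_zero] at hne ⊢
    obtain ⟨ha, hc⟩ := mul_ne_zero_iff.1 hne
    have hf := bareTable_facts (h1 x)
    obtain ⟨a, ha4, hax⟩ := hf.2.1 ha
    rw [hf.1.resolve_left ha, one_mul]
    have := (realizes_of_justified h (fun v => ?_) hc).introduceVertex hk ha4
    · refine ⟨_, ?_, this⟩
      rw [Function.update_idem, ← hax, Function.update_eq_self]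
    · by_cases hvx : v = x
      · simp [hvx]
      · simp [hvx, h1]
  | introduceEdge c u w =>
    simp only [hk] at hne ⊢
    rw [hk] at hv
    obtain ⟨-, -, hadj, -⟩ := hv
    rw [idx_div_mod h2, idx_div_mod h2, idx_div_mod h3, idx_div_mod h3, ← idx_pair hadj.ne,
      ← idx_add] at *
    rw [(hs u).2.2, (hs w).2.2, combine_eq] at hne ⊢
    split_ifs at hne ⊢ with hz
    · exact absurd rfl hne
    · rw [not_or] at hz
      exact ⟨_, rfl, (realizes_of_justified h h1 hz.1).introduceEdge hk (hs u).2.1 (hs w).2.1 hz.2⟩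
  | forget c x =>
    simp only [hk] at hne ⊢
    rw [idx_div_mod h1, ← idx_update_zero] at *
    obtain ⟨ha, hc⟩ := mul_ne_zero_iff.1 hne
    have hf := fullTable_facts (h1 x)
    obtain ⟨a, ha4, hax⟩ := hf.2.1 ha
    rw [hf.1.resolve_left ha, one_mul]
    exact ⟨_, rfl, (realizes_of_justified h h1 hc).forget hk hax⟩
  | join c₁ c₂ =>
    simp only [hk] at hne ⊢
    rw [← idx_add]
    rw [combine_eq] at hne ⊢
    split_ifs at hne ⊢ with hz
    · exact absurd rfl hne
    · rw [not_or] at hz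
      refine ⟨_, rfl, ?_⟩
      have := (realizes_of_justified h h1 hz.1).join hk (realizes_of_justified h h2 hz.2)
        fun x _ => by have := hs x; omega
      rwa [show (fun v => σ₁ v + φ v) = fun v => σ₁ v + σ₂ v % 6 from funext fun v => by
        have := hs v; omega]

/-- The entry of the table of node `t` for the solution is large enough. -/
def Reached (T : NiceTreeDecomposition G (Fin N)) (τ : Fin n → ℕ) (fl : Fin N → Fin n → ℕ)
    (tab : Fin N → ℕ → ℕ) (t : Fin N) : Prop :=
  T.value τ fl t + 1 ≤ tab t (idx (T.state τ fl t))

/-- Completeness. The choice `δ` is fixed before `tab`, because the table changes during the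
enumeration and the one relevant choice has to work for whatever table is present at its turn. -/
theorem IsSolution.exists_candOf {τ : Fin n → ℕ} {fl : Fin N → Fin n → ℕ}
    (hS : T.IsSolution τ fl) (t : Fin N) :
    ∃ δ : Fin n → ℕ, (∀ v, δ v < 16) ∧ ∀ tab, (∀ c, T.IsChild t c → T.Reached τ fl tab c) →
      (T.candOf tab t δ).1 = idx (T.state τ fl t) ∧
        T.value τ fl t + 1 ≤ (T.candOf tab t δ).2 := by
  classical
  have hsum : ∀ A x, FlagSum (τ x) (∑ s ∈ A, T.flagAt fl s x) := hS.sum_flagAt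
  have hlt : ∀ s x, T.state τ fl s x < 24 := by
    intro s x
    have h1 := hS.type_lt x
    have h2 := (hsum (T.desc s) x).lt
    unfold state flags
    split_ifs <;> omega
  have h0 : ∀ x, FlagSum (τ x) 0 := fun x => .inl rfl
  have hv := T.kind_valid t
  cases hk : T.kind t with
  | leaf =>
    have hb : T.bigNode t = t := by simp [bigNode, hk]
    rw [hk] at hv
    obtain ⟨h1, h2⟩ := state_leaf (τ := τ) (fl := fl) hk
    refine ⟨fun _ => 0, by simp, fun tab _ => ?_⟩
    simp only [candOf, hb, cand, hk, h1, h2]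
    refine ⟨?_, le_rfl⟩
    congr 1
    funext v
    simp [spread, hv.2]
  | introduceVertex c x =>
    have hb : T.bigNode t = t := by simp [bigNode, hk]
    rw [hk] at hv
    obtain ⟨h1, h2, h3⟩ := state_introduceVertex (τ := τ) (fl := fl) hk
    obtain ⟨δ, hδ, e1, -, -⟩ := exists_spread (T.bag t) hS.type_lt
      (F' := fun _ => 0) (hsum (T.desc t)) h0
      fun v => by simpa using hsum (T.desc t) v
    change spread (T.bag t) codeTable₁ δ = T.state τ fl t at e1
    refine ⟨δ, hδ, fun tab htab => ?_⟩
    have hc := htab c (isChild_of_eq hv.1)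
    simp only [candOf, hb, cand, hk, e1]
    rw [idx_div_mod (hlt t), ← idx_update_zero, ← h1]
    have hf := bareTable_facts (hlt t x)
    rw [hf.1.resolve_left (hf.2.2 ⟨τ x, hS.type_lt x, h2⟩), one_mul, h3]
    exact ⟨trivial, hc⟩
  | introduceEdge c u w =>
    have hb : T.bigNode t = t := by simp [bigNode, hk]
    rw [hk] at hv
    obtain ⟨hch, hbc, hadj, hu, hw⟩ := hv
    obtain ⟨h1, h2, h3⟩ := hS.state_introduceEdge hk
    -- The 16 codes also serve edge nodes: the second part of a code holds the flags of the node `t`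
    -- itself in place of those of a second child.
    obtain ⟨δ, hδ, e1, e2, e3⟩ := exists_spread (T.bag t) hS.type_lt (hsum (T.desc c))
      (fun v => by simpa using hsum {t} v) fun v => by
        have := hsum (T.desc t) v
        rwa [show ∑ s ∈ T.desc t, T.flagAt fl s v = _ from flags_of_child hch v] at this
    have hl2 := fun v => (spread_lt (T.bag t) hδ v).1
    have hl3 := fun v => (spread_lt (T.bag t) hδ v).2
    refine ⟨δ, hδ, fun tab htab => ?_⟩
    have hc := htab c (isChild_of_eq hch)
    simp only [candOf, hb, cand, hk]
    rw [idx_div_mod hl2, idx_div_mod hl2, idx_div_mod hl3, idx_div_mod hl3, ← idx_pair hadj.ne,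
      ← idx_add, e1, e2, e3]
    simp only [hu, hw, if_true]
    rw [← h2, h3, combine_eq, hbc]
    have he : (fun v => if v ∈ T.bag c then 6 * τ v + ∑ s ∈ T.desc c, T.flagAt fl s v else 0) =
      T.state τ fl c := rfl
    rw [he]
    unfold Reached at hc
    have := hS.val_ne t
    constructor
    · congr 1
      rw [h1]
      funext v
      rw [show (if v ∈ T.bag c then 6 * τ v + ∑ s ∈ T.desc c, T.flagAt fl s v else 0) =
        T.state τ fl c v from rfl]
      congr 1
      split_ifs with hvu hvw
      · rw [hvu]
      · rw [hvw]
      · simp [flagAt, hk, hvu, hvw]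
    · rw [if_neg (by omega)]
      omega
  | forget c x =>
    have hb : T.bigNode t = c := by simp [bigNode, hk]
    rw [hk] at hv
    obtain ⟨h1, h2, h3⟩ := hS.state_forget hk
    -- The choice ranges over the bag of the child, which still contains the forgotten vertex.
    obtain ⟨δ, hδ, e1, -, -⟩ := exists_spread (T.bag c) hS.type_lt
      (F' := fun _ => 0) (hsum (T.desc c)) h0
      fun v => by simpa using hsum (T.desc c) v
    change spread (T.bag c) codeTable₁ δ = T.state τ fl c at e1
    refine ⟨δ, hδ, fun tab htab => ?_⟩
    have hc := htab c (isChild_of_eq hv.1)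
    simp only [candOf, hb, cand, hk, e1]
    rw [idx_div_mod (hlt c), ← idx_update_zero, ← h1]
    have hf := fullTable_facts (hlt c x)
    rw [hf.1.resolve_left (hf.2.2 ⟨τ x, hS.type_lt x, h2⟩), one_mul, h3]
    exact ⟨rfl, hc⟩
  | join c₁ c₂ =>
    have hb : T.bigNode t = t := by simp [bigNode, hk]
    rw [hk] at hv
    obtain ⟨hne, hch, hb₁, hb₂⟩ := hv
    obtain ⟨h1, h2⟩ := state_join (τ := τ) (fl := fl) hk
    obtain ⟨δ, hδ, e1, e2, e3⟩ := exists_spread (T.bag t) hS.type_lt (hsum (T.desc c₁))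
      (hsum (T.desc c₂)) fun v => by
        rw [← Finset.sum_union (disjoint_desc (isChild_of_eq_pair hch).1
          (isChild_of_eq_pair hch).2 hne)]
        exact hsum _ v
    refine ⟨δ, hδ, fun tab htab => ?_⟩
    have hc₁ := htab c₁ (isChild_of_eq_pair hch).1
    have hc₂ := htab c₂ (isChild_of_eq_pair hch).2
    simp only [candOf, hb, cand, hk]
    rw [← idx_add]
    constructor
    · congr 1
      funext v
      simp only [e1, e3]
      by_cases hvb : v ∈ T.bag t
      · rw [h1 v hvb, if_pos hvb, if_pos hvb]
        rfl
      · simp [hvb, state]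
    · have e1' : spread (T.bag t) codeTable₁ δ = T.state τ fl c₁ := by rw [e1, hb₁]; rfl
      have e2' : spread (T.bag t) codeTable₂ δ = T.state τ fl c₂ := by rw [e2, hb₂]; rfl
      unfold Reached at hc₁ hc₂
      rw [e1', e2', combine_eq, if_neg (by omega), h2]
      omega

end NiceTreeDecomposition

/-! ### The layout of the input -/

theorem length_flatMap_finRange {N m : ℕ} (f : Fin N → List ℕ) (hf : ∀ i, (f i).length = m) :
    ((List.finRange N).flatMap f).length = N * m := by
  simp [List.length_flatMap, hf]

theorem getD_flatMap_finRange {N m : ℕ} (f : Fin N → List ℕ) (hf : ∀ i, (f i).length = m)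
    (i : Fin N) {j : ℕ} (hj : j < m) :
    ((List.finRange N).flatMap f).getD (i * m + j) 0 = (f i).getD j 0 := by
  induction N with
  | zero => exact i.elim0
  | succ N ih =>
    rw [List.finRange_succ, List.flatMap_cons]
    refine Fin.cases ?_ (fun i => ?_) i
    · rw [Fin.val_zero, zero_mul, zero_add, List.getD_append _ _ _ _ (by rw [hf]; exact hj)]
    · rw [Fin.val_succ, List.getD_append_right _ _ _ _ (by rw [hf]; nlinarith), hf,
        show ((i : ℕ) + 1) * m + j - m = i * m + j by rw [add_mul]; omega, List.flatMap_map]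
      exact ih (fun i => f i.succ) (fun i => hf _) i

section

variable {n N : ℕ} (G : SimpleGraph (Fin n)) (T : NiceTreeDecomposition G (Fin N))

/-- The position of the membership matrix of the bags. -/
def bagPos (n N : ℕ) : ℕ := 3 + n * n + N * N

/-- The position of the records of the nodes. -/
def recPos (n N : ℕ) : ℕ := bagPos n N + N * n

/-- The length of the input. -/
def inputLen (n N : ℕ) : ℕ := recPos n N + N * 4

theorem length_encodeKind (k : NodeKind (Fin n) (Fin N)) : (encodeKind k).length = 4 := by
  cases k <;> rfl

-- The two adjacency matrices stay anonymous: the program takes the edges and the children from the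
-- records, so only the lengths of the matrices matter.
open Classical in
theorem encode_eq : ∃ l₁ l₂ : List ℕ, l₁.length = n * n ∧ l₂.length = N * N ∧
    encode G T = [n, N, (T.root : ℕ)] ++ l₁ ++ l₂ ++
      ((List.finRange N).flatMap fun t => (List.finRange n).map fun v =>
        if v ∈ T.bag t then 1 else 0) ++
      ((List.finRange N).flatMap fun t => encodeKind (T.kind t)) := by
  refine ⟨_, _, ?_, ?_, by rw [encode]⟩
  · exact length_flatMap_finRange _ fun i => by simp
  · exact length_flatMap_finRange _ fun i => by simp

theorem length_encode : (encode G T).length = inputLen n N := by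
  classical
  obtain ⟨l₁, l₂, h₁, h₂, h⟩ := encode_eq G T
  rw [h]
  simp only [List.length_append, h₁, h₂, inputLen, recPos, bagPos]
  rw [length_flatMap_finRange (m := n) _ fun i => by simp,
    length_flatMap_finRange (m := 4) _ fun i => length_encodeKind _]
  simp

theorem encode_head : (encode G T).getD 0 0 = n ∧ (encode G T).getD 1 0 = N ∧
    (encode G T).getD 2 0 = T.root := by
  obtain ⟨l₁, l₂, -, -, h⟩ := encode_eq G T
  rw [h]
  simp

theorem encode_bag (t : Fin N) (v : Fin n) :
    (encode G T).getD (bagPos n N + t * n + v) 0 = if v ∈ T.bag t then 1 else 0 := by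
  classical
  obtain ⟨l₁, l₂, h₁, h₂, h⟩ := encode_eq G T
  have hl : ([n, N, (T.root : ℕ)] ++ l₁ ++ l₂).length = bagPos n N := by
    simp [h₁, h₂, bagPos]
    omega
  have hb := t.2
  have hv := v.2
  have hlt : (t : ℕ) * n + v < N * n := by nlinarith
  rw [h, List.getD_append, List.getD_append_right, hl,
    show bagPos n N + t * n + v - bagPos n N = t * n + v by omega,
    getD_flatMap_finRange (m := n) _ (fun i => by simp) t v.2]
  · simp
  · rw [hl]; omega
  · rw [List.length_append, hl, length_flatMap_finRange (m := n) _ fun i => by simp]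
    omega

theorem encode_record (t : Fin N) {j : ℕ} (hj : j < 4) :
    (encode G T).getD (recPos n N + t * 4 + j) 0 = (encodeKind (T.kind t)).getD j 0 := by
  classical
  obtain ⟨l₁, l₂, h₁, h₂, h⟩ := encode_eq G T
  have hl : ([n, N, (T.root : ℕ)] ++ l₁ ++ l₂ ++
      ((List.finRange N).flatMap fun t => (List.finRange n).map fun v =>
        if v ∈ T.bag t then 1 else 0)).length = recPos n N := by
    rw [List.length_append, length_flatMap_finRange (m := n) _ fun i => by simp]
    simp [h₁, h₂, recPos, bagPos]
    omega
  rw [h, List.getD_append_right, hl,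
    show recPos n N + t * 4 + j - recPos n N = t * 4 + j by omega,
    getD_flatMap_finRange (m := 4) _ (fun i => length_encodeKind _) t hj]
  rw [hl]; omega

theorem encode_le (a : ℕ) : (encode G T).getD a 0 ≤ n + N + 4 := by
  have key : ∀ x ∈ encode G T, x ≤ n + N + 4 := by
    intro x hx
    simp only [encode, List.mem_append, List.mem_flatMap, List.mem_map, List.mem_cons,
      List.not_mem_nil, or_false] at hx
    rcases hx with (((h | ⟨_, _, _, _, h⟩) | ⟨_, _, _, _, h⟩) | ⟨_, _, _, _, h⟩) | ⟨t, _, h⟩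
    · rcases h with h | h | h
      · omega
      · omega
      · have := T.root.2
        omega
    · split_ifs at h <;> omega
    · split_ifs at h <;> omega
    · split_ifs at h <;> omega
    · cases hk : T.kind t <;> simp [hk, encodeKind] at h <;> omega
  rcases lt_or_ge a (encode G T).length with h | h
  · rw [List.getD_eq_getElem _ _ h]
    exact key _ (List.getElem_mem h)
  · rw [List.getD_eq_default _ _ h]
    omega

end

/-! ### Decoding of the choices of codes -/

section

variable {n : ℕ} (b : Finset (Fin n))

/-- The number of elements of `b` from `j` on. -/
def cnt (j : ℕ) : ℕ := (b.filter fun v : Fin n => j ≤ (v : ℕ)).card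

theorem cnt_zero : cnt b 0 = b.card := by simp [cnt]

theorem cnt_self : cnt b n = 0 := by
  rw [cnt, Finset.card_eq_zero, Finset.filter_eq_empty_iff]
  intro v _
  have := v.2
  omega

theorem cnt_eq (v : Fin n) : cnt b v = cnt b (v + 1) + if v ∈ b then 1 else 0 := by
  have h : (b.filter fun w : Fin n => (v : ℕ) ≤ w) =
      (b.filter fun w : Fin n => (v : ℕ) + 1 ≤ w) ∪ b.filter fun w => w = v := by
    ext w
    simp only [Finset.mem_filter, Finset.mem_union, Fin.ext_iff]
    constructor
    · rintro ⟨h1, h2⟩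
      rcases Nat.lt_or_ge v w with h | h
      · exact .inl ⟨h1, h⟩
      · exact .inr ⟨h1, by omega⟩
    · rintro (⟨h1, h2⟩ | ⟨h1, h2⟩)
      · exact ⟨h1, by omega⟩
      · exact ⟨h1, by omega⟩
  rw [cnt, h, Finset.card_union_of_disjoint, cnt]
  · congr 1
    split_ifs with hv
    · rw [Finset.card_eq_one]
      exact ⟨v, by ext w; simp; rintro rfl; exact hv⟩
    · rw [Finset.card_eq_zero, Finset.filter_eq_empty_iff]
      rintro w hw rfl
      exact hv hw
  · rw [Finset.disjoint_filter]
    rintro w _ h rfl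
    omega

theorem cnt_anti {i j : ℕ} (h : i ≤ j) : cnt b j ≤ cnt b i :=
  Finset.card_le_card fun v hv => by
    rw [Finset.mem_filter] at hv ⊢
    exact ⟨hv.1, by omega⟩

/-- The choice of codes with number `x`. -/
def codes (x : ℕ) (v : Fin n) : ℕ := x / 16 ^ cnt b (v + 1) % 16

theorem codes_lt (x : ℕ) (v : Fin n) : codes b x v < 16 := Nat.mod_lt _ (by norm_num)

/-- Only vertices of `b` own a digit, at the position given by the number of later members of `b`;
this gives `16 ^ b.card` choices rather than `16 ^ n`. -/
theorem exists_codes {δ : Fin n → ℕ} (hδ : ∀ v, δ v < 16) :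
    ∃ x < 16 ^ b.card, ∀ v ∈ b, codes b x v = δ v := by
  suffices H : ∀ j ≤ n, ∃ x < 16 ^ cnt b j, ∀ v ∈ b, j ≤ (v : ℕ) → codes b x v = δ v by
    obtain ⟨x, hx, h⟩ := H 0 (Nat.zero_le _)
    exact ⟨x, cnt_zero b ▸ hx, fun v hv => h v hv (Nat.zero_le _)⟩
  intro j hj
  induction hj using Nat.decreasingInduction with
  | self => exact ⟨0, by positivity, fun v _ h => absurd v.2 (by omega)⟩
  | of_succ j hj ih =>
    obtain ⟨x, hx, h⟩ := ih
    let w : Fin n := ⟨j, hj⟩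
    have hc := cnt_eq b w
    change cnt b j = cnt b (j + 1) + _ at hc
    by_cases hw : w ∈ b
    · rw [if_pos hw] at hc
      -- The new vertex precedes those already treated, so it contributes the most significant
      -- digit.
      refine ⟨x + 16 ^ cnt b (j + 1) * δ w, ?_, fun v hv hjv => ?_⟩
      · rw [hc, pow_succ]
        have := hδ w
        nlinarith
      · rcases Nat.lt_or_ge j v with h' | h'
        · rw [← h v hv h', codes, codes]
          have h1 := cnt_eq b v
          have h2 := cnt_anti b (i := j + 1) (j := v) h'
          rw [if_pos hv] at h1
          obtain ⟨k, hk⟩ : ∃ k, cnt b (j + 1) = cnt b (v + 1) + 1 + k :=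
            ⟨cnt b (j + 1) - cnt b (v + 1) - 1, by omega⟩
          rw [hk, pow_add, pow_add, pow_one, mul_assoc, mul_assoc,
            Nat.add_mul_div_left _ _ (by positivity), Nat.add_mul_mod_self_left]
        · have hvw : v = w := Fin.ext (by simp only [w]; omega)
          subst hvw
          rw [codes, Nat.add_mul_div_left _ _ (by positivity)]
          change (x / 16 ^ cnt b (j + 1) + _) % 16 = _
          rw [Nat.div_eq_of_lt hx, zero_add, Nat.mod_eq_of_lt (hδ _)]
    · rw [if_neg hw, add_zero] at hc
      refine ⟨x, hc ▸ hx, fun v hv hjv => h v hv ?_⟩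
      rcases Nat.lt_or_ge j v with h' | h'
      · exact h'
      · exact absurd (show v = w from Fin.ext (by simp only [w]; omega)) fun h => hw (h ▸ hv)

/-- The part of the number `idx σ` that consists of the digits from `j` on. -/
def idxFrom (σ : Fin n → ℕ) (j : ℕ) : ℕ :=
  ∑ v ∈ Finset.univ.filter (fun v : Fin n => j ≤ (v : ℕ)), σ v * 24 ^ ((v : ℕ) - j)

theorem idxFrom_zero (σ : Fin n → ℕ) : idxFrom σ 0 = idx σ := by simp [idxFrom, idx]

theorem idxFrom_self (σ : Fin n → ℕ) : idxFrom σ n = 0 := by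
  rw [idxFrom, Finset.sum_eq_zero]
  intro v hv
  have := v.2
  rw [Finset.mem_filter] at hv
  omega

/-- Horner's rule, in the direction in which the loop over the vertices runs. -/
theorem idxFrom_eq (σ : Fin n → ℕ) (v : Fin n) :
    idxFrom σ v = idxFrom σ (v + 1) * 24 + σ v := by
  have h : (Finset.univ.filter fun w : Fin n => (v : ℕ) ≤ w) =
      insert v (Finset.univ.filter fun w : Fin n => (v : ℕ) + 1 ≤ w) := by
    ext w
    simp only [Finset.mem_filter, Finset.mem_insert, Fin.ext_iff, Finset.mem_univ, true_and]
    omega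
  rw [idxFrom, h, Finset.sum_insert (by simp), idxFrom, Finset.sum_mul, Nat.sub_self, pow_zero,
    mul_one, add_comm]
  congr 1
  refine Finset.sum_congr rfl fun w hw => ?_
  rw [Finset.mem_filter] at hw
  rw [show (w : ℕ) - v = w - (v + 1) + 1 by omega, pow_succ, mul_assoc]

theorem idxFrom_le (σ : Fin n → ℕ) (j : ℕ) : idxFrom σ j ≤ idx σ := by
  rw [idxFrom, idx]
  refine (Finset.sum_le_sum fun v _ => Nat.mul_le_mul_left (σ v)
    (Nat.pow_le_pow_right (by norm_num) (Nat.sub_le _ _))).trans ?_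
  exact Finset.sum_le_sum_of_subset (Finset.filter_subset _ _)

end

/-! ### The program -/

/-- The number of binary digits that suffices for all numbers that occur. -/
def wordLen (n N : ℕ) : ℕ := 5 * (n + N + 4)

theorem wordLen_pos (n N : ℕ) : 0 < wordLen n N := by unfold wordLen; omega

/-- Five binary digits hold a digit to base 24, and the 20 spare ones leave room for the factor
1000. The exponent involves `N` because powers are also formed from record fields that hold a node.
-/
theorem pow_mul_lt (n N : ℕ) : 24 ^ (n + N) * 1000 < 2 ^ wordLen n N := by
  rw [wordLen, pow_mul, pow_add _ (n + N) 4]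
  have h : (24 : ℕ) ^ (n + N) ≤ (2 ^ 5) ^ (n + N) := Nat.pow_le_pow_left (by norm_num) _
  have h' : (0 : ℕ) < (2 ^ 5) ^ (n + N) := by positivity
  norm_num only at h h' ⊢
  omega

theorem pow_lt {n N m : ℕ} (h : m ≤ n + N) : 24 ^ m * 1000 < 2 ^ wordLen n N :=
  (Nat.mul_le_mul_right _ (Nat.pow_le_pow_right (by norm_num) h)).trans_lt (pow_mul_lt n N)

theorem inputLen_lt (n N : ℕ) : inputLen n N + (n + N + 4) < 2 ^ wordLen n N := by
  have h1 : n + N + 4 < 2 ^ (n + N + 4) := Nat.lt_two_pow_self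
  have h2 : wordLen n N = (n + N + 4) + (n + N + 4) + (n + N + 4) + 2 * (n + N + 4) := by
    unfold wordLen; omega
  have h3 : 1 ≤ 2 ^ (2 * (n + N + 4)) := Nat.one_le_two_pow
  have h4 : inputLen n N + (n + N + 4) ≤ (n + N + 4) * (n + N + 4) * (n + N + 4) := by
    unfold inputLen recPos bagPos
    nlinarith [Nat.zero_le (n * N), Nat.zero_le n, Nat.zero_le N,
      Nat.zero_le (n * n), Nat.zero_le (N * N), Nat.zero_le (n * n * n), Nat.zero_le (N * N * N),
      Nat.zero_le (n * n * N), Nat.zero_le (n * N * N)]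
  rw [h2, pow_add, pow_add, pow_add]
  calc inputLen n N + (n + N + 4) ≤ (n + N + 4) * (n + N + 4) * (n + N + 4) := h4
    _ < 2 ^ (n + N + 4) * 2 ^ (n + N + 4) * 2 ^ (n + N + 4) := by gcongr
    _ ≤ _ := Nat.le_mul_of_pos_right _ h3

/-- The power of `24` with exponent in register `src`. -/
def powP (dst src : ℕ) : Prog :=
  setP dst 1 ;; loopP 17 (.reg src) (assigns [(dst, .reg dst * 24)])

/-- A factor bounding the time of `powP` for the exponent `m`. -/
def powCost (m : ℕ) : ℕ :=
  (1 : Ex).cost + 1 + (1 + 2 + m * (assignsCost [(0, .reg 0 * 24)] + 8))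

theorem does_powP {n N : ℕ} {s : State} {dst src : ℕ} (hd : dst ≠ 17) (hds : dst ≠ src)
    (hm : s.reg src ≤ n + N) :
    Does (wordLen n N) (powP dst src) s (powCost (s.reg src)) fun s' =>
      s'.mem = s.mem ∧ s'.reg dst = 24 ^ s.reg src ∧
        ∀ i, i ≠ dst → i ≠ 17 → s'.reg i = s.reg i := by
  have hl := wordLen_pos n N
  have h1 := pow_lt (n := n) (N := N) (Nat.zero_le _)
  refine Does.set_seq hl (fun _ => by rw [Ex.eval_one]; omega) ?_
  have he : (Ex.reg src).eval (s.setReg dst ((1 : Ex).eval s)) = s.reg src := by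
    simp [hds.symm]
  refine (Does.loop (k := assignsCost [(0, .reg 0 * 24)]) hl (fun j s' => s'.mem = s.mem ∧
    s'.reg dst = 24 ^ (s.reg src - j) ∧ s'.reg 17 = j ∧ j ≤ s.reg src ∧
      ∀ i, i ≠ dst → i ≠ 17 → s'.reg i = s.reg i) ?_ ?_ ?_ ?_).mono ?_ ?_
  · have h2 := pow_lt hm
    have h3 : s.reg src < 24 ^ s.reg src := Nat.lt_pow_self (by norm_num)
    rw [he]
    omega
  · rw [he]
    refine ⟨rfl, by simp [hd], by simp, le_rfl, fun i hi hi' => by simp [hi, hi']⟩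
  · exact fun j s' h => h.2.2.1
  · rintro j s' hj ⟨h1, h2, h3, h4, h5⟩
    have h6 := pow_lt (n := n) (N := N) (m := s.reg src - j) (by omega)
    have h7 : 24 ^ (s.reg src - (j + 1)) * 24 = 24 ^ (s.reg src - j) := by
      rw [← pow_succ]
      congr 1
      omega
    refine (Does.assigns hl ?_).mono le_rfl ?_
    · simp only [AssignsLt, Ex.eval_mul, Ex.eval_reg, Ex.eval_ofNat, State.reg_setReg, hd,
        if_false, h2, h7]
      exact ⟨by omega, trivial⟩
    · rintro _ rfl
      simp only [runAssigns, State.mem_setReg, State.reg_setReg, Ex.eval_mul, Ex.eval_reg,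
        Ex.eval_ofNat, hd, if_false, if_true, h2, h7, Ne.symm hd]
      exact ⟨h1, trivial, trivial, by omega, fun i hi hi' => by simp [hi, hi', h5]⟩
  · rw [he]
    rfl
  · rintro s' ⟨h1, h2, -, -, h5⟩
    exact ⟨h1, h2, h5⟩

/-- The entry of the membership matrix for the node in register `12` and the vertex in
register `17`. -/
def bitE : Ex := .mem (.reg 3 + .reg 12 * .reg 1 + .reg 17)

/-- The number of choices of codes. -/
def countP : Prog := setP 15 1 ;; loopP 17 (.reg 1) (assigns [(15, .reg 15 * (1 + 15 * bitE))])

/-- A factor bounding the time of `countP`. -/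
def countCost (n : ℕ) : ℕ :=
  (1 : Ex).cost + 1 + (1 + 2 + n * (assignsCost [(15, .reg 15 * (1 + 15 * bitE))] + 8))

theorem does_countP {n N : ℕ} {s : State} (hn : s.reg 1 = n) (b : Finset (Fin n))
    (hb : ∀ v : Fin n, s.mem (s.reg 3 + s.reg 12 * n + v) = if v ∈ b then 1 else 0) :
    Does (wordLen n N) countP s (countCost n) fun s' =>
      s'.mem = s.mem ∧ s'.reg 15 = 16 ^ b.card ∧ ∀ i, i ≠ 15 → i ≠ 17 → s'.reg i = s.reg i := by
  have hl := wordLen_pos n N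
  have h1 := pow_lt (n := n) (N := N) (Nat.zero_le _)
  refine Does.set_seq hl (fun _ => by rw [Ex.eval_one]; omega) ?_
  have he : (Ex.reg 1).eval (s.setReg 15 ((1 : Ex).eval s)) = n := by simp [hn]
  refine (Does.loop (k := assignsCost [(15, .reg 15 * (1 + 15 * bitE))]) hl
    (fun j s' => s'.mem = s.mem ∧ s'.reg 15 = 16 ^ cnt b j ∧ s'.reg 17 = j ∧ j ≤ n ∧
      ∀ i, i ≠ 15 → i ≠ 17 → s'.reg i = s.reg i) ?_ ?_ ?_ ?_).mono ?_ ?_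
  · have h2 := pow_lt (n := n) (N := N) (m := n) (by omega)
    have h3 : n < 24 ^ n := Nat.lt_pow_self (by norm_num)
    rw [he]
    omega
  · rw [he]
    refine ⟨rfl, by simp [cnt_self], by simp, le_rfl, fun i hi hi' => by simp [hi, hi']⟩
  · exact fun j s' h => h.2.2.1
  · rintro j s' hj ⟨h1, h2, h3, h4, h5⟩
    rw [he] at hj
    have h6 : s'.mem (s'.reg 3 + s'.reg 12 * s'.reg 1 + j) =
        if (⟨j, hj⟩ : Fin n) ∈ b then 1 else 0 := by
      rw [h1, h5 3 (by norm_num) (by norm_num), h5 12 (by norm_num) (by norm_num),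
        h5 1 (by norm_num) (by norm_num), hn]
      exact hb ⟨j, hj⟩
    -- The factor is 16 for a member of the bag and 1 otherwise, which avoids a branch.
    have h7 : 16 ^ cnt b (j + 1) * (1 + 15 * if (⟨j, hj⟩ : Fin n) ∈ b then 1 else 0) =
        16 ^ cnt b j := by
      rw [show cnt b j = _ from cnt_eq b ⟨j, hj⟩]
      split_ifs
      · rw [pow_succ]
      · simp
    have h8 : 16 ^ cnt b j < 2 ^ wordLen n N := by
      have h9 := pow_lt (n := n) (N := N) (m := n) (by omega)
      have h10 : cnt b j ≤ n := by
        have := cnt_anti b (Nat.zero_le j)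
        rw [cnt_zero] at this
        exact this.trans (card_finset_fin_le b)
      have h11 : 16 ^ cnt b j ≤ 24 ^ n :=
        (Nat.pow_le_pow_left (by norm_num) _).trans (Nat.pow_le_pow_right (by norm_num) h10)
      omega
    refine (Does.assigns hl ?_).mono le_rfl ?_
    · simp only [AssignsLt, bitE, Ex.eval_mul, Ex.eval_add, Ex.eval_mem, Ex.eval_one, Ex.eval_reg,
        Ex.eval_ofNat, State.reg_setReg, State.mem_setReg, h2]
      simp only [Nat.reduceEqDiff, if_false, if_true, OfNat.one_ne_ofNat, h6, h7]
      exact ⟨h8, trivial⟩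
    · rintro _ rfl
      simp only [runAssigns, bitE, Ex.eval_mul, Ex.eval_add, Ex.eval_mem, Ex.eval_one, Ex.eval_reg,
        Ex.eval_ofNat, State.reg_setReg, State.mem_setReg]
      simp only [Nat.reduceEqDiff, if_false, if_true, OfNat.one_ne_ofNat, h6, h7, h2]
      refine ⟨h1, trivial, trivial, by omega, fun i hi hi' => by simp [hi, hi', h5]⟩
  · rw [he]
    rfl
  · rintro s' ⟨h1, h2, -, -, h5⟩
    exact ⟨h1, cnt_zero b ▸ h2, h5⟩

/-- The initialization of the decoding. -/
def decodeInit : List (ℕ × Ex) := [(18, .reg 16), (19, 0), (20, 0), (21, 0)]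

/-- One step of the decoding. -/
def decodeStep : List (ℕ × Ex) :=
  [(22, bitE),
   (19, .reg 19 * 24 + .reg 22 * ((Ex.reg 18).mod 16).table codeTable₁),
   (20, .reg 20 * 24 + .reg 22 * ((Ex.reg 18).mod 16).table codeTable₂),
   (21, .reg 21 * 24 + .reg 22 * ((Ex.reg 18).mod 16).table codeTable₃),
   (18, .reg 18 / (1 + 15 * .reg 22))]

/-- The states for the choice of codes in register `16`. -/
def decodeP : Prog := assigns decodeInit ;; loopP 17 (.reg 1) (assigns decodeStep)

/-- A factor bounding the time of `decodeP`. -/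
def decodeCost (n : ℕ) : ℕ := assignsCost decodeInit + (1 + 2 + n * (assignsCost decodeStep + 8))

/-- As the vertices run downwards, the digits to base 16 are consumed from the least significant one
while three numbers to base 24 are built by Horner's rule. -/
theorem does_decodeP {n N : ℕ} {s : State} (hn : s.reg 1 = n) (b : Finset (Fin n))
    (hb : ∀ v : Fin n, s.mem (s.reg 3 + s.reg 12 * n + v) = if v ∈ b then 1 else 0) :
    Does (wordLen n N) decodeP s (decodeCost n) fun s' =>
      s'.mem = s.mem ∧ (∀ i < 17, s'.reg i = s.reg i) ∧
      s'.reg 19 = idx (spread b codeTable₁ (codes b (s.reg 16))) ∧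
      s'.reg 20 = idx (spread b codeTable₂ (codes b (s.reg 16))) ∧
      s'.reg 21 = idx (spread b codeTable₃ (codes b (s.reg 16))) := by
  refine Does.of_bnd fun hbnd => ?_
  have hl := wordLen_pos n N
  have h1 := pow_lt (n := n) (N := N) (Nat.zero_le _)
  have h24 := pow_lt (n := n) (N := N) (m := n) (by omega)
  set δ := codes b (s.reg 16)
  have hlt : ∀ v, δ v < 16 := codes_lt b (s.reg 16)
  have hf := spread_facts b hlt
  have hf' := spread_lt b hlt
  have hi₁ := idx_lt fun v => (hf v).1
  have hi₂ := idx_lt fun v => (hf' v).1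
  have hi₃ := idx_lt fun v => (hf' v).2
  refine (Does.assigns hl ?_).seq ?_
  · simp only [AssignsLt, decodeInit, Ex.eval_reg, Ex.eval_zero, and_true]
    exact ⟨hbnd.1 16, by omega, by omega, by omega⟩
  rintro _ rfl
  have he : (Ex.reg 1).eval (runAssigns decodeInit s) = n := by
    simp [runAssigns, decodeInit, hn]
  refine (Does.loop (k := assignsCost decodeStep) hl
    (fun j s' => s'.mem = s.mem ∧ (∀ i < 17, s'.reg i = s.reg i) ∧
      s'.reg 19 = idxFrom (spread b codeTable₁ δ) j ∧
      s'.reg 20 = idxFrom (spread b codeTable₂ δ) j ∧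
      s'.reg 21 = idxFrom (spread b codeTable₃ δ) j ∧
      s'.reg 18 = s.reg 16 / 16 ^ cnt b j ∧ s'.reg 17 = j ∧ j ≤ n) ?_ ?_ ?_ ?_).mono ?_ ?_
  · have h3 : n < 24 ^ n := Nat.lt_pow_self (by norm_num)
    rw [he]
    omega
  · rw [he]
    refine ⟨rfl, fun i hi => ?_, ?_⟩
    · have : i ≠ 17 ∧ i ≠ 18 ∧ i ≠ 19 ∧ i ≠ 20 ∧ i ≠ 21 := by omega
      simp [runAssigns, decodeInit, this]
    · simp [runAssigns, decodeInit, idxFrom_self, cnt_self]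
  · exact fun j s' h => h.2.2.2.2.2.2.1
  · rintro j s' hj ⟨h1, h2, h3, h4, h5, h6, h7, h8⟩
    rw [he] at hj
    have hbit : s'.mem (s'.reg 3 + s'.reg 12 * s'.reg 1 + j) =
        if (⟨j, hj⟩ : Fin n) ∈ b then 1 else 0 := by
      rw [h1, h2 3 (by norm_num), h2 12 (by norm_num), h2 1 (by norm_num), hn]
      exact hb ⟨j, hj⟩
    have hcode : s'.reg 18 % 16 = δ ⟨j, hj⟩ := by rw [h6]; rfl
    have hstep : ∀ L, idxFrom (spread b L δ) (j + 1) * 24 +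
        (if (⟨j, hj⟩ : Fin n) ∈ b then 1 else 0) * tableVal L (δ ⟨j, hj⟩) =
          idxFrom (spread b L δ) j := by
      intro L
      rw [show idxFrom (spread b L δ) j = _ from idxFrom_eq _ ⟨j, hj⟩]
      congr 1
      unfold spread
      split_ifs <;> simp
    have hy : s'.reg 18 / (1 + 15 * if (⟨j, hj⟩ : Fin n) ∈ b then 1 else 0) =
        s.reg 16 / 16 ^ cnt b j := by
      rw [h6, Nat.div_div_eq_div_mul, show cnt b j = _ from cnt_eq b ⟨j, hj⟩]
      congr 1
      split_ifs
      · rw [pow_succ]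
      · simp
    have hb1 : (if (⟨j, hj⟩ : Fin n) ∈ b then 1 else 0) < 2 ^ wordLen n N := by
      split_ifs <;> omega
    have hb2 := (idxFrom_le (spread b codeTable₁ δ) j)
    have hb3 := (idxFrom_le (spread b codeTable₂ δ) j)
    have hb4 := (idxFrom_le (spread b codeTable₃ δ) j)
    have hb5 : s.reg 16 / 16 ^ cnt b j < 2 ^ wordLen n N :=
      (Nat.div_le_self _ _).trans_lt (hbnd.1 16)
    refine (Does.assigns hl ?_).mono le_rfl ?_
    · simp only [AssignsLt, decodeStep, bitE, Ex.eval_mul, Ex.eval_add, Ex.eval_mem, Ex.eval_one,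
        Ex.eval_reg, Ex.eval_ofNat, Ex.eval_table, Ex.eval_mod, Ex.eval_div, State.reg_setReg,
        State.mem_setReg]
      simp only [Nat.reduceEqDiff, if_false, if_true,
        OfNat.one_ne_ofNat, hbit, hcode, h3, h4, h5, hstep, hy]
      exact ⟨hb1, by omega, by omega, by omega, hb5, trivial⟩
    · rintro _ rfl
      simp only [runAssigns, decodeStep, bitE, Ex.eval_mul, Ex.eval_add, Ex.eval_mem, Ex.eval_one,
        Ex.eval_reg, Ex.eval_ofNat, Ex.eval_table, Ex.eval_mod, Ex.eval_div, State.reg_setReg,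
        State.mem_setReg]
      simp only [Nat.reduceEqDiff, if_false, if_true,
        OfNat.one_ne_ofNat, hbit, hcode, h3, h4, h5, hstep, hy]
      refine ⟨h1, fun i hi => ?_, trivial, trivial, trivial, trivial, trivial, by omega⟩
      have : i ≠ 17 ∧ i ≠ 18 ∧ i ≠ 19 ∧ i ≠ 20 ∧ i ≠ 21 ∧ i ≠ 22 := by omega
      simp [this, h2 i hi]
  · rw [he]
    rfl
  · rintro s' ⟨h1, h2, h3, h4, h5, -⟩
    rw [idxFrom_zero] at h3 h4 h5
    exact ⟨h1, h2, h3, h4, h5⟩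

/-- The entry of the table of node `c` at the place `X`. -/
def tabE (c X : Ex) : Ex := .mem (.reg 5 + X * .reg 2 + c)

/-- The digit of `X` to base `24` at the place given by a power of `24`. -/
def digE (X p : Ex) : Ex := (X / p).mod 24

/-- The expression for `combine`. -/
def combineE (a b : Ex) : Ex := (1 - (1 - a)) * ((1 - (1 - b)) * (a + b - 1))

/-- The place and the value of the entry computed at a leaf. -/
def leafL : List (ℕ × Ex) := [(23, .reg 19), (24, 1)]

/-- The place and the value of the entry computed at a node that introduces a vertex. -/
def vertexL : List (ℕ × Ex) :=
  [(23, .reg 19), (24, (digE (.reg 19) (.reg 13)).table bareTable *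
    tabE (.reg 9) (.reg 19 - digE (.reg 19) (.reg 13) * .reg 13))]

/-- The place and the value of the entry computed at a node that introduces an edge. -/
def edgeL : List (ℕ × Ex) :=
  [(23, .reg 19 + (digE (.reg 21) (.reg 13) * .reg 13 + digE (.reg 21) (.reg 14) * .reg 14)),
   (24, combineE (tabE (.reg 9) (.reg 19))
    ((24 * digE (.reg 20) (.reg 13) + digE (.reg 20) (.reg 14)).table edgeTable))]

/-- The place and the value of the entry computed at a forget node. -/
def forgetL : List (ℕ × Ex) :=
  [(23, .reg 19 - digE (.reg 19) (.reg 13) * .reg 13),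
   (24, (digE (.reg 19) (.reg 13)).table fullTable * tabE (.reg 9) (.reg 19))]

/-- The place and the value of the entry computed at a join node. -/
def joinL : List (ℕ × Ex) :=
  [(23, .reg 19 + .reg 21),
   (24, combineE (tabE (.reg 9) (.reg 19)) (tabE (.reg 10) (.reg 20)))]

/-- The place and the value of the entry that the choice of codes leads to. -/
def caseP : Prog :=
  iteP (.reg 8) (iteP (.reg 8 - 1) (iteP (.reg 8 - 2) (iteP (.reg 8 - 3)
    (assigns joinL) (assigns forgetL)) (assigns edgeL)) (assigns vertexL)) (assigns leafL)

/-- A factor bounding the time of `caseP`. -/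
def caseCost : ℕ :=
  (Ex.reg 8).cost + (Ex.reg 8).wt + (Ex.reg 8 - 1).cost + (Ex.reg 8 - 1).wt +
  (Ex.reg 8 - 2).cost + (Ex.reg 8 - 2).wt + (Ex.reg 8 - 3).cost + (Ex.reg 8 - 3).wt +
  assignsCost joinL + assignsCost forgetL + assignsCost edgeL + assignsCost vertexL +
  assignsCost leafL

theorem does_pair {l : ℕ} (hl : 0 < l) {s : State} {e₁ e₂ : Ex} {Z v : ℕ} (h₁ : e₁.eval s = Z)
    (h₂ : e₂.eval (s.setReg 23 Z) = v) (hZ : Z < 2 ^ l) (hv : v < 2 ^ l) :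
    Does l (assigns [(23, e₁), (24, e₂)]) s (assignsCost [(23, e₁), (24, e₂)]) fun s' =>
      s'.mem = s.mem ∧ (∀ i < 23, s'.reg i = s.reg i) ∧ s'.reg 23 = Z ∧ s'.reg 24 = v := by
  subst h₁ h₂
  refine (Does.assigns (L := [(23, e₁), (24, e₂)]) (s := s) hl
    (And.intro hZ (And.intro hv trivial))).mono le_rfl ?_
  rintro _ rfl
  refine ⟨rfl, fun i hi => ?_, by simp [runAssigns], by simp [runAssigns]⟩
  have : i ≠ 23 ∧ i ≠ 24 := by omega
  simp [runAssigns, this]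

/-! ### Invariants and the treatment of one choice of codes -/

section

variable {n N : ℕ} {G : SimpleGraph (Fin n)} (T : NiceTreeDecomposition G (Fin N))

/-- The tables in the memory. -/
def tabOf (n : ℕ) {N : ℕ} (m : ℕ → ℕ) (t : Fin N) (X : ℕ) : ℕ := m (inputLen n N + X * N + t)

/-- The invariant of the program. -/
structure Good (s : State) : Prop where
  reg1 : s.reg 1 = n
  reg2 : s.reg 2 = N
  reg3 : s.reg 3 = bagPos n N
  reg4 : s.reg 4 = recPos n N
  reg5 : s.reg 5 = inputLen n N
  low : ∀ a < inputLen n N, s.mem a = (encode G T).getD a 0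
  just : ∀ t X, T.Justified t X (tabOf n s.mem t X)

/-- The registers hold the data of the node `t`. -/
structure NodeEnv (t : Fin N) (s : State) : Prop where
  reg7 : s.reg 7 = t
  reg8 : s.reg 8 = (encodeKind (T.kind t)).getD 0 0
  reg9 : s.reg 9 = (encodeKind (T.kind t)).getD 1 0
  reg10 : s.reg 10 = (encodeKind (T.kind t)).getD 2 0
  reg11 : s.reg 11 = (encodeKind (T.kind t)).getD 3 0
  reg12 : s.reg 12 = T.bigNode t
  reg13 : s.reg 13 = 24 ^ (encodeKind (T.kind t)).getD 2 0
  reg14 : s.reg 14 = 24 ^ (encodeKind (T.kind t)).getD 3 0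

variable {T}

theorem Good.congr {s s' : State} (h : Good T s) (hr : ∀ i < 6, s'.reg i = s.reg i)
    (hm : s'.mem = s.mem) : Good T s' where
  reg1 := (hr 1 (by norm_num)).trans h.reg1
  reg2 := (hr 2 (by norm_num)).trans h.reg2
  reg3 := (hr 3 (by norm_num)).trans h.reg3
  reg4 := (hr 4 (by norm_num)).trans h.reg4
  reg5 := (hr 5 (by norm_num)).trans h.reg5
  low := hm ▸ h.low
  just := hm ▸ h.just

theorem NodeEnv.congr {t : Fin N} {s s' : State} (h : NodeEnv T t s)
    (hr : ∀ i < 16, s'.reg i = s.reg i) : NodeEnv T t s' where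
  reg7 := (hr 7 (by norm_num)).trans h.reg7
  reg8 := (hr 8 (by norm_num)).trans h.reg8
  reg9 := (hr 9 (by norm_num)).trans h.reg9
  reg10 := (hr 10 (by norm_num)).trans h.reg10
  reg11 := (hr 11 (by norm_num)).trans h.reg11
  reg12 := (hr 12 (by norm_num)).trans h.reg12
  reg13 := (hr 13 (by norm_num)).trans h.reg13
  reg14 := (hr 14 (by norm_num)).trans h.reg14

theorem Good.bag {s : State} (h : Good T s) {c : Fin N} (v : Fin n) :
    s.mem (s.reg 3 + c * n + v) = if v ∈ T.bag c then 1 else 0 := by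
  rw [h.reg3, h.low, encode_bag]
  have := c.2
  have := v.2
  unfold inputLen recPos
  nlinarith

theorem does_caseP {t : Fin N} {s : State} (hG : Good T s) (hE : NodeEnv T t s)
    (h₁ : (T.cand (tabOf n s.mem) t (s.reg 19) (s.reg 20) (s.reg 21)).1 < 2 ^ wordLen n N)
    (h₂ : (T.cand (tabOf n s.mem) t (s.reg 19) (s.reg 20) (s.reg 21)).2 < 2 ^ wordLen n N) :
    Does (wordLen n N) caseP s caseCost fun s' =>
      s'.mem = s.mem ∧ (∀ i < 23, s'.reg i = s.reg i) ∧
      s'.reg 23 = (T.cand (tabOf n s.mem) t (s.reg 19) (s.reg 20) (s.reg 21)).1 ∧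
      s'.reg 24 = (T.cand (tabOf n s.mem) t (s.reg 19) (s.reg 20) (s.reg 21)).2 := by
  have hl := wordLen_pos n N
  obtain ⟨-, h8, h9, h10, h11, -, h13, h14⟩ := hE
  have hr2 := hG.reg2
  have hr5 := hG.reg5
  cases hk : T.kind t with
  | leaf =>
    simp only [hk, encodeKind, List.getD_cons_zero, List.getD_cons_succ] at h8 h9 h10 h11 h13 h14
    refine (Does.ite_of_eq (k := assignsCost leafL) hl (by simp [h8])
      (does_pair hl ?_ ?_ h₁ h₂)).mono
      (by unfold caseCost; omega) fun _ h => h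
    · simp [NiceTreeDecomposition.cand, hk]
    · simp [NiceTreeDecomposition.cand, hk]
  | introduceVertex c x =>
    simp only [hk, encodeKind, List.getD_cons_zero, List.getD_cons_succ] at h8 h9 h10 h11 h13 h14
    refine (Does.ite_of_ne hl (by simp [h8])
      (Does.ite_of_eq (k := assignsCost vertexL) hl (by simp [h8])
      (does_pair hl ?_ ?_ h₁ h₂))).mono
      (by unfold caseCost; omega) fun _ h => h
    · simp [NiceTreeDecomposition.cand, hk]
    · simp [NiceTreeDecomposition.cand, hk, digE, tabE, tabOf, h9, h13, hr2, hr5]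
  | introduceEdge c u w =>
    simp only [hk, encodeKind, List.getD_cons_zero, List.getD_cons_succ] at h8 h9 h10 h11 h13 h14
    refine (Does.ite_of_ne hl (by simp [h8])
      (Does.ite_of_ne hl (by simp [h8])
      (Does.ite_of_eq (k := assignsCost edgeL) hl (by simp [h8])
      (does_pair hl ?_ ?_ h₁ h₂)))).mono
      (by unfold caseCost; omega) fun _ h => h
    · simp [NiceTreeDecomposition.cand, hk, digE, h13, h14]
    · simp [NiceTreeDecomposition.cand, hk, digE, tabE, tabOf, combineE, combine, edgeVal_def, h9,
        h13, h14, hr2, hr5]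
  | forget c x =>
    simp only [hk, encodeKind, List.getD_cons_zero, List.getD_cons_succ] at h8 h9 h10 h11 h13 h14
    refine (Does.ite_of_ne hl (by simp [h8])
      (Does.ite_of_ne hl (by simp [h8])
      (Does.ite_of_ne hl (by simp [h8])
      (Does.ite_of_eq (k := assignsCost forgetL) hl (by simp [h8])
      (does_pair hl ?_ ?_ h₁ h₂))))).mono
      (by unfold caseCost; omega) fun _ h => h
    · simp [NiceTreeDecomposition.cand, hk, digE, h13]
    · simp [NiceTreeDecomposition.cand, hk, digE, tabE, tabOf, h9, h13, hr2, hr5]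
  | join c₁ c₂ =>
    simp only [hk, encodeKind, List.getD_cons_zero, List.getD_cons_succ] at h8 h9 h10 h11 h13 h14
    refine (Does.ite_of_ne hl (by simp [h8])
      (Does.ite_of_ne hl (by simp [h8])
      (Does.ite_of_ne hl (by simp [h8])
      (Does.ite_of_ne (k := assignsCost joinL) hl (by simp [h8])
      (does_pair hl ?_ ?_ h₁ h₂))))).mono
      (by unfold caseCost; omega) fun _ h => h
    · simp [NiceTreeDecomposition.cand, hk]
    · simp [NiceTreeDecomposition.cand, hk, tabE, tabOf, combineE, combine, h9, h10, hr2, hr5]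

/-- A digit times its place value does not exceed the number, so the computed place fits the word
length even for inadmissible choices. -/
theorem cand_fst_le (tab : Fin N → ℕ → ℕ) (t : Fin N) (X₁ X₂ F : ℕ) :
    (T.cand tab t X₁ X₂ F).1 ≤ X₁ + (F + F) := by
  have key : ∀ p, F / p % 24 * p ≤ F := fun p =>
    (Nat.mul_le_mul_right _ (Nat.mod_le _ _)).trans (Nat.div_mul_le_self _ _)
  unfold NiceTreeDecomposition.cand
  cases T.kind t with
  | leaf => exact Nat.le_add_right _ _
  | introduceVertex c x => exact Nat.le_add_right _ _
  | introduceEdge c u w =>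
    have := key (24 ^ (u : ℕ))
    have := key (24 ^ (w : ℕ))
    simp only
    omega
  | forget c x => exact (Nat.sub_le _ _).trans (Nat.le_add_right _ _)
  | join c₁ c₂ => exact Nat.add_le_add_left (Nat.le_add_right _ _) _

/-- The treatment of one choice of codes. -/
def stepP : Prog :=
  decodeP ;; caseP ;; putP (.reg 5 + .reg 23 * .reg 2 + .reg 7)
    ((tabE (.reg 7) (.reg 23)).max (.reg 24))

/-- A factor bounding the time of `stepP`. -/
def stepCost (n : ℕ) : ℕ :=
  decodeCost n + (caseCost + ((Ex.reg 5 + .reg 23 * .reg 2 + .reg 7).cost +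
    ((tabE (.reg 7) (.reg 23)).max (.reg 24)).cost +
    (Ex.reg 5 + .reg 23 * .reg 2 + .reg 7).wt + 1))

/-- The tables of all nodes are interleaved; the residue modulo `N` tells the node. -/
theorem addr_inj {N X X' : ℕ} {t t' : Fin N} {q : ℕ} (h : q + X * N + t = q + X' * N + t') :
    X = X' ∧ t = t' := by
  have hN : 0 < N := t.pos
  have h' : (t : ℕ) + N * X = t' + N * X' := by rw [mul_comm N, mul_comm N]; omega
  have h1 : (t : ℕ) = t' := by
    have := congrArg (· % N) h'
    simpa [Nat.add_mul_mod_self_left, Nat.mod_eq_of_lt t.2, Nat.mod_eq_of_lt t'.2] using this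
  refine ⟨?_, Fin.ext h1⟩
  rw [h1] at h'
  exact Nat.eq_of_mul_eq_mul_left hN (Nat.add_left_cancel h')

/-- Storing the maximum never lowers an entry, and it preserves justification because the maximum is
one of two justified values. -/
theorem does_stepP {t : Fin N} {s : State} (hG : Good T s) (hE : NodeEnv T t s) :
    Does (wordLen n N) stepP s (stepCost n) fun s' =>
      (∀ i < 17, s'.reg i = s.reg i) ∧ Good T s' ∧
      (∀ (t' : Fin N) X, tabOf n s.mem t' X ≤ tabOf n s'.mem t' X) ∧
      (T.candOf (tabOf n s.mem) t (codes (T.bag (T.bigNode t)) (s.reg 16))).2 ≤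
        tabOf n s'.mem t
          (T.candOf (tabOf n s.mem) t (codes (T.bag (T.bigNode t)) (s.reg 16))).1 := by
  refine Does.of_bnd fun hbnd => ?_
  have hl := wordLen_pos n N
  generalize hδ : codes (T.bag (T.bigNode t)) (s.reg 16) = δ
  have hδ16 : ∀ v, δ v < 16 := fun v => hδ ▸ codes_lt _ _ v
  have hj := NiceTreeDecomposition.justified_candOf hG.just t hδ16
  generalize hZ : (T.candOf (tabOf n s.mem) t δ).1 = Z at hj ⊢
  generalize hv : (T.candOf (tabOf n s.mem) t δ).2 = v at hj ⊢
  have hZlt : Z < 2 ^ wordLen n N := by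
    have h1 := idx_lt fun v => (spread_facts (T.bag (T.bigNode t)) hδ16 v).1
    have h2 := idx_lt fun v => (spread_lt (T.bag (T.bigNode t)) hδ16 v).2
    have h3 := pow_lt (n := n) (N := N) (m := n) (by omega)
    have h4 : Z ≤ _ := hZ ▸ cand_fst_le _ _ _ _ _
    omega
  have hvlt : v < 2 ^ wordLen n N := by
    have h1 := inputLen_lt n N
    by_cases h0 : v = 0
    · omega
    · obtain ⟨σ, -, hr⟩ := hj h0
      have := hr.le_card
      rw [Fintype.card_fin] at this
      omega
  refine (does_decodeP (N := N) hG.reg1 (T.bag (T.bigNode t)) fun v => by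
    rw [hE.reg12]; exact hG.bag v).seq fun s₁ h₁ => ?_
  obtain ⟨hm₁, hr₁, h19, h20, h21⟩ := h₁
  rw [hδ] at h19 h20 h21
  have hG₁ := hG.congr (fun i hi => hr₁ i (by omega)) hm₁
  have hE₁ := hE.congr fun i hi => hr₁ i (by omega)
  have hcand : T.cand (tabOf n s₁.mem) t (s₁.reg 19) (s₁.reg 20) (s₁.reg 21) = (Z, v) := by
    rw [h19, h20, h21, hm₁, ← hZ, ← hv]
    rfl
  refine (does_caseP hG₁ hE₁ (by rw [hcand]; exact hZlt) (by rw [hcand]; exact hvlt)).seq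
    fun s₂ h₂ => ?_
  rw [hcand] at h₂
  obtain ⟨hm₂, hr₂, h23, h24⟩ := h₂
  have hr : ∀ i < 17, s₂.reg i = s.reg i := fun i hi => (hr₂ i (by omega)).trans (hr₁ i hi)
  have hm : s₂.mem = s.mem := hm₂.trans hm₁
  have ha : (Ex.reg 5 + .reg 23 * .reg 2 + .reg 7).eval s₂ = inputLen n N + Z * N + t := by
    simp [hr, hG.reg5, hG.reg2, hE.reg7, h23]
  have hval : ((tabE (.reg 7) (.reg 23)).max (.reg 24)).eval s₂ = max (tabOf n s.mem t Z) v := by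
    simp [tabE, hr, hG.reg5, hG.reg2, hE.reg7, h23, h24, tabOf, hm]
  refine (Does.put hl ?_).mono le_rfl ?_
  · rw [hval]
    exact max_lt (hbnd.2 _) hvlt
  · rintro _ rfl
    rw [ha, hval]
    have htab : ∀ t' X, tabOf n (s₂.setMem (inputLen n N + Z * N + t)
        (max (tabOf n s.mem t Z) v)).mem t' X =
          if X = Z ∧ t' = t then max (tabOf n s.mem t Z) v else tabOf n s.mem t' X := by
      intro t' X
      rw [tabOf, State.mem_setMem, hm]
      refine if_congr ⟨addr_inj, ?_⟩ rfl rfl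
      rintro ⟨rfl, rfl⟩
      rfl
    refine ⟨fun i hi => by simp [hr i hi], ?_, fun t' X => ?_, ?_⟩
    · have hg := hG.congr (s' := s₂) (fun i hi => hr i (by omega)) hm
      refine ⟨hg.reg1, hg.reg2, hg.reg3, hg.reg4, hg.reg5, fun a ha => ?_, fun t' X => ?_⟩
      · rw [State.mem_setMem, if_neg (by omega)]
        exact hg.low a ha
      · rw [htab]
        split_ifs with h
        · rw [h.1, h.2]
          rcases max_choice (tabOf n s.mem t Z) v with h' | h' <;> rw [h']
          · exact hG.just t Z
          · exact hj
        · exact hG.just t' X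
    · rw [htab]
      split_ifs with h
      · rw [h.1, h.2]
        exact le_max_left _ _
      · exact le_rfl
    · rw [htab, if_pos ⟨rfl, rfl⟩]
      exact le_max_right _ _

end

/-! ### Sweeps over the nodes and the whole program -/

section

variable {n N : ℕ} {G : SimpleGraph (Fin n)} {T : NiceTreeDecomposition G (Fin N)}
  {τ : Fin n → ℕ} {fl : Fin N → Fin n → ℕ}

theorem NiceTreeDecomposition.Reached.mono {tab tab' : Fin N → ℕ → ℕ} {t : Fin N}
    (h : T.Reached τ fl tab t) (hle : ∀ t X, tab t X ≤ tab' t X) : T.Reached τ fl tab' t :=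
  le_trans h (hle _ _)

/-- Needed because a code number reproduces a given choice only on the bag. -/
theorem NiceTreeDecomposition.candOf_congr (tab : Fin N → ℕ → ℕ) (t : Fin N) {δ δ' : Fin n → ℕ}
    (h : ∀ v ∈ T.bag (T.bigNode t), δ v = δ' v) : T.candOf tab t δ = T.candOf tab t δ' := by
  have hs : ∀ L, spread (T.bag (T.bigNode t)) L δ = spread (T.bag (T.bigNode t)) L δ' := by
    intro L
    funext v
    unfold spread
    split_ifs with hv
    · rw [h v hv]
    · rfl
  simp only [candOf, hs]

/-- The progress made at the nodes in `A` between two states. -/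
structure Progress (T : NiceTreeDecomposition G (Fin N)) (τ : Fin n → ℕ)
    (fl : Fin N → Fin n → ℕ) (A : Set (Fin N)) (s s' : State) : Prop where
  good : Good T s'
  le : ∀ (t : Fin N) X, tabOf n s.mem t X ≤ tabOf n s'.mem t X
  reached : ∀ t ∈ A, (∀ c, T.IsChild t c → T.Reached τ fl (tabOf n s.mem) c) →
    T.Reached τ fl (tabOf n s'.mem) t

/-- Only the pass whose counter equals the code number `x` of the solution matters for progress:
before it nothing is claimed, and afterwards entries only grow. -/
theorem does_choices (hS : T.IsSolution τ fl) {t : Fin N} {s : State} (hG : Good T s)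
    (hE : NodeEnv T t s) (h15 : s.reg 15 = 16 ^ (T.bag (T.bigNode t)).card) :
    Does (wordLen n N) (loopP 16 (.reg 15) stepP) s
      (3 + 16 ^ (T.bag (T.bigNode t)).card * (stepCost n + 8)) fun s' =>
      (∀ i < 16, s'.reg i = s.reg i) ∧ Progress T τ fl {t} s s' := by
  refine Does.of_bnd fun hbnd => ?_
  obtain ⟨δ, hδ, hcand⟩ := hS.exists_candOf t
  obtain ⟨x, hx, hxδ⟩ := exists_codes (T.bag (T.bigNode t)) hδ
  have he : (Ex.reg 15).eval s = 16 ^ (T.bag (T.bigNode t)).card := h15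
  refine (Does.loop (k := stepCost n) (wordLen_pos n N)
    (fun j s' => s'.reg 16 = j ∧ (∀ i < 16, s'.reg i = s.reg i) ∧
      Progress T τ fl {t' | t' = t ∧ j ≤ x} s s') ?_ ?_ (fun _ _ h => h.1) ?_).mono
      (by rw [he]; rfl) fun s' h => ⟨h.2.1, ?_⟩
  · exact hbnd.1 15
  · have hr : ∀ i < 16, (s.setReg 16 ((Ex.reg 15).eval s)).reg i = s.reg i := fun i hi => by
      rw [State.reg_setReg, if_neg (by omega)]
    refine ⟨by simp, hr, hG.congr (fun i hi => hr i (by omega)) rfl, fun _ _ => le_rfl, ?_⟩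
    rintro t' ⟨-, ht'⟩
    rw [he] at ht'
    omega
  · rintro j s' - ⟨-, h2, h3⟩
    have hr : ∀ i < 16, (s'.setReg 16 j).reg i = s.reg i := fun i hi => by
      rw [State.reg_setReg, if_neg (by omega), h2 i hi]
    have hg : Good T (s'.setReg 16 j) :=
      h3.good.congr (fun i hi => by rw [State.reg_setReg, if_neg (by omega)]) rfl
    refine (does_stepP hg (hE.congr hr)).mono le_rfl ?_
    rintro s'' ⟨g1, g2, g3, g4⟩
    refine ⟨by simp [g1 16], fun i hi => (g1 i (by omega)).trans (hr i hi), g2,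
      fun t' X => (h3.le t' X).trans (g3 t' X), ?_⟩
    rintro t' ⟨rfl, hj⟩ hc
    rcases Nat.lt_or_ge j x with hjx | hjx
    · exact (h3.reached t' ⟨rfl, hjx⟩ hc).mono g3
    · obtain rfl : j = x := le_antisymm hj hjx
      obtain ⟨e1, e2⟩ := hcand (tabOf n s'.mem) fun c hcc => (hc c hcc).mono h3.le
      have e3 : (s'.setReg 16 j).reg 16 = j := by simp
      rw [e3, State.mem_setReg, NiceTreeDecomposition.candOf_congr _ _ hxδ, e1] at g4
      exact e2.trans g4
  · exact ⟨h.2.2.good, h.2.2.le, fun t' ht' => h.2.2.reached t' ⟨ht', Nat.zero_le _⟩⟩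

/-- The data of the node in register `7`. -/
def recL : List (ℕ × Ex) :=
  [(8, .mem (.reg 4 + .reg 7 * 4)), (9, .mem (.reg 4 + .reg 7 * 4 + 1)),
   (10, .mem (.reg 4 + .reg 7 * 4 + 2)), (11, .mem (.reg 4 + .reg 7 * 4 + 3)),
   (12, (Ex.reg 8).eq 3 * .reg 9 + (1 - (Ex.reg 8).eq 3) * .reg 7)]

/-- The treatment of the node in register `7`. -/
def nodeP : Prog :=
  assigns recL ;; powP 13 10 ;; powP 14 11 ;; countP ;; loopP 16 (.reg 15) stepP

/-- A factor bounding the time of `nodeP` if all bags have at most `w` elements. -/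
def nodeCost (n N w : ℕ) : ℕ :=
  assignsCost recL + (powCost (n + N) + (powCost (n + N) + (countCost n +
    (3 + 16 ^ w * (stepCost n + 8)))))

theorem encodeKind_le (k : NodeKind (Fin n) (Fin N)) :
    (encodeKind k).getD 0 0 ≤ 4 ∧ (encodeKind k).getD 1 0 ≤ n + N ∧
      (encodeKind k).getD 2 0 ≤ n + N ∧ (encodeKind k).getD 3 0 ≤ n + N := by
  cases k <;> simp [encodeKind] <;> omega

theorem bigNode_eq (T : NiceTreeDecomposition G (Fin N)) (t : Fin N) :
    Ex.eqInd ((encodeKind (T.kind t)).getD 0 0) 3 * (encodeKind (T.kind t)).getD 1 0 +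
      (1 - Ex.eqInd ((encodeKind (T.kind t)).getD 0 0) 3) * t = T.bigNode t := by
  unfold NiceTreeDecomposition.bigNode
  cases T.kind t <;> simp [encodeKind, Ex.eqInd]

theorem powCost_mono {m m' : ℕ} (h : m ≤ m') : powCost m ≤ powCost m' := by
  unfold powCost
  gcongr

theorem does_nodeP (hS : T.IsSolution τ fl) {w : ℕ} (hw : ∀ t, (T.bag t).card ≤ w) {t : Fin N}
    {s : State} (hG : Good T s) (h7 : s.reg 7 = t) :
    Does (wordLen n N) nodeP s (nodeCost n N w) fun s' =>
      (∀ i < 8, s'.reg i = s.reg i) ∧ Progress T τ fl {t} s s' := by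
  have hl := wordLen_pos n N
  have hlt := inputLen_lt n N
  obtain ⟨f0, f1, f2, f3⟩ := encodeKind_le (T.kind t)
  have hrec : ∀ j < 4, s.mem (recPos n N + t * 4 + j) = (encodeKind (T.kind t)).getD j 0 := by
    intro j hj
    rw [← encode_record G T t hj, hG.low]
    have := t.2
    unfold inputLen
    omega
  have r0 := hrec 0 (by norm_num)
  have r1 := hrec 1 (by norm_num)
  have r2 := hrec 2 (by norm_num)
  have r3 := hrec 3 (by norm_num)
  have h4 := hG.reg4
  have hbig := bigNode_eq T t
  have hbl := (T.bigNode t).2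
  rw [add_zero] at r0
  unfold nodeP nodeCost
  refine (Does.assigns hl ?_).seq ?_
  · simp [AssignsLt, recL, h4, h7, r0, r1, r2, r3, hbig, -List.getD_eq_getElem?_getD]
    omega
  rintro _ rfl
  generalize hs₁ : runAssigns recL s = s₁
  have hm₁ : s₁.mem = s.mem := by subst hs₁; rfl
  have hr₁ : ∀ i < 8, s₁.reg i = s.reg i := by
    intro i hi
    have : i ≠ 8 ∧ i ≠ 9 ∧ i ≠ 10 ∧ i ≠ 11 ∧ i ≠ 12 := by omega
    subst hs₁
    simp [runAssigns, recL, this]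
  have e8 : s₁.reg 8 = (encodeKind (T.kind t)).getD 0 0 := by
    subst hs₁; simp [runAssigns, recL, h4, h7, r0]
  have e9 : s₁.reg 9 = (encodeKind (T.kind t)).getD 1 0 := by
    subst hs₁; simp [runAssigns, recL, h4, h7, r1]
  have e10 : s₁.reg 10 = (encodeKind (T.kind t)).getD 2 0 := by
    subst hs₁; simp [runAssigns, recL, h4, h7, r2]
  have e11 : s₁.reg 11 = (encodeKind (T.kind t)).getD 3 0 := by
    subst hs₁; simp [runAssigns, recL, h4, h7, r3]
  have e12 : s₁.reg 12 = T.bigNode t := by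
    subst hs₁; simp [runAssigns, recL, h4, h7, r0, r1, hbig, -List.getD_eq_getElem?_getD]
  clear hs₁
  refine ((does_powP (n := n) (N := N) (s := s₁) (dst := 13) (src := 10) (by norm_num)
    (by norm_num) (by rw [e10]; exact f2)).mono
    (powCost_mono (by rw [e10]; exact f2)) fun _ h => h).seq fun s₂ h₂ => ?_
  obtain ⟨hm₂, e13, hr₂⟩ := h₂
  have e11' : s₂.reg 11 = (encodeKind (T.kind t)).getD 3 0 :=
    (hr₂ 11 (by norm_num) (by norm_num)).trans e11
  refine ((does_powP (n := n) (N := N) (s := s₂) (dst := 14) (src := 11) (by norm_num)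
    (by norm_num) (by rw [e11']; exact f3)).mono
    (powCost_mono (by rw [e11']; exact f3)) fun _ h => h).seq fun s₃ h₃ => ?_
  obtain ⟨hm₃, e14, hr₃⟩ := h₃
  have hr₁₃ : ∀ i < 13, s₃.reg i = s₁.reg i := fun i hi =>
    (hr₃ i (by omega) (by omega)).trans (hr₂ i (by omega) (by omega))
  have hG₃ : Good T s₃ := hG.congr (fun i hi => (hr₁₃ i (by omega)).trans (hr₁ i (by omega)))
    (hm₃.trans (hm₂.trans hm₁))
  have hE₃ : NodeEnv T t s₃ :=
    ⟨(hr₁₃ 7 (by norm_num)).trans ((hr₁ 7 (by norm_num)).trans h7),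
      (hr₁₃ 8 (by norm_num)).trans e8, (hr₁₃ 9 (by norm_num)).trans e9,
      (hr₁₃ 10 (by norm_num)).trans e10, (hr₁₃ 11 (by norm_num)).trans e11,
      (hr₁₃ 12 (by norm_num)).trans e12,
      (hr₃ 13 (by norm_num) (by norm_num)).trans (e10 ▸ e13), e11' ▸ e14⟩
  refine (does_countP hG₃.reg1 (T.bag (T.bigNode t)) fun v => by
    rw [hE₃.reg12]; exact hG₃.bag v).seq fun s₄ h₄ => ?_
  obtain ⟨hm₄, e15, hr₄⟩ := h₄
  have hG₄ : Good T s₄ := hG₃.congr (fun i hi => hr₄ i (by omega) (by omega)) hm₄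
  have hE₄ : NodeEnv T t s₄ := by
    obtain ⟨a1, a2, a3, a4, a5, a6, a7, a8⟩ := hE₃
    constructor <;> rw [hr₄ _ (by norm_num) (by norm_num)] <;> assumption
  refine (does_choices hS hG₄ hE₄ e15).mono ?_ ?_
  · gcongr
    · norm_num
    · exact hw _
  · rintro s' ⟨h1, h2⟩
    have hm : s₄.mem = s.mem := hm₄.trans (hm₃.trans (hm₂.trans hm₁))
    refine ⟨fun i hi => ?_, h2.good, hm ▸ h2.le, hm ▸ h2.reached⟩
    rw [h1 i (by omega), hr₄ i (by omega) (by omega), hr₁₃ i (by omega), hr₁ i hi]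

theorem nodes_lt (n N : ℕ) : N < 2 ^ wordLen n N := by
  have := inputLen_lt n N
  omega

/-- Nodes are visited by decreasing number, which need not respect the tree. A round thus promises
progress only at nodes whose children were good when it started. -/
theorem does_roundP (hS : T.IsSolution τ fl) {w : ℕ} (hw : ∀ t, (T.bag t).card ≤ w)
    {s : State} (hG : Good T s) :
    Does (wordLen n N) (loopP 7 (.reg 2) nodeP) s (3 + N * (nodeCost n N w + 8)) fun s' =>
      (∀ i < 7, s'.reg i = s.reg i) ∧ Progress T τ fl Set.univ s s' := by
  have he : (Ex.reg 2).eval s = N := hG.reg2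
  refine (Does.loop (k := nodeCost n N w) (wordLen_pos n N)
    (fun j s' => s'.reg 7 = j ∧ (∀ i < 7, s'.reg i = s.reg i) ∧
      Progress T τ fl {t | j ≤ (t : ℕ)} s s') (he ▸ nodes_lt n N) ?_ (fun _ _ h => h.1) ?_).mono
      (by rw [he]; rfl) fun s' h => ⟨h.2.1, ?_⟩
  · have hr : ∀ i < 7, (s.setReg 7 ((Ex.reg 2).eval s)).reg i = s.reg i := fun i hi => by
      rw [State.reg_setReg, if_neg (by omega)]
    refine ⟨by simp, hr, hG.congr (fun i hi => hr i (by omega)) rfl, fun _ _ => le_rfl, ?_⟩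
    intro t ht
    have := t.2
    rw [Set.mem_ofPred_eq, he] at ht
    omega
  · rintro j s' hj ⟨-, h2, h3⟩
    rw [he] at hj
    have hg : Good T (s'.setReg 7 j) :=
      h3.good.congr (fun i hi => by rw [State.reg_setReg, if_neg (by omega)]) rfl
    refine (does_nodeP hS hw (t := ⟨j, hj⟩) hg (by simp)).mono le_rfl ?_
    rintro s'' ⟨g1, g2⟩
    refine ⟨by simp [g1 7], fun i hi => ?_, g2.good, fun t' X => (h3.le t' X).trans (g2.le t' X),
      ?_⟩
    · rw [g1 i (by omega), State.reg_setReg, if_neg (by omega), h2 i hi]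
    intro t ht hc
    rcases Nat.lt_or_ge j t with hjt | hjt
    · exact (h3.reached t hjt hc).mono g2.le
    · have htj : t = ⟨j, hj⟩ := Fin.ext (le_antisymm hjt ht)
      exact g2.reached t htj fun c hcc => (hc c hcc).mono h3.le
  · exact ⟨h.2.2.good, h.2.2.le, fun t' _ => h.2.2.reached t' (Nat.zero_le _)⟩

/-- Each round gains one level of the tree, starting from the deepest. All depths are below `N`, so
the claim is empty before the first round. -/
theorem does_roundsP (hS : T.IsSolution τ fl) {w : ℕ} (hw : ∀ t, (T.bag t).card ≤ w)
    {s : State} (hG : Good T s) :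
    Does (wordLen n N) (loopP 6 (.reg 2) (loopP 7 (.reg 2) nodeP)) s
      (3 + N * (3 + N * (nodeCost n N w + 8) + 8)) fun s' =>
      Good T s' ∧ ∀ t, T.Reached τ fl (tabOf n s'.mem) t := by
  have he : (Ex.reg 2).eval s = N := hG.reg2
  refine (Does.loop (k := 3 + N * (nodeCost n N w + 8)) (wordLen_pos n N)
    (fun j s' => s'.reg 6 = j ∧ Good T s' ∧
      ∀ t, j ≤ T.tree.dist T.root t → T.Reached τ fl (tabOf n s'.mem) t)
      (he ▸ nodes_lt n N) ?_ (fun _ _ h => h.1) ?_).mono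
      (by rw [he]; rfl) fun s' h => ⟨h.2.1, fun t => h.2.2 t (Nat.zero_le _)⟩
  · refine ⟨by simp, hG.congr (fun i hi => by rw [State.reg_setReg, if_neg (by omega)]) rfl,
      fun t ht => ?_⟩
    have := T.dist_root_lt t
    rw [Fintype.card_fin] at this
    rw [he] at ht
    omega
  · rintro j s' - ⟨-, h2, h3⟩
    have hg : Good T (s'.setReg 6 j) :=
      h2.congr (fun i hi => by rw [State.reg_setReg, if_neg (by omega)]) rfl
    refine (does_roundP hS hw hg).mono le_rfl ?_
    rintro s'' ⟨g1, g2⟩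
    refine ⟨by simp [g1 6], g2.good, fun t ht => g2.reached t trivial fun c hc => h3 c ?_⟩
    have := hc.dist
    omega

/-- The positions in the input. -/
def initL : List (ℕ × Ex) :=
  [(1, .mem 0), (2, .mem 1), (3, 3 + .reg 1 * .reg 1 + .reg 2 * .reg 2),
   (4, .reg 3 + .reg 2 * .reg 1), (5, .reg 4 + .reg 2 * 4)]

/-- The result. -/
def finalL : List (ℕ × Ex) := [(0, .mem (.reg 5 + .mem 2) - 1)]

/-- The program. -/
def mainP : Prog :=
  assigns initL ;; loopP 6 (.reg 2) (loopP 7 (.reg 2) nodeP) ;; assigns finalL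

/-- A factor bounding the time of `mainP` if all bags have at most `w` elements. -/
def mainCost (n N w : ℕ) : ℕ :=
  assignsCost initL + (3 + N * (3 + N * (nodeCost n N w + 8) + 8) + assignsCost finalL)

/-- The empty bag at the root leaves a single state, with index 0. The two conclusions bound the
output from below by the fixed solution and from above by the existence of one with that many edges.
-/
theorem does_mainP (hS : T.IsSolution τ fl) {w : ℕ} (hw : ∀ t, (T.bag t).card ≤ w) :
    Does (wordLen n N) mainP (initState (encode G T)) (mainCost n N w) fun s' =>
      T.value τ fl T.root ≤ s'.reg 0 ∧ T.Justified T.root 0 (s'.reg 0 + 1) := by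
  have hl := wordLen_pos n N
  have hlt := inputLen_lt n N
  obtain ⟨m0, m1, m2⟩ := encode_head G T
  have hpos : 3 ≤ bagPos n N ∧ bagPos n N ≤ recPos n N ∧ recPos n N ≤ inputLen n N := by
    unfold inputLen recPos bagPos
    omega
  set s := initState (encode G T) with hs
  replace m0 : s.mem 0 = n := m0
  replace m1 : s.mem 1 = N := m1
  have hb : 3 + n * n + N * N = bagPos n N := rfl
  have hrp : bagPos n N + N * n = recPos n N := rfl
  have hil : recPos n N + N * 4 = inputLen n N := rfl
  refine (Does.assigns hl ?_).seq ?_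
  · simp [AssignsLt, initL, m0, m1, hb, hrp, hil]
    omega
  rintro _ rfl
  -- Memory beyond the input is zero, so the empty tables are vacuously justified.
  have hG : Good T (runAssigns initL s) := by
    refine ⟨?_, ?_, ?_, ?_, ?_, fun a _ => rfl, fun t X h => absurd ?_ h⟩
    · simp [runAssigns, initL, m0]
    · simp [runAssigns, initL, m1]
    · simp [runAssigns, initL, m0, m1, hb]
    · simp [runAssigns, initL, m0, m1, hb, hrp]
    · simp [runAssigns, initL, m0, m1, hb, hrp, hil]
    · change (encode G T).getD _ 0 = 0
      refine List.getD_eq_default _ _ ?_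
      rw [length_encode]
      omega
  refine (does_roundsP hS hw hG).seq ?_
  rintro s₁ ⟨hG₁, hR⟩
  refine Does.of_bnd fun hbnd => ?_
  have e : (Ex.mem (.reg 5 + .mem 2) - 1).eval s₁ = tabOf n s₁.mem T.root 0 - 1 := by
    have h2 : s₁.mem 2 = T.root := (hG₁.low 2 (by omega)).trans m2
    simp [tabOf, hG₁.reg5, h2]
  refine (Does.assigns (L := finalL) (s := s₁) hl (And.intro ?_ trivial)).mono le_rfl ?_
  · exact e ▸ (Nat.sub_le _ _).trans_lt (hbnd.2 _)
  rintro _ rfl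
  have e0 : (runAssigns finalL s₁).reg 0 = tabOf n s₁.mem T.root 0 - 1 := by
    rw [← e]
    simp [runAssigns, finalL]
  have hroot : idx (T.state τ fl T.root) = 0 := by
    simp [idx, NiceTreeDecomposition.state, T.root_bag]
  have h := hR T.root
  unfold NiceTreeDecomposition.Reached at h
  rw [hroot] at h
  refine ⟨by omega, ?_⟩
  rw [e0, Nat.sub_add_cancel (by omega)]
  exact hG₁.just _ _

end

/-! ### The running time and the main theorem -/

theorem exists_nodeCost_le :
    ∃ A, ∀ n N w : ℕ, nodeCost n N w ≤ A * (16 ^ w * (n + N + 1)) := by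
  unfold nodeCost powCost countCost stepCost decodeCost
  generalize assignsCost recL = c₁
  generalize (1 : Ex).cost = c₂
  generalize assignsCost [(0, .reg 0 * 24)] = c₃
  generalize assignsCost [(15, .reg 15 * (1 + 15 * bitE))] = c₄
  generalize assignsCost decodeInit = c₅
  generalize assignsCost decodeStep = c₆
  generalize (caseCost + ((Ex.reg 5 + .reg 23 * .reg 2 + .reg 7).cost +
    ((tabE (.reg 7) (.reg 23)).max (.reg 24)).cost +
    (Ex.reg 5 + .reg 23 * .reg 2 + .reg 7).wt + 1)) = c₇
  refine ⟨c₁ + 3 * c₂ + 2 * c₃ + c₄ + c₅ + c₆ + c₇ + 60, fun n N w => ?_⟩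
  have h1 : 1 ≤ 16 ^ w := Nat.one_le_pow _ _ (by norm_num)
  generalize 16 ^ w = z at *
  set q := n + N + 1 with hq
  have hz : q ≤ z * q := Nat.le_mul_of_pos_left _ h1
  have hn : n ≤ q := by omega
  have hnN : n + N ≤ q := by omega
  have hq1 : 1 ≤ q := by omega
  have e1 : ∀ c, (n + N) * c ≤ c * (z * q) := fun c => by
    rw [mul_comm]
    exact Nat.mul_le_mul_left _ (hnN.trans hz)
  have e2 : ∀ c, n * c ≤ c * (z * q) := fun c => by
    rw [mul_comm]
    exact Nat.mul_le_mul_left _ (hn.trans hz)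
  have e3 : ∀ c, c ≤ c * (z * q) := fun c => Nat.le_mul_of_pos_right _ (by positivity)
  have e4 : z * (c₅ + (1 + 2 + n * (c₆ + 8)) + c₇ + 8) ≤ (c₅ + c₆ + c₇ + 19) * (z * q) := by
    have : c₅ + (1 + 2 + n * (c₆ + 8)) + c₇ + 8 ≤ (c₅ + c₆ + c₇ + 19) * q := by nlinarith
    calc _ ≤ z * ((c₅ + c₆ + c₇ + 19) * q) := Nat.mul_le_mul_left _ this
      _ = _ := by ring
  have f1 := e3 c₁
  have f2 := e3 c₂
  have f3 := e1 (c₃ + 8)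
  have f4 := e2 (c₄ + 8)
  have f5 := e3 1
  rw [← hq] at *
  nlinarith

/-- Two nested loops over the nodes multiply the linear factor in the cost of one node by a square.
-/
theorem exists_mainCost_le :
    ∃ A, ∀ n N w : ℕ, mainCost n N w ≤ A * (16 ^ w * (n + N + 1) ^ 3) := by
  obtain ⟨B, hB⟩ := exists_nodeCost_le
  unfold mainCost
  generalize assignsCost initL = c₁
  generalize assignsCost finalL = c₂
  refine ⟨c₁ + c₂ + B + 22, fun n N w => ?_⟩
  have h1 : 1 ≤ 16 ^ w := Nat.one_le_pow _ _ (by norm_num)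
  have h2 := hB n N w
  generalize nodeCost n N w = k at *
  generalize 16 ^ w = z at *
  have hN : N ≤ n + N + 1 := by omega
  have hq : 1 ≤ n + N + 1 := by omega
  generalize n + N + 1 = q at *
  have e1 : 1 ≤ z * q := Nat.mul_pos h1 hq
  have e2 : k + 8 ≤ (B + 8) * (z * q) := by nlinarith
  have e3 : N * (k + 8) ≤ (B + 8) * (z * q ^ 2) :=
    (Nat.mul_le_mul hN e2).trans
      (by rw [show q * ((B + 8) * (z * q)) = (B + 8) * (z * q ^ 2) by ring])
  have e4 : 1 ≤ z * q ^ 2 := Nat.mul_pos h1 (by positivity)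
  have e5 : 3 + N * (k + 8) + 8 ≤ (B + 19) * (z * q ^ 2) := by nlinarith
  have e6 : N * (3 + N * (k + 8) + 8) ≤ (B + 19) * (z * q ^ 3) :=
    (Nat.mul_le_mul hN e5).trans
      (by rw [show q * ((B + 19) * (z * q ^ 2)) = (B + 19) * (z * q ^ 3) by ring])
  have e7 : 1 ≤ z * q ^ 3 := Nat.mul_pos h1 (by positivity)
  nlinarith

/-- The quotient of a fixed power by an exponential tends to 0 and is therefore bounded. -/
theorem exists_pow_le_mul_two_pow (m : ℕ) : ∃ B : ℕ, ∀ k : ℕ, (k + 1) ^ m ≤ B * 2 ^ k := by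
  obtain ⟨b, hb⟩ :=
    (tendsto_pow_const_div_const_pow_of_one_lt m (r := (2 : ℝ)) (by norm_num)).bddAbove_range
  obtain ⟨B, hB⟩ := exists_nat_ge b
  refine ⟨B * 2, fun k => ?_⟩
  have h := (hb ⟨k + 1, rfl⟩).trans hB
  simp only at h
  rw [div_le_iff₀ (by positivity)] at h
  rw [mul_assoc, mul_comm 2, ← pow_succ]
  exact_mod_cast h

/-- With the word length included, the time is of order `16 ^ ω` times the fourth power of `n + N +
1`, which is polynomial in `(ω + 1) * (n + 1)`. The resulting power of `ω + 1` is at most a constant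
times `2 ^ ω`. -/
theorem exists_time_le (K : ℕ) : ∃ C c : ℕ, ∀ n N ω : ℕ, N ≤ K * ((ω + 1) * (n + 1)) ^ K →
    mainCost n N (ω + 1) * wordLen n N ≤ C * 45 ^ ω * (n + 1) ^ c := by
  obtain ⟨A, hA⟩ := exists_mainCost_le
  obtain ⟨B, hB⟩ := exists_pow_le_mul_two_pow (4 * (K + 1))
  -- Here 320 = 16 · 20: bags have up to `ω + 1` vertices, and the word length is at most `20 * (n +
  -- N + 1)`.
  refine ⟨A * 320 * (K + 1) ^ 4 * B, 4 * (K + 1), fun n N ω hN => ?_⟩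
  have hq : n + N + 1 ≤ (K + 1) * ((ω + 1) * (n + 1)) ^ (K + 1) := by
    have hp : 1 ≤ (ω + 1) * (n + 1) := Nat.mul_pos (by omega) (by omega)
    have hn : n + 1 ≤ (ω + 1) * (n + 1) := Nat.le_mul_of_pos_left _ (by omega)
    generalize (ω + 1) * (n + 1) = p at *
    have h1 : p ^ K ≤ p ^ (K + 1) := Nat.pow_le_pow_right hp (by omega)
    have h2 : p ≤ p ^ (K + 1) := Nat.le_self_pow (by omega) _
    nlinarith
  have hw : wordLen n N ≤ 20 * (n + N + 1) := by unfold wordLen; omega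
  calc mainCost n N (ω + 1) * wordLen n N
      ≤ A * (16 ^ (ω + 1) * (n + N + 1) ^ 3) * (20 * (n + N + 1)) := Nat.mul_le_mul (hA _ _ _) hw
    _ = A * 320 * 16 ^ ω * (n + N + 1) ^ 4 := by ring
    _ ≤ A * 320 * 16 ^ ω * ((K + 1) * ((ω + 1) * (n + 1)) ^ (K + 1)) ^ 4 := by gcongr
    _ = A * 320 * (K + 1) ^ 4 * 16 ^ ω * (ω + 1) ^ (4 * (K + 1)) * (n + 1) ^ (4 * (K + 1)) := by
        rw [mul_pow, ← pow_mul, mul_pow, mul_comm (K + 1) 4]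
        ring
    _ ≤ A * 320 * (K + 1) ^ 4 * 16 ^ ω * (B * 2 ^ ω) * (n + 1) ^ (4 * (K + 1)) := by
        gcongr
        exact hB ω
    _ = A * 320 * (K + 1) ^ 4 * B * (16 * 2) ^ ω * (n + 1) ^ (4 * (K + 1)) := by
        rw [mul_pow]
        ring
    _ ≤ A * 320 * (K + 1) ^ 4 * B * 45 ^ ω * (n + 1) ^ (4 * (K + 1)) := by
        gcongr
        norm_num

theorem exists_isMinimalEdgeDominating {V : Type*} [Finite V] (G : SimpleGraph V) :
    ∃ M, IsMinimalEdgeDominating G M := by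
  classical
  have := Fintype.ofFinite V
  have h : IsEdgeDominating G G.edgeFinset :=
    ⟨by simp, fun e he hn => absurd (SimpleGraph.mem_edgeFinset.2 he) hn⟩
  obtain ⟨M, hM, hmin⟩ := wellFounded_lt.has_min {M : Finset (Sym2 V) | IsEdgeDominating G M} ⟨_, h⟩
  exact ⟨M, hM, fun M' hlt hM' => hmin M' hM' hlt⟩

theorem exists_isUpperEDSNumber {V : Type*} [Finite V] (G : SimpleGraph V) :
    ∃ k, IsUpperEDSNumber G k := by
  classical
  have := Fintype.ofFinite V
  obtain ⟨M, hM⟩ := exists_isMinimalEdgeDominating G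
  refine BddAbove.exists_isGreatest_of_nonempty ?_ ⟨M.card, M, hM, rfl⟩
  refine ⟨Fintype.card (Sym2 V), ?_⟩
  rintro _ ⟨M, -, rfl⟩
  exact Finset.card_le_univ M

theorem bnd_initState {n N : ℕ} {G : SimpleGraph (Fin n)} (T : NiceTreeDecomposition G (Fin N)) :
    Bnd (wordLen n N) (initState (encode G T)) := by
  have h := inputLen_lt n N
  refine ⟨fun r => by positivity, fun a => ?_⟩
  have := encode_le G T a
  change (encode G T).getD a 0 < _
  omega

/-- The analysis is run with the solution of an optimal set, so the output is at least `k`. -/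
theorem computes_mainP {n N w k : ℕ} {G : SimpleGraph (Fin n)}
    (T : NiceTreeDecomposition G (Fin N)) (hw : ∀ t, (T.bag t).card ≤ w)
    (hk : IsUpperEDSNumber G k) :
    ∃ t ≤ mainCost n N w * wordLen n N, ComputesInTime mainP (encode G T) k t := by
  obtain ⟨⟨M, hM, hMk⟩, hmax⟩ := hk
  obtain ⟨τ, fl, hS, hsum⟩ := T.exists_isSolution hM
  obtain ⟨t, m, s, h1, h2, -, ⟨h3, h4⟩, h5⟩ :=
    does_mainP hS hw (bnd_initState T) (initState (encode G T)) ⟨fun _ => rfl, rfl⟩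
  refine ⟨t, h5, m, h1, (h2.1 0).trans ?_⟩
  have hv : T.value τ fl T.root = k := by
    have hd : T.desc T.root = Finset.univ := Finset.eq_univ_iff_forall.2 fun s => T.mem_desc_root s
    rw [NiceTreeDecomposition.value, hd, hsum, hMk]
  -- Conversely, the justified root entry yields a minimal edge dominating set whose size is the
  -- output, which by optimality is at most `k`.
  obtain ⟨σ, -, hr⟩ := h4 (Nat.succ_ne_zero _)
  obtain ⟨τ', fl', hS', hv'⟩ := hr.root
  obtain ⟨M', hM', hc⟩ := hS'.exists_minimal
  have := hmax ⟨M', hM', rfl⟩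
  omega

end UpperEDS

theorem mainTheorem2 :
    ∃ P : UpperEDS.Prog, ∀ K : ℕ, ∃ C c : ℕ,
      ∀ (n N ω : ℕ) (G : SimpleGraph (Fin n))
        (T : UpperEDS.NiceTreeDecomposition G (Fin N)),
        T.width ≤ (ω : ℤ) →
        N ≤ K * ((ω + 1) * (n + 1)) ^ K →
        ∃ k t : ℕ, UpperEDS.IsUpperEDSNumber G k ∧
          UpperEDS.ComputesInTime P (UpperEDS.encode G T) k t ∧
          t ≤ C * 45 ^ ω * (n + 1) ^ c := by
  refine ⟨UpperEDS.mainP, fun K => ?_⟩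
  obtain ⟨C, c, hC⟩ := UpperEDS.exists_time_le K
  refine ⟨C, c, fun n N ω G T hw hN => ?_⟩
  obtain ⟨k, hk⟩ := UpperEDS.exists_isUpperEDSNumber G
  have hbag : ∀ t, (T.bag t).card ≤ ω + 1 := by
    intro t
    have h : (T.bag t).card ≤ Finset.univ.sup fun t => (T.bag t).card :=
      Finset.le_sup (f := fun t => (T.bag t).card) (Finset.mem_univ t)
    unfold UpperEDS.TreeDecomposition.width at hw
    omega
  obtain ⟨t, ht, hcomp⟩ := UpperEDS.computes_mainP T hbag hk
  exact ⟨k, t, hk, hcomp, ht.trans (hC n N ω hN)⟩
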